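/- For nonempty polygonal curves $P,Q$ (finite sequences of points) in $\mathbb{R}^d$, a paired walk along $P$ and $Q$ is a sequence $(\mathcal P_1,\mathcal Q_1),\dots,(\mathcal P_t,\mathcal Q_t)$, where $\mathcal P_1,\dots,\mathcal P_t$ and $\mathcal Q_1,\dots,\mathcal Q_t$ are partitions of $P$ and of $Q$ into consecutive nonempty subcurves and, for each $i$, $|\mathcal P_i|=1$ or $|\mathcal Q_i|=1$. Its cost is the maximum of $\|p-q\|_2$ over all $i$ and all $p\in\mathcal P_i$, $q\in\mathcal Q_i$. The discrete Fréchet distance $d_{dF}(P,Q)$ is the minimum cost of a paired walk along $P$ and $Q$. Theorem. Let $d\ge 1$, let $P=(p_1,\dots,p_m)$ be a curve of $m$ points in $\mathbb{R}^d$, let $1\le k\le m$ and $\varepsilon\in(0,\frac12)$. On the real RAM with integer words of $O(\log(md/\varepsilon))$ bits, there is a data structure that occupies $O(mkd\log\frac mk)$ memory cells (and $O(md)$ cells in the trivial case $k=m$), such that, given indices $1\le i<j\le m$, a query algorithm with access to the data structure only returns in $O(kd)$ time a nonempty curve $\Pi$ of at most $2k$ points such that $$d_{dF}(P[i,j],\Pi)\le(1+\varepsilon)\,d_{dF}(P[i,j],\Pi')$$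 for every nonempty curve $\Pi'$ in $\mathbb{R}^d$ of at most $k$ points, where $P[i,j]=(p_i,\dots,p_j)$. The constants in the space and query bounds are absolute. Such a data structure can be computed from $P,k,\varepsilon$ in time $\tilde O(m^2d\,\varepsilon^{-4.5})$, that is, $C\,m^2d\,\varepsilon^{-4.5}\log_2^{c}(md/\varepsilon)$ with absolute constants $C,c$. For fixed $d$, such a data structure can also be computed in time $\tilde O(m^2/\varepsilon)$, that is, $C_d\,m^2\varepsilon^{-1}\log_2^{c_d}(m/\varepsilon)$ with constants $C_d,c_d$ that depend only on $d$ (the constant in the word length may then depend on $d$ too). -/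

import Mathlib

/-! ## Curves and the discrete Fréchet distance

A polygonal curve in `ℝ^d` is the nonempty list of its points. -/

abbrev Point (d : ℕ) : Type := EuclideanSpace ℝ (Fin d)

/-- The subcurve `P[i,j] = (p_i, …, p_j)`, with indices starting at `1`. -/
def subcurve {d : ℕ} (P : List (Point d)) (i j : ℕ) : List (Point d) :=
  (P.drop (i - 1)).take (j + 1 - i)

/-- A paired walk along `P` and `Q`: consecutive nonempty subcurves `𝒫₁, …, 𝒫ₜ` that make up `P` and
`𝒬₁, …, 𝒬ₜ` that make up `Q`, such that for every index one of the two is a single point. -/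
structure IsPairedWalk {d : ℕ} (P Q : List (Point d))
    (ω : List (List (Point d) × List (Point d))) : Prop where
  left : (ω.map Prod.fst).flatten = P
  right : (ω.map Prod.snd).flatten = Q
  left_ne_nil : ∀ b ∈ ω, b.1 ≠ []
  right_ne_nil : ∀ b ∈ ω, b.2 ≠ []
  single : ∀ b ∈ ω, b.1.length = 1 ∨ b.2.length = 1

/-- The cost of a paired walk: the maximum distance over all matched pairs (a finite set). -/
noncomputable def walkCost {d : ℕ} (ω : List (List (Point d) × List (Point d))) : ℝ :=
  sSup {r : ℝ | ∃ b ∈ ω, ∃ p ∈ b.1, ∃ q ∈ b.2, r = ‖p - q‖}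

/-- The discrete Fréchet distance of two (nonempty) curves: the minimum cost of a paired walk. There
are finitely many paired walks, and at least one if both curves are nonempty. -/
noncomputable def dfd {d : ℕ} (P Q : List (Point d)) : ℝ :=
  sInf {r : ℝ | ∃ ω, IsPairedWalk P Q ω ∧ r = walkCost ω}

/-- `S` is an `(α, k, γ)`-simplification of `P`: it has at most `α * k` points, and its distance to `P` is at most `γ` times the distance to `P`
of any curve with at most `k` points. -/
def IsSimplification {d : ℕ} (α : ℝ) (k : ℕ) (γ : ℝ) (P S : List (Point d)) : Prop :=
  S ≠ [] ∧ (S.length : ℝ) ≤ α * k ∧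
    ∀ S' : List (Point d), S' ≠ [] → S'.length ≤ k → dfd P S ≤ γ * dfd P S'

/-! ## The real RAM

A random access machine that works on integer words of `w` bits and on real numbers. It has finitely
many integer and real registers and arrays (those named in the program), all of whose cells are
initially `0` unless they hold input. It can read and write an array at a computed address, and it
performs the word operations, the real operations `+, -, *, /, √`, and comparisons, at unit cost.
There are no real constants other than integers, and a real cannot be rounded to an integer. -/

inductive IOp where
  | add | sub | mul | div | mod | land | lor | xor

/-- Subtraction is truncated at `0`, and division is rounded down. -/
def IOp.eval : IOp → ℕ → ℕ → ℕ
  | add, x, y => x + y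
  | sub, x, y => x - y
  | mul, x, y => x * y
  | div, x, y => x / y
  | mod, x, y => x % y
  | land, x, y => x &&& y
  | lor, x, y => x ||| y
  | xor, x, y => x ^^^ y

inductive ROp where
  | add | sub | mul | div

/-- Dividing by `0` gives `0`; a program can test the divisor before it divides. -/
noncomputable def ROp.eval : ROp → ℝ → ℝ → ℝ
  | add, x, y => x + y
  | sub, x, y => x - y
  | mul, x, y => x * y
  | div, x, y => x / y

/-- The memory: integer registers, real registers, integer arrays, real arrays. The first argument of
`iarr` and `rarr` is the name of the array, the second one the address in it. -/
structure Memory where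
  ireg : ℕ → ℕ
  rreg : ℕ → ℝ
  iarr : ℕ → ℕ → ℕ
  rarr : ℕ → ℕ → ℝ

/-- Integer expressions: constants, registers, array cells, operations. -/
inductive IExp where
  | lit (n : ℕ)
  | reg (x : ℕ)
  | get (a : ℕ) (i : IExp)
  | bin (o : IOp) (e f : IExp)

def IExp.eval (s : Memory) : IExp → ℕ
  | lit n => n
  | reg x => s.ireg x
  | get a i => s.iarr a (i.eval s)
  | bin o e f => o.eval (e.eval s) (f.eval s)

/-- Every operand and every operation costs one step. -/
def IExp.cost : IExp → ℕ
  | lit _ => 1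
  | reg _ => 1
  | get _ i => i.cost + 1
  | bin _ e f => e.cost + f.cost + 1

/-- Real expressions: integers, registers, array cells, operations, square roots. -/
inductive RExp where
  | cast (e : IExp)
  | reg (x : ℕ)
  | get (a : ℕ) (i : IExp)
  | bin (o : ROp) (e f : RExp)
  | sqrt (e : RExp)

noncomputable def RExp.eval (s : Memory) : RExp → ℝ
  | cast e => (e.eval s : ℝ)
  | reg x => s.rreg x
  | get a i => s.rarr a (i.eval s)
  | bin o e f => o.eval (e.eval s) (f.eval s)
  | sqrt e => Real.sqrt (e.eval s)

def RExp.cost : RExp → ℕ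
  | cast e => e.cost + 1
  | reg _ => 1
  | get _ i => i.cost + 1
  | bin _ e f => e.cost + f.cost + 1
  | sqrt e => e.cost + 1

/-- Conditions: comparisons of integers, comparisons of reals, Boolean combinations. -/
inductive BExp where
  | ile (e f : IExp)
  | rle (e f : RExp)
  | not (b : BExp)
  | and (b c : BExp)

def BExp.holds (s : Memory) : BExp → Prop
  | ile e f => e.eval s ≤ f.eval s
  | rle e f => e.eval s ≤ f.eval s
  | not b => ¬ b.holds s
  | and b c => b.holds s ∧ c.holds s

def BExp.cost : BExp → ℕ
  | ile e f => e.cost + f.cost + 1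
  | rle e f => e.cost + f.cost + 1
  | not b => b.cost + 1
  | and b c => b.cost + c.cost + 1

/-- Programs: assignments to registers (`iset`, `rset`) and to array cells (`iput`, `rput`),
sequential composition, conditionals, and while loops. -/
inductive Prog where
  | skip
  | iset (x : ℕ) (e : IExp)
  | rset (x : ℕ) (e : RExp)
  | iput (a : ℕ) (i e : IExp)
  | rput (a : ℕ) (i : IExp) (e : RExp)
  | seq (c c' : Prog)
  | ite (b : BExp) (c c' : Prog)
  | loop (b : BExp) (c : Prog)

def Memory.iset (s : Memory) (x v : ℕ) : Memory :=
  { s with ireg := Function.update s.ireg x v }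

def Memory.rset (s : Memory) (x : ℕ) (v : ℝ) : Memory :=
  { s with rreg := Function.update s.rreg x v }

def Memory.iput (s : Memory) (a i v : ℕ) : Memory :=
  { s with iarr := Function.update s.iarr a (Function.update (s.iarr a) i v) }

def Memory.rput (s : Memory) (a i : ℕ) (v : ℝ) : Memory :=
  { s with rarr := Function.update s.rarr a (Function.update (s.rarr a) i v) }

/-- `Runs w c s t n`: with words of `w` bits, the program `c` started in memory `s` halts in memory `t`
after `n` steps. Storing an integer that does not fit into a word, or using such an integer as the
address of a write, leaves the machine stuck. -/
inductive Runs (w : ℕ) : Prog → Memory → Memory → ℕ → Prop where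
  | skip (s : Memory) : Runs w .skip s s 1
  | iset (s : Memory) (x : ℕ) (e : IExp) (h : e.eval s < 2 ^ w) :
      Runs w (.iset x e) s (s.iset x (e.eval s)) (e.cost + 1)
  | rset (s : Memory) (x : ℕ) (e : RExp) :
      Runs w (.rset x e) s (s.rset x (e.eval s)) (e.cost + 1)
  | iput (s : Memory) (a : ℕ) (i e : IExp) (hi : i.eval s < 2 ^ w) (h : e.eval s < 2 ^ w) :
      Runs w (.iput a i e) s (s.iput a (i.eval s) (e.eval s)) (i.cost + e.cost + 1)
  | rput (s : Memory) (a : ℕ) (i : IExp) (e : RExp) (hi : i.eval s < 2 ^ w) :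
      Runs w (.rput a i e) s (s.rput a (i.eval s) (e.eval s)) (i.cost + e.cost + 1)
  | seq {c c' : Prog} {s t u : Memory} {n n' : ℕ} (h : Runs w c s t n) (h' : Runs w c' t u n') :
      Runs w (.seq c c') s u (n + n')
  | ite_true {b : BExp} {c : Prog} (c' : Prog) {s t : Memory} {n : ℕ} (hb : b.holds s)
      (h : Runs w c s t n) : Runs w (.ite b c c') s t (b.cost + n + 1)
  | ite_false {b : BExp} (c : Prog) {c' : Prog} {s t : Memory} {n : ℕ} (hb : ¬ b.holds s)
      (h : Runs w c' s t n) : Runs w (.ite b c c') s t (b.cost + n + 1)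
  | loop_done {b : BExp} (c : Prog) {s : Memory} (hb : ¬ b.holds s) :
      Runs w (.loop b c) s s (b.cost + 1)
  | loop_step {b : BExp} {c : Prog} {s t u : Memory} {n n' : ℕ} (hb : b.holds s)
      (h : Runs w c s t n) (h' : Runs w (.loop b c) t u n') :
      Runs w (.loop b c) s u (b.cost + n + n' + 1)

/-! ## Data structures -/

/-- A data structure is a finite sequence of words together with a finite sequence of reals. -/
structure DataStructure where
  words : List ℕ
  reals : List ℝ

/-- The space of a data structure: the number of cells it occupies. -/
def DataStructure.space (D : DataStructure) : ℕ := D.words.length + D.reals.length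

/-- The input of the preprocessing: `m, k, d` in the integer registers `0, 1, 2`, `ε` in the real
register `0`, and the coordinates of the points of `P`, point after point, in the real array `0`. -/
noncomputable def prepInput {d : ℕ} (P : List (Point d)) (k : ℕ) (ε : ℝ) : Memory where
  ireg x := [P.length, k, d].getD x 0
  rreg x := [ε].getD x 0
  iarr _ _ := 0
  rarr a x := if a = 0 then (P.flatMap fun p => List.ofFn fun b : Fin d => p b).getD x 0 else 0

/-- The output of the preprocessing: the beginnings of the integer array `1` and of the real array
`1`, with lengths given by the integer registers `0` and `1`. -/
def prepOutput (t : Memory) : DataStructure where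
  words := (List.range (t.ireg 0)).map (t.iarr 1)
  reals := (List.range (t.ireg 1)).map (t.rarr 1)

/-- The input of a query: the indices in the integer registers `0, 1`, and the data structure in the
integer array `0` and the real array `0`. Nothing else is known to the query program. -/
noncomputable def queryInput (D : DataStructure) (i j : ℕ) : Memory where
  ireg x := [i, j].getD x 0
  rreg _ := 0
  iarr a x := if a = 0 then D.words.getD x 0 else 0
  rarr a x := if a = 0 then D.reals.getD x 0 else 0

/-- The output of a query: a curve whose number of points is in the integer register `0`, and whose
coordinates are, point after point, in the real array `1`. -/
noncomputable def queryOutput (d : ℕ) (t : Memory) : List (Point d) :=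
  (List.range (t.ireg 0)).map fun a => WithLp.toLp 2 fun b : Fin d => t.rarr 1 (a * d + b)

/-- With words of `w` bits, the preprocessing program `prep` turns `P`, `k`, `ε` in at most `prepTime`
steps into a data structure of at most `space` cells, from which the program `query` obtains, for all
`1 ≤ i < j ≤ |P|`, in at most `queryTime` steps, a curve with at most `2k` points whose distance to
`P[i,j]` is at most `1 + ε` times that of any curve with at most `k` points. -/
def ZoomsIn (prep query : Prog) (w : ℕ) {d : ℕ} (P : List (Point d)) (k : ℕ) (ε : ℝ)
    (space queryTime prepTime : ℝ) : Prop :=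
  ∃ (t : Memory) (n : ℕ), Runs w prep (prepInput P k ε) t n ∧ (n : ℝ) ≤ prepTime ∧
    ((prepOutput t).space : ℝ) ≤ space ∧
    ∀ i j : ℕ, 1 ≤ i → i < j → j ≤ P.length →
      ∃ (t' : Memory) (n' : ℕ), Runs w query (queryInput (prepOutput t) i j) t' n' ∧
        (n' : ℝ) ≤ queryTime ∧
        IsSimplification 2 k (1 + ε) (subcurve P i j) (queryOutput d t')

/-- The space bound, up to a constant factor: `m k d log (m / k)`, and `m d` in the trivial case
`k = m`, where the logarithm vanishes. -/
noncomputable def spaceBound (m k d : ℕ) : ℝ :=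
  if k < m then m * k * d * Real.logb 2 (m / k) else m * d

/-! ## Program notation -/

/-! A paired walk of cost `ρ` between `P[i,j]` and a curve of at most `k` points cuts `P[i,j]` into
at most `k` consecutive runs, each inside a ball of radius `ρ`; conversely, the centres of such
balls form a curve at distance at most `ρ`. Simplification is thus a one-dimensional covering
problem. `Cov` serves for lower bounds and tolerates empty or overshooting runs; `BallCover` serves
for the curves produced and has the nonempty runs and exact ends that a walk demands. The bridge is
`cov_of_isPairedWalk`, `dfd_le_of_ballCover` and `isSimplification_of_ballCover`.

Queries. Covering part of an interval never needs a larger radius. So if an interval is cut in two,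
near-optimal covers of the parts by `k` balls each concatenate to a near-optimal curve of at most
`2k` points. At the highest bit `l` in which `a / k` and `b / k` differ, the end points `a < b` lie
in neighbouring blocks of `k * 2 ^ l` points, the first of even number (`div_two_pow_log_xor`). The
parts are then a suffix of an even block and a prefix of an odd one, so one stored cover per point
and level suffices. The number of levels is at most `log (m / k) + 1`, each cover takes `k * d`
reals, and a query copies two of them (`halts_answer`). An interval of at most `2k` points is its
own answer.

Preprocessing, with `e = ε / 8`. If `g` is the `k`-th largest gap between consecutive points of the
interval, the optimal radius lies between `g / 2` and `m * g` (`Cov.gap_le`, `cov_of_card_gaps_lt`),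
and bisection down to width `e * g` takes `O(log (m / ε))` rounds (`halts_search`). Each round
covers greedily (`halts_cover`). Minimum enclosing balls are replaced by a moving centre `c`: a
point `p` farther than `(1 + e) * r` from `c` pulls `c` to `c + e • (p - c)`. For each `q` within
`r` of all points seen, `‖c - q‖ ^ 2 + e / 4 * r ^ 2` shrinks by the factor `1 - e`
(`move_potential`), yet it never falls below `e / 4 * r ^ 2`. Hence after `T = O(log (1 / e) / e)`
moves no ball of radius `r` fits (`false_of_potential`). A cover costs `O(d * T * m)`, and all cells
together cost `m ^ 2 * d / ε` up to three logarithms. This lies below both claimed time bounds, so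
the same two programs prove both halves of the theorem.

The programs are verified in a small total-correctness calculus: `Halts` carries the step count, and
`Frame` says that whatever is not written stays unchanged. -/

instance (n : ℕ) : OfNat IExp n := ⟨.lit n⟩
instance : Add IExp := ⟨.bin .add⟩
instance : Sub IExp := ⟨.bin .sub⟩
instance : Mul IExp := ⟨.bin .mul⟩
instance : Div IExp := ⟨.bin .div⟩
instance : Mod IExp := ⟨.bin .mod⟩
instance (n : ℕ) : OfNat RExp n := ⟨.cast (.lit n)⟩
instance : Add RExp := ⟨.bin .add⟩
instance : Sub RExp := ⟨.bin .sub⟩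
instance : Mul RExp := ⟨.bin .mul⟩
instance : Div RExp := ⟨.bin .div⟩

/-- Sequential composition. -/
infixr:60 " ;; " => Prog.seq

/-- The strict comparison of integers. -/
def BExp.ilt (e f : IExp) : BExp := .ile (e + 1) f

/-- `for i = 0, …, e - 1 do c`. -/
def forLoop (i : ℕ) (e : IExp) (c : Prog) : Prog :=
  .iset i 0 ;; .loop (.ilt (.reg i) e) (c ;; .iset i (.reg i + 1))

section eval
variable (s : Memory)

@[simp] lemma IExp.eval_ofNat (n : ℕ) : IExp.eval s ofNat(n) = OfNat.ofNat n := rfl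
@[simp] lemma IExp.eval_zero : IExp.eval s 0 = 0 := rfl
@[simp] lemma IExp.eval_one : IExp.eval s 1 = 1 := rfl
@[simp] lemma IExp.eval_lit (n : ℕ) : IExp.eval s (.lit n) = n := rfl
@[simp] lemma IExp.eval_reg (x : ℕ) : IExp.eval s (.reg x) = s.ireg x := rfl
@[simp] lemma IExp.eval_get (a : ℕ) (i : IExp) : IExp.eval s (.get a i) = s.iarr a (i.eval s) := rfl
@[simp] lemma IExp.eval_add (e f : IExp) : (e + f).eval s = e.eval s + f.eval s := rfl
@[simp] lemma IExp.eval_sub (e f : IExp) : (e - f).eval s = e.eval s - f.eval s := rfl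
@[simp] lemma IExp.eval_mul (e f : IExp) : (e * f).eval s = e.eval s * f.eval s := rfl
@[simp] lemma IExp.eval_div (e f : IExp) : (e / f).eval s = e.eval s / f.eval s := rfl
@[simp] lemma IExp.eval_mod (e f : IExp) : (e % f).eval s = e.eval s % f.eval s := rfl
@[simp] lemma IExp.eval_xor (e f : IExp) :
    (IExp.bin .xor e f).eval s = e.eval s ^^^ f.eval s := rfl

@[simp] lemma IExp.cost_ofNat (n : ℕ) : IExp.cost ofNat(n) = 1 := rfl
@[simp] lemma IExp.cost_zero : IExp.cost 0 = 1 := rfl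
@[simp] lemma IExp.cost_one : IExp.cost 1 = 1 := rfl
@[simp] lemma IExp.cost_lit (n : ℕ) : IExp.cost (.lit n) = 1 := rfl
@[simp] lemma IExp.cost_reg (x : ℕ) : IExp.cost (.reg x) = 1 := rfl
@[simp] lemma IExp.cost_get (a : ℕ) (i : IExp) : IExp.cost (.get a i) = i.cost + 1 := rfl
@[simp] lemma IExp.cost_bin (o : IOp) (e f : IExp) :
    (IExp.bin o e f).cost = e.cost + f.cost + 1 := rfl
@[simp] lemma IExp.cost_add (e f : IExp) : (e + f).cost = e.cost + f.cost + 1 := rfl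
@[simp] lemma IExp.cost_sub (e f : IExp) : (e - f).cost = e.cost + f.cost + 1 := rfl
@[simp] lemma IExp.cost_mul (e f : IExp) : (e * f).cost = e.cost + f.cost + 1 := rfl
@[simp] lemma IExp.cost_div (e f : IExp) : (e / f).cost = e.cost + f.cost + 1 := rfl
@[simp] lemma IExp.cost_mod (e f : IExp) : (e % f).cost = e.cost + f.cost + 1 := rfl

@[simp] lemma RExp.eval_ofNat (n : ℕ) [n.AtLeastTwo] :
    RExp.eval s ofNat(n) = OfNat.ofNat n := rfl
@[simp] lemma RExp.eval_zero : RExp.eval s 0 = 0 := by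
  show ((0 : ℕ) : ℝ) = 0; simp
@[simp] lemma RExp.eval_one : RExp.eval s 1 = 1 := by
  show ((1 : ℕ) : ℝ) = 1; simp
@[simp] lemma RExp.eval_cast (e : IExp) : RExp.eval s (.cast e) = e.eval s := rfl
@[simp] lemma RExp.eval_reg (x : ℕ) : RExp.eval s (.reg x) = s.rreg x := rfl
@[simp] lemma RExp.eval_get (a : ℕ) (i : IExp) : RExp.eval s (.get a i) = s.rarr a (i.eval s) := rfl
@[simp] lemma RExp.eval_sqrt (e : RExp) : RExp.eval s (.sqrt e) = √(e.eval s) := rfl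
@[simp] lemma RExp.eval_add (e f : RExp) : (e + f).eval s = e.eval s + f.eval s := rfl
@[simp] lemma RExp.eval_sub (e f : RExp) : (e - f).eval s = e.eval s - f.eval s := rfl
@[simp] lemma RExp.eval_mul (e f : RExp) : (e * f).eval s = e.eval s * f.eval s := rfl
@[simp] lemma RExp.eval_div (e f : RExp) : (e / f).eval s = e.eval s / f.eval s := rfl

@[simp] lemma RExp.cost_ofNat (n : ℕ) : RExp.cost ofNat(n) = 2 := rfl
@[simp] lemma RExp.cost_zero : RExp.cost 0 = 2 := rfl
@[simp] lemma RExp.cost_one : RExp.cost 1 = 2 := rfl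
@[simp] lemma RExp.cost_cast (e : IExp) : RExp.cost (.cast e) = e.cost + 1 := rfl
@[simp] lemma RExp.cost_reg (x : ℕ) : RExp.cost (.reg x) = 1 := rfl
@[simp] lemma RExp.cost_get (a : ℕ) (i : IExp) : RExp.cost (.get a i) = i.cost + 1 := rfl
@[simp] lemma RExp.cost_sqrt (e : RExp) : RExp.cost (.sqrt e) = e.cost + 1 := rfl
@[simp] lemma RExp.cost_add (e f : RExp) : (e + f).cost = e.cost + f.cost + 1 := rfl
@[simp] lemma RExp.cost_sub (e f : RExp) : (e - f).cost = e.cost + f.cost + 1 := rfl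
@[simp] lemma RExp.cost_mul (e f : RExp) : (e * f).cost = e.cost + f.cost + 1 := rfl
@[simp] lemma RExp.cost_div (e f : RExp) : (e / f).cost = e.cost + f.cost + 1 := rfl

@[simp] lemma BExp.holds_ile (e f : IExp) : (BExp.ile e f).holds s ↔ e.eval s ≤ f.eval s := Iff.rfl
@[simp] lemma BExp.holds_ilt (e f : IExp) : (BExp.ilt e f).holds s ↔ e.eval s < f.eval s := Iff.rfl
@[simp] lemma BExp.holds_rle (e f : RExp) : (BExp.rle e f).holds s ↔ e.eval s ≤ f.eval s := Iff.rfl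
@[simp] lemma BExp.holds_not (b : BExp) : (BExp.not b).holds s ↔ ¬ b.holds s := Iff.rfl
@[simp] lemma BExp.holds_and (b c : BExp) : (BExp.and b c).holds s ↔ b.holds s ∧ c.holds s := Iff.rfl
@[simp] lemma BExp.cost_ile (e f : IExp) : (BExp.ile e f).cost = e.cost + f.cost + 1 := rfl
@[simp] lemma BExp.cost_ilt (e f : IExp) : (BExp.ilt e f).cost = e.cost + 1 + 1 + f.cost + 1 := rfl
@[simp] lemma BExp.cost_rle (e f : RExp) : (BExp.rle e f).cost = e.cost + f.cost + 1 := rfl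
@[simp] lemma BExp.cost_not (b : BExp) : (BExp.not b).cost = b.cost + 1 := rfl
@[simp] lemma BExp.cost_and (b c : BExp) : (BExp.and b c).cost = b.cost + c.cost + 1 := rfl

variable (x y a b i j v : ℕ) (r : ℝ)

@[simp] lemma iset_ireg : (s.iset x v).ireg y = if y = x then v else s.ireg y := by
  simp [Memory.iset, Function.update_apply]
@[simp] lemma iset_rreg : (s.iset x v).rreg = s.rreg := rfl
@[simp] lemma iset_iarr : (s.iset x v).iarr = s.iarr := rfl
@[simp] lemma iset_rarr : (s.iset x v).rarr = s.rarr := rfl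
@[simp] lemma rset_rreg : (s.rset x r).rreg y = if y = x then r else s.rreg y := by
  simp [Memory.rset, Function.update_apply]
@[simp] lemma rset_ireg : (s.rset x r).ireg = s.ireg := rfl
@[simp] lemma rset_iarr : (s.rset x r).iarr = s.iarr := rfl
@[simp] lemma rset_rarr : (s.rset x r).rarr = s.rarr := rfl
@[simp] lemma iput_ireg : (s.iput a i v).ireg = s.ireg := rfl
@[simp] lemma iput_rreg : (s.iput a i v).rreg = s.rreg := rfl
@[simp] lemma iput_rarr : (s.iput a i v).rarr = s.rarr := rfl
lemma iput_iarr : (s.iput a i v).iarr b =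
    if b = a then Function.update (s.iarr a) i v else s.iarr b := by
  simp [Memory.iput, Function.update_apply]
@[simp] lemma iput_iarr_same : (s.iput a i v).iarr a = Function.update (s.iarr a) i v := by
  simp [iput_iarr]
lemma iput_iarr_of_ne (h : b ≠ a) : (s.iput a i v).iarr b = s.iarr b := by
  simp [iput_iarr, h]
@[simp] lemma rput_ireg : (s.rput a i r).ireg = s.ireg := rfl
@[simp] lemma rput_rreg : (s.rput a i r).rreg = s.rreg := rfl
@[simp] lemma rput_iarr : (s.rput a i r).iarr = s.iarr := rfl
lemma rput_rarr : (s.rput a i r).rarr b =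
    if b = a then Function.update (s.rarr a) i r else s.rarr b := by
  simp [Memory.rput, Function.update_apply]
@[simp] lemma rput_rarr_same : (s.rput a i r).rarr a = Function.update (s.rarr a) i r := by
  simp [rput_rarr]
lemma rput_rarr_of_ne (h : b ≠ a) : (s.rput a i r).rarr b = s.rarr b := by
  simp [rput_rarr, h]

end eval

/-! ## Frames: what a program does not write, it does not change -/

/-- Whether a program assigns to the integer register `x`. -/
def Prog.setsI : Prog → ℕ → Bool
  | iset y _, x => y == x
  | seq c c', x => c.setsI x || c'.setsI x
  | ite _ c c', x => c.setsI x || c'.setsI x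
  | loop _ c, x => c.setsI x
  | _, _ => false

/-- Whether a program assigns to the real register `x`. -/
def Prog.setsR : Prog → ℕ → Bool
  | rset y _, x => y == x
  | seq c c', x => c.setsR x || c'.setsR x
  | ite _ c c', x => c.setsR x || c'.setsR x
  | loop _ c, x => c.setsR x
  | _, _ => false

/-- Whether a program writes to the integer array `a`. -/
def Prog.putsI : Prog → ℕ → Bool
  | iput b _ _, a => b == a
  | seq c c', a => c.putsI a || c'.putsI a
  | ite _ c c', a => c.putsI a || c'.putsI a
  | loop _ c, a => c.putsI a
  | _, _ => false

/-- Whether a program writes to the real array `a`. -/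
def Prog.putsR : Prog → ℕ → Bool
  | rput b _ _, a => b == a
  | seq c c', a => c.putsR a || c'.putsR a
  | ite _ c c', a => c.putsR a || c'.putsR a
  | loop _ c, a => c.putsR a
  | _, _ => false

/-- The memories `s` and `t` agree on everything that `c` does not write. -/
structure Frame (c : Prog) (s t : Memory) : Prop where
  ireg : ∀ x, c.setsI x = false → t.ireg x = s.ireg x
  rreg : ∀ x, c.setsR x = false → t.rreg x = s.rreg x
  iarr : ∀ a, c.putsI a = false → t.iarr a = s.iarr a
  rarr : ∀ a, c.putsR a = false → t.rarr a = s.rarr a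

lemma Frame.refl (c : Prog) (s : Memory) : Frame c s s :=
  ⟨fun _ _ => rfl, fun _ _ => rfl, fun _ _ => rfl, fun _ _ => rfl⟩

lemma Frame.trans {c : Prog} {s t u : Memory} (h : Frame c s t) (h' : Frame c t u) :
    Frame c s u :=
  ⟨fun x hx => (h'.ireg x hx).trans (h.ireg x hx), fun x hx => (h'.rreg x hx).trans (h.rreg x hx),
    fun x hx => (h'.iarr x hx).trans (h.iarr x hx), fun x hx => (h'.rarr x hx).trans (h.rarr x hx)⟩

lemma Frame.mono {c c' : Prog} {s t : Memory} (h : Frame c s t)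
    (h1 : ∀ x, c'.setsI x = false → c.setsI x = false)
    (h2 : ∀ x, c'.setsR x = false → c.setsR x = false)
    (h3 : ∀ x, c'.putsI x = false → c.putsI x = false)
    (h4 : ∀ x, c'.putsR x = false → c.putsR x = false) : Frame c' s t :=
  ⟨fun x hx => h.ireg x (h1 x hx), fun x hx => h.rreg x (h2 x hx),
    fun x hx => h.iarr x (h3 x hx), fun x hx => h.rarr x (h4 x hx)⟩

lemma Frame.seq_left {c c' : Prog} {s t : Memory} (h : Frame c s t) : Frame (c.seq c') s t := by
  refine h.mono ?_ ?_ ?_ ?_ <;> intro x hx <;>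
    simp_all [Prog.setsI, Prog.setsR, Prog.putsI, Prog.putsR]

lemma Frame.seq_right {c c' : Prog} {s t : Memory} (h : Frame c' s t) : Frame (c.seq c') s t := by
  refine h.mono ?_ ?_ ?_ ?_ <;> intro x hx <;>
    simp_all [Prog.setsI, Prog.setsR, Prog.putsI, Prog.putsR]

/-- The write sets are computed from the syntax, so for a concrete program and a concrete register
the side conditions of `Frame` hold by `rfl`. Invariants then need to mention only what changes. -/
lemma Runs.frame {w : ℕ} {c : Prog} {s t : Memory} {n : ℕ} (h : Runs w c s t n) :
    Frame c s t := by
  induction h with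
  | skip s => exact Frame.refl _ _
  | iset s x e h =>
    refine ⟨fun y hy => ?_, fun _ _ => rfl, fun _ _ => rfl, fun _ _ => rfl⟩
    have : x ≠ y := by simpa [Prog.setsI] using hy
    simp [this.symm]
  | rset s x e =>
    refine ⟨fun _ _ => rfl, fun y hy => ?_, fun _ _ => rfl, fun _ _ => rfl⟩
    have : x ≠ y := by simpa [Prog.setsR] using hy
    simp [this.symm]
  | iput s a i e hi h =>
    refine ⟨fun _ _ => rfl, fun _ _ => rfl, fun y hy => ?_, fun _ _ => rfl⟩
    have : a ≠ y := by simpa [Prog.putsI] using hy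
    exact iput_iarr_of_ne _ _ _ _ _ this.symm
  | rput s a i e hi =>
    refine ⟨fun _ _ => rfl, fun _ _ => rfl, fun _ _ => rfl, fun y hy => ?_⟩
    have : a ≠ y := by simpa [Prog.putsR] using hy
    exact rput_rarr_of_ne _ _ _ _ _ this.symm
  | seq _ _ ih ih' => exact ih.seq_left.trans ih'.seq_right
  | ite_true c' hb h ih =>
    refine ih.mono ?_ ?_ ?_ ?_ <;> intro x hx <;>
      simp_all [Prog.setsI, Prog.setsR, Prog.putsI, Prog.putsR]
  | ite_false c' hb h ih =>
    refine ih.mono ?_ ?_ ?_ ?_ <;> intro x hx <;>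
      simp_all [Prog.setsI, Prog.setsR, Prog.putsI, Prog.putsR]
  | loop_done c hb => exact Frame.refl _ _
  | loop_step hb h h' ih ih' =>
    exact Frame.trans (ih.mono (fun _ h => h) (fun _ h => h) (fun _ h => h) (fun _ h => h)) ih'

/-! ## Total correctness with step counts -/

/-- Started in `s`, the program `c` halts in some memory `t` after `n` steps, with `Q t n`. -/
def Halts (w : ℕ) (c : Prog) (s : Memory) (Q : Memory → ℕ → Prop) : Prop :=
  ∃ t n, Runs w c s t n ∧ Q t n

variable {w : ℕ} {c c' : Prog} {s : Memory} {Q Q' : Memory → ℕ → Prop}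

/-- The consequence rule, with the frame of the executed program supplied for free. -/
lemma Halts.imp (h : Halts w c s Q) (H : ∀ t n, Frame c s t → Q t n → Q' t n) :
    Halts w c s Q' := by
  obtain ⟨t, n, hr, hq⟩ := h
  exact ⟨t, n, hr, H t n hr.frame hq⟩

lemma halts_skip (h : Q s 1) : Halts w .skip s Q := ⟨s, 1, .skip s, h⟩

lemma halts_iset {x : ℕ} {e : IExp} (he : e.eval s < 2 ^ w)
    (h : Q (s.iset x (e.eval s)) (e.cost + 1)) : Halts w (.iset x e) s Q :=
  ⟨_, _, .iset s x e he, h⟩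

lemma halts_rset {x : ℕ} {e : RExp} (h : Q (s.rset x (e.eval s)) (e.cost + 1)) :
    Halts w (.rset x e) s Q :=
  ⟨_, _, .rset s x e, h⟩

lemma halts_iput {a : ℕ} {i e : IExp} (hi : i.eval s < 2 ^ w) (he : e.eval s < 2 ^ w)
    (h : Q (s.iput a (i.eval s) (e.eval s)) (i.cost + e.cost + 1)) : Halts w (.iput a i e) s Q :=
  ⟨_, _, .iput s a i e hi he, h⟩

lemma halts_rput {a : ℕ} {i : IExp} {e : RExp} (hi : i.eval s < 2 ^ w)
    (h : Q (s.rput a (i.eval s) (e.eval s)) (i.cost + e.cost + 1)) : Halts w (.rput a i e) s Q :=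
  ⟨_, _, .rput s a i e hi, h⟩

lemma halts_seq (h : Halts w c s fun t n => Halts w c' t fun u n' => Q u (n + n')) :
    Halts w (c ;; c') s Q := by
  obtain ⟨t, n, hr, u, n', hr', hq⟩ := h
  exact ⟨u, n + n', .seq hr hr', hq⟩

lemma halts_iset_seq {x : ℕ} {e : IExp} (he : e.eval s < 2 ^ w)
    (h : Halts w c' (s.iset x (e.eval s)) fun u n' => Q u (e.cost + 1 + n')) :
    Halts w (.iset x e ;; c') s Q :=
  halts_seq (halts_iset he h)

lemma halts_rset_seq {x : ℕ} {e : RExp}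
    (h : Halts w c' (s.rset x (e.eval s)) fun u n' => Q u (e.cost + 1 + n')) :
    Halts w (.rset x e ;; c') s Q :=
  halts_seq (halts_rset h)

lemma halts_ite {b : BExp} (ht : b.holds s → Halts w c s fun t n => Q t (b.cost + n + 1))
    (hf : ¬ b.holds s → Halts w c' s fun t n => Q t (b.cost + n + 1)) :
    Halts w (.ite b c c') s Q := by
  by_cases hb : b.holds s
  · obtain ⟨t, n, hr, hq⟩ := ht hb
    exact ⟨_, _, .ite_true c' hb hr, hq⟩
  · obtain ⟨t, n, hr, hq⟩ := hf hb
    exact ⟨_, _, .ite_false c hb hr, hq⟩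

/-- The rule for loops: the invariant `J v n t` speaks of a variant `v`, the number `n` of steps made
so far, and the current memory `t`. -/
lemma halts_loop {b : BExp} (J : ℕ → ℕ → Memory → Prop) {v₀ : ℕ} (h0 : J v₀ 0 s)
    (hstep : ∀ v n t, Frame c s t → J v n t → b.holds t →
      Halts w c t fun t' n' => ∃ v' < v, J v' (n + (b.cost + n' + 1)) t')
    (hexit : ∀ v n t, Frame c s t → J v n t → ¬ b.holds t → Q t (n + (b.cost + 1))) :
    Halts w (.loop b c) s Q := by
  suffices H : ∀ v n t, Frame c s t → J v n t →
      ∃ u n', Runs w (.loop b c) t u n' ∧ Q u (n + n') by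
    obtain ⟨u, n', hr, hq⟩ := H v₀ 0 s (Frame.refl _ _) h0
    exact ⟨u, n', hr, by simpa using hq⟩
  intro v
  induction v using Nat.strong_induction_on with
  | _ v ih =>
    intro n t hf hJ
    by_cases hb : b.holds t
    · obtain ⟨t', n', hr, v', hv, hJ'⟩ := hstep v n t hf hJ hb
      obtain ⟨u, n'', hr', hq⟩ := ih v' hv _ t' (hf.trans hr.frame) hJ'
      refine ⟨u, _, .loop_step hb hr hr', ?_⟩
      convert hq using 1
      omega
    · exact ⟨t, _, .loop_done c hb, hexit v n t hf hJ hb⟩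

/-- The rule for counting loops whose body takes at most `K` steps. -/
lemma halts_for {i : ℕ} {e : IExp} (N K : ℕ) (J : ℕ → Memory → Prop)
    (hi : c.setsI i = false) (hN : N < 2 ^ w)
    (he : ∀ n t, n ≤ N → Frame (forLoop i e c) s t → J n t → e.eval t = N)
    (h0 : J 0 (s.iset i 0))
    (hstep : ∀ n t, n < N → Frame (forLoop i e c) s t → t.ireg i = n → J n t →
      Halts w c t fun t' n' => n' ≤ K ∧ J (n + 1) (t'.iset i (n + 1)))
    (hQ : ∀ t n, Frame (forLoop i e c) s t → J N t → n ≤ N * (K + e.cost + 9) + e.cost + 7 →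
      Q t n) :
    Halts w (forLoop i e c) s Q := by
  have hfr : ∀ t, Frame (c ;; Prog.iset i (.reg i + 1)) (s.iset i 0) t →
      Frame (forLoop i e c) s t := by
    intro t hf
    have h1 : Runs w (.iset i 0) s (s.iset i 0) 2 := .iset s i 0 (by positivity)
    exact h1.frame.seq_left.trans (Frame.seq_right (hf.mono (fun _ h => h) (fun _ h => h)
      (fun _ h => h) (fun _ h => h)))
  refine halts_iset_seq (by positivity) ?_
  -- The variant `v` counts the rounds left, so the counter holds `N - v`. Besides the body, a round
  -- pays `e.cost + 9` for the guard, the loop step and the increment.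
  refine halts_loop (fun v n t => v ≤ N ∧ t.ireg i = N - v ∧ J (N - v) t ∧
    n ≤ (N - v) * (K + e.cost + 9)) (v₀ := N) (by simpa using h0) ?_ ?_
  · rintro v n t hf ⟨hv, hti, hJ, hn⟩ hb
    replace hf := hfr t hf
    have hev := he _ t (Nat.sub_le _ _) hf hJ
    simp only [BExp.holds_ilt, IExp.eval_reg, hti, hev] at hb
    have hbody := hstep _ t hb hf hti hJ
    refine halts_seq (hbody.imp ?_)
    rintro t' n' hf' ⟨hn', hJ'⟩
    have hti' : t'.ireg i = N - v := (hf'.ireg i hi).trans hti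
    have hvv : N - v + 1 = N - (v - 1) := by omega
    refine halts_iset (by simp [hti']; omega) ⟨v - 1, by omega, by omega, ?_, ?_, ?_⟩
    · simp [hti', hvv]
    · simpa [hti', hvv] using hJ'
    · simp only [BExp.cost_ilt, IExp.cost_reg, IExp.cost_add, IExp.cost_one]
      rw [← hvv, Nat.add_mul, Nat.one_mul]
      omega
  · rintro v n t hf ⟨hv, hti, hJ, hn⟩ hb
    replace hf := hfr t hf
    have hev := he _ t (Nat.sub_le _ _) hf hJ
    simp only [BExp.holds_ilt, IExp.eval_reg, hti, hev] at hb
    obtain rfl : v = 0 := by omega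
    refine hQ t _ hf (by simpa using hJ) ?_
    simp only [BExp.cost_ilt, IExp.cost_reg, IExp.cost_zero]
    simp only [Nat.sub_zero] at hn
    omega

/-- `for i = 0, …, len - 1` copy the cell `es + i` of the real array `src` to the cell `ed + i` of the
real array `dst`. -/
def copyReals (i dst : ℕ) (ed : IExp) (src : ℕ) (es len : IExp) : Prog :=
  forLoop i len (.rput dst (ed + .reg i) (.get src (es + .reg i)))

/-- The address and length expressions may read registers; it is enough that they keep their values
in every memory the copying can reach. Since `dst ≠ src`, the source is never overwritten. -/
lemma halts_copyReals {i dst src : ℕ} {ed es len : IExp} (D S N : ℕ) (hne : dst ≠ src)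
    (hw : D + N < 2 ^ w)
    (hD : ∀ t, Frame (copyReals i dst ed src es len) s t → ed.eval t = D)
    (hS : ∀ t, Frame (copyReals i dst ed src es len) s t → es.eval t = S)
    (hN : ∀ t, Frame (copyReals i dst ed src es len) s t → len.eval t = N) :
    Halts w (copyReals i dst ed src es len) s fun t n =>
      (∀ y, t.rarr dst y = if D ≤ y ∧ y < D + N then s.rarr src (S + (y - D)) else s.rarr dst y) ∧
      n ≤ N * (ed.cost + es.cost + len.cost + 15) + len.cost + 7 := by
  refine halts_for N (ed.cost + es.cost + 6) (fun n t => ∀ y, t.rarr dst y =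
    if D ≤ y ∧ y < D + n then s.rarr src (S + (y - D)) else s.rarr dst y) (by rfl) (by omega)
    (fun n t _ hf _ => hN t hf) ?_ ?_ ?_
  · intro y
    rw [if_neg (by omega)]
    rfl
  · intro n t hn hf hi hJ
    have h1 : t.rarr src = s.rarr src := hf.rarr src (by
      simp [forLoop, Prog.putsR, hne])
    refine halts_rput (by simp [hD t hf, hi]; omega) ⟨by simp; omega, ?_⟩
    intro y
    simp only [IExp.eval_add, hD t hf, hS t hf, hi, h1, RExp.eval_get, IExp.eval_reg, iset_rarr,
      rput_rarr_same, Function.update_apply, hJ y]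
    by_cases hy : y = D + n
    · subst hy
      simp
    · rw [if_neg hy]
      have : (D ≤ y ∧ y < D + n) ↔ (D ≤ y ∧ y < D + (n + 1)) := by omega
      simp [this]
  · intro t n hf hJ hn
    refine ⟨hJ, hn.trans (le_of_eq ?_)⟩
    ring

/-! ## Covering consecutive points by balls -/

/-- The point whose coordinates begin at the address `x`. -/
def pt (d : ℕ) (A : ℕ → ℝ) (x : ℕ) : Point d := WithLp.toLp 2 fun b : Fin d => A (x + b)

/-- The points `p y` with `a ≤ y < b` split into at most `k` consecutive runs, each contained in a
ball of radius `r`. -/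
def Cov {d : ℕ} (p : ℕ → Point d) (r : ℝ) : ℕ → ℕ → ℕ → Prop
  | 0, a, b => b ≤ a
  | k + 1, a, b => ∃ e c, (∀ y, a ≤ y → y < e → ‖p y - c‖ ≤ r) ∧ Cov p r k e b

/-- The points `p y` with `a ≤ y < b` split into consecutive nonempty runs contained in the balls of
radius `ρ` around the points of the list. -/
inductive BallCover {d : ℕ} (p : ℕ → Point d) (ρ : ℝ) : ℕ → ℕ → List (Point d) → Prop where
  | nil (a : ℕ) : BallCover p ρ a a []
  | cons {a e b : ℕ} {c : Point d} {S : List (Point d)} (hae : a < e)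
      (h : ∀ y, a ≤ y → y < e → ‖p y - c‖ ≤ ρ) (h' : BallCover p ρ e b S) : BallCover p ρ a b (c :: S)

section cover
variable {d : ℕ} {p : ℕ → Point d} {r ρ : ℝ} {k a b : ℕ}

/-- The same cuts serve the smaller interval, because `Cov` permits runs that are empty or end
beyond `b`. Together with `Cov.mono_right` this is what lets a query be cut in two. -/
lemma Cov.mono_left {a' : ℕ} (h : Cov p r k a b) (ha : a ≤ a') : Cov p r k a' b := by
  cases k with
  | zero => exact le_trans (show b ≤ a from h) ha
  | succ k =>
    obtain ⟨e, c, h1, h2⟩ := h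
    exact ⟨e, c, fun y hy hy' => h1 y (ha.trans hy) hy', h2⟩

lemma Cov.mono_right {b' : ℕ} (h : Cov p r k a b) (hb : b' ≤ b) : Cov p r k a b' := by
  induction k generalizing a with
  | zero => exact hb.trans (show b ≤ a from h)
  | succ k ih =>
    obtain ⟨e, c, h1, h2⟩ := h
    exact ⟨e, c, h1, ih h2⟩

lemma Cov.mono {k' : ℕ} (h : Cov p r k a b) (hk : k ≤ k') : Cov p r k' a b := by
  induction hk with
  | refl => exact h
  | step _ ih => exact ⟨a, 0, fun y hy hy' => absurd hy (by omega), ih⟩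

lemma Cov.nonneg (h : Cov p r k a b) (hab : a < b) : 0 ≤ r := by
  induction k generalizing a with
  | zero => exact absurd (show b ≤ a from h) (by omega)
  | succ k ih =>
    obtain ⟨e, c, h1, h2⟩ := h
    by_cases he : a < e
    · exact (norm_nonneg _).trans (h1 a le_rfl he)
    · exact ih (h2.mono_left (by omega)) hab

/-- The greedy choice: if no ball of radius `r` contains the points from `a` up to `x`, then the
first run may as well end before `x`. -/
lemma Cov.greedy {x : ℕ} (h : Cov p r k a b) (hab : a < b)
    (hx : x < b → ¬ ∃ c, ∀ y, a ≤ y → y ≤ x → ‖p y - c‖ ≤ r) :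
    ∃ k', k = k' + 1 ∧ Cov p r k' (min x b) b := by
  cases k with
  | zero => exact absurd (show b ≤ a from h) (by omega)
  | succ k =>
    refine ⟨k, rfl, ?_⟩
    obtain ⟨e, c, h1, h2⟩ := h
    rcases lt_or_ge x b with hxb | hxb
    · have : e ≤ x := by
        by_contra hex
        exact hx hxb ⟨c, fun y hy hy' => h1 y hy (by omega)⟩
      exact h2.mono_left (by omega)
    · rw [min_eq_right hxb]
      have h0 : Cov p r 0 b b := le_refl b
      exact h0.mono (Nat.zero_le _)

/-- Cutting at all gaps larger than `g` leaves runs of radius at most `(b - a) * g`. -/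
lemma cov_of_card_gaps_lt {g R : ℝ} (hg : 0 ≤ g) (hab : a < b) (hR : (b - a : ℝ) * g ≤ R)
    (hk : ((Finset.Ico a (b - 1)).filter fun f => g < ‖p f - p (f + 1)‖).card < k) :
    Cov p R k a b := by
  have hball : ∀ a y, a ≤ y → (∀ f, a ≤ f → f < y → ‖p f - p (f + 1)‖ ≤ g) →
      ‖p y - p a‖ ≤ (y - a : ℝ) * g := by
    intro a y hay
    induction y, hay using Nat.le_induction with
    | base => simp
    | succ y hay ih =>
      intro hf
      have h1 := ih fun f h1 h2 => hf f h1 (by omega)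
      have h2 := hf y hay (by omega)
      calc ‖p (y + 1) - p a‖ ≤ ‖p (y + 1) - p y‖ + ‖p y - p a‖ := norm_sub_le_norm_sub_add_norm_sub _ _ _
        _ ≤ g + (y - a : ℝ) * g := by rw [norm_sub_rev]; exact add_le_add h2 h1
        _ = _ := by push_cast; ring
  induction k generalizing a with
  | zero => omega
  | succ k ih =>
    by_cases hex : ∃ f, a ≤ f ∧ f < b - 1 ∧ g < ‖p f - p (f + 1)‖
    · classical
      obtain ⟨h1, h2, h3⟩ := Nat.find_spec hex
      have hmin := fun f => Nat.find_min (m := f) hex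
      set f := Nat.find hex
      have hfb : (f : ℝ) + 1 ≤ b := by exact_mod_cast (by omega : f + 1 ≤ b)
      have haf : (a : ℝ) ≤ f := by exact_mod_cast h1
      -- The first run ends at the first long gap `f`. That gap is no longer counted from `f + 1`
      -- on, so one run fewer suffices for the rest.
      refine ⟨f + 1, p a, fun y hy hy' => ?_, ih (by omega) ?_ ?_⟩
      · refine (hball a y hy fun f' h4 h5 => ?_).trans (le_trans ?_ hR)
        · by_contra hc
          exact hmin f' (by omega) ⟨h4, by omega, not_le.mp hc⟩
        · have : (y : ℝ) ≤ f := by exact_mod_cast (by omega : y ≤ f)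
          exact mul_le_mul_of_nonneg_right (by linarith) hg
      · refine le_trans ?_ hR
        push_cast
        gcongr
        linarith
      · refine Nat.lt_of_lt_of_le (Finset.card_lt_card (t := (Finset.Ico a (b - 1)).filter
          fun f => g < ‖p f - p (f + 1)‖) ?_) (by omega)
        refine Finset.ssubset_iff_subset_ne.mpr ⟨?_, ?_⟩
        · intro y
          simp only [Finset.mem_filter, Finset.mem_Ico]
          rintro ⟨⟨h4, h5⟩, h6⟩
          exact ⟨⟨by omega, h5⟩, h6⟩
        · intro heq
          have : f ∈ (Finset.Ico a (b - 1)).filter fun f => g < ‖p f - p (f + 1)‖ := by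
            simp [h1, h2, h3]
          rw [← heq] at this
          simp at this
    · push Not at hex
      have h0 : Cov p R 0 b b := le_refl b
      refine ⟨b, p a, fun y hy hy' => ?_, h0.mono (Nat.zero_le _)⟩
      refine (hball a y hy fun f' h4 h5 => hex f' h4 (by omega)).trans (le_trans ?_ hR)
      have : (y : ℝ) ≤ b := by exact_mod_cast hy'.le
      gcongr

/-- If there are `k` gaps of length at least `g`, then one of them lies inside of a run. -/
lemma Cov.gap_le {g : ℝ} (h : Cov p r k a b) (hab : a < b)
    (hk : k ≤ ((Finset.Ico a (b - 1)).filter fun f => g ≤ ‖p f - p (f + 1)‖).card) :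
    g ≤ 2 * r := by
  by_contra hg
  push Not at hg
  refine absurd hk (not_le.mpr ?_)
  clear hk
  induction k generalizing a with
  | zero => exact absurd (show b ≤ a from h) (by omega)
  | succ k ih =>
    obtain ⟨e, c, h1, h2⟩ := h
    have hsmall : ∀ f, a ≤ f → f + 1 < e → ¬ g ≤ ‖p f - p (f + 1)‖ := by
      intro f hf hf' hgf
      have h3 := h1 f hf (by omega)
      have h4 := h1 (f + 1) (by omega) hf'
      have h5 := norm_sub_le_norm_sub_add_norm_sub (p f) c (p (f + 1))
      rw [norm_sub_rev c] at h5
      linarith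
    by_cases hea : e ≤ a
    · exact (ih (h2.mono_left hea) hab).trans (Nat.lt_succ_self k)
    -- A gap inside the run is shorter than `g`, so the run accounts for at most the gap `e - 1` by
    -- which it is left. If the run reaches `b`, there is no such gap, which is where the strict
    -- inequality comes from.
    · have hsub : ((Finset.Ico a (b - 1)).filter fun f => g ≤ ‖p f - p (f + 1)‖) ⊆
          ((Finset.Ico e (b - 1)).filter fun f => g ≤ ‖p f - p (f + 1)‖) ∪
            ((Finset.Ico (e - 1) e).filter fun f => f < b - 1) := by
        intro f
        simp only [Finset.mem_filter, Finset.mem_Ico, Finset.mem_union]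
        rintro ⟨⟨h3, h4⟩, h5⟩
        by_cases hfe : e ≤ f
        · exact Or.inl ⟨⟨hfe, h4⟩, h5⟩
        · by_cases hfe' : f + 1 < e
          · exact absurd h5 (hsmall f h3 hfe')
          · exact Or.inr (by omega)
      have hc1 := (Finset.card_le_card hsub).trans (Finset.card_union_le _ _)
      have hc2 : ((Finset.Ico (e - 1) e).filter fun f => f < b - 1).card ≤ 1 :=
        (Finset.card_filter_le _ _).trans (by rw [Nat.card_Ico]; omega)
      by_cases heb : e < b
      · have := ih h2 heb
        omega
      · have h3 : ((Finset.Ico e (b - 1)).filter fun f => g ≤ ‖p f - p (f + 1)‖).card = 0 := by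
          rw [Finset.Ico_eq_empty (by omega)]
          simp
        have h4 : ((Finset.Ico (e - 1) e).filter fun f => f < b - 1).card = 0 := by
          rw [Finset.card_eq_zero, Finset.filter_eq_empty_iff]
          intro f
          simp only [Finset.mem_Ico]
          omega
        omega

lemma BallCover.append {e : ℕ} {S S' : List (Point d)} (h : BallCover p ρ a e S) (h' : BallCover p ρ e b S') :
    BallCover p ρ a b (S ++ S') := by
  induction h with
  | nil => exact h'
  | cons hae h1 _ ih => exact .cons hae h1 (ih h')

lemma BallCover.mono {ρ' : ℝ} {S : List (Point d)} (h : BallCover p ρ a b S) (hρ : ρ ≤ ρ') :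
    BallCover p ρ' a b S := by
  induction h with
  | nil a => exact .nil a
  | cons hae h1 _ ih => exact .cons hae (fun y hy hy' => (h1 y hy hy').trans hρ) ih

lemma BallCover.le {S : List (Point d)} (h : BallCover p ρ a b S) : a ≤ b := by
  induction h with
  | nil => exact le_rfl
  | cons hae h1 _ ih => omega

lemma BallCover.ne_nil {S : List (Point d)} (h : BallCover p ρ a b S) (hab : a < b) : S ≠ [] := by
  cases h with
  | nil => omega
  | cons => simp

lemma ballCover_self (n : ℕ) : BallCover p 0 a (a + n) ((List.range' a n).map p) := by
  induction n generalizing a with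
  | zero => exact .nil a
  | succ n ih =>
    rw [List.range'_succ, List.map_cons]
    refine .cons (Nat.lt_succ_self a) (fun y hy hy' => ?_) ?_
    · obtain rfl : y = a := by omega
      simp
    · convert ih using 1
      omega

end cover

/-! ## Covers and paired walks -/

section walk
variable {d : ℕ} {p : ℕ → Point d} {ρ : ℝ} {k a b : ℕ}

lemma walkCost_nonneg (ω : List (List (Point d) × List (Point d))) : 0 ≤ walkCost ω := by
  refine Real.sSup_nonneg ?_
  rintro r ⟨b, -, x, -, y, -, rfl⟩
  exact norm_nonneg _

lemma le_walkCost {ω : List (List (Point d) × List (Point d))} {b : List (Point d) × List (Point d)}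
    (hb : b ∈ ω) {x y : Point d} (hx : x ∈ b.1) (hy : y ∈ b.2) : ‖x - y‖ ≤ walkCost ω := by
  refine le_csSup ?_ ⟨b, hb, x, hx, y, hy, rfl⟩
  -- Boundedness has to be proved, since `sSup` of an unbounded set is `0`; the set is a finite
  -- union of singletons.
  have : {r : ℝ | ∃ b ∈ ω, ∃ p ∈ b.1, ∃ q ∈ b.2, r = ‖p - q‖} =
      ⋃ b ∈ {b | b ∈ ω}, ⋃ p ∈ {p | p ∈ b.1}, ⋃ q ∈ {q | q ∈ b.2}, {‖p - q‖} := by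
    ext r
    simp
  rw [this]
  refine Set.Finite.bddAbove ?_
  exact (List.finite_toSet _).biUnion fun _ _ => (List.finite_toSet _).biUnion fun _ _ =>
    (List.finite_toSet _).biUnion fun _ _ => Set.finite_singleton _

lemma dfd_le_walkCost {P Q : List (Point d)} {ω : List (List (Point d) × List (Point d))}
    (h : IsPairedWalk P Q ω) : dfd P Q ≤ walkCost ω := by
  refine csInf_le ⟨0, ?_⟩ ⟨ω, h, rfl⟩
  rintro r ⟨ω, -, rfl⟩
  exact walkCost_nonneg ω

/-- Needed because `sInf ∅ = 0`: without a walk, no positive lower bound on `dfd` could be derived.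
With two or more points on both sides, the head of `P` takes all of `Q` but its last point, which is
matched to the tail of `P`. -/
lemma exists_isPairedWalk {P Q : List (Point d)} (hP : P ≠ []) (hQ : Q ≠ []) :
    ∃ ω, IsPairedWalk P Q ω := by
  by_cases hP1 : P.length = 1
  · exact ⟨[(P, Q)], by simp, by simp, by simpa, by simpa, by simp [hP1]⟩
  by_cases hQ1 : Q.length = 1
  · exact ⟨[(P, Q)], by simp, by simp, by simpa, by simpa, by simp [hQ1]⟩
  have hP2 := List.length_pos_iff.mpr hP
  have hQ2 := List.length_pos_iff.mpr hQ
  refine ⟨[([P.head hP], Q.dropLast), (P.tail, [Q.getLast hQ])], by simp,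
    by simpa using List.dropLast_append_getLast hQ, ?_, ?_, by simp⟩
  · simp [← List.length_pos_iff]
    omega
  · simp [← List.length_pos_iff]
    omega

lemma le_dfd {P Q : List (Point d)} (hP : P ≠ []) (hQ : Q ≠ [])
    (h : ∀ ω, IsPairedWalk P Q ω → ρ ≤ walkCost ω) : ρ ≤ dfd P Q := by
  obtain ⟨ω, hω⟩ := exists_isPairedWalk hP hQ
  refine le_csInf ⟨_, ω, hω, rfl⟩ ?_
  rintro r ⟨ω, hω, rfl⟩
  exact h ω hω

lemma range'_add (a m n : ℕ) : List.range' a (m + n) = List.range' a m ++ List.range' (a + m) n := by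
  simp

/-- A cover by the balls around the points of `S` is a paired walk. -/
lemma dfd_le_of_ballCover {n : ℕ} {S : List (Point d)} (hρ : 0 ≤ ρ) (h : BallCover p ρ a (a + n) S) :
    dfd ((List.range' a n).map p) S ≤ ρ := by
  suffices H : ∀ b, BallCover p ρ a b S → ∀ n, b = a + n → ∃ ω,
      IsPairedWalk ((List.range' a n).map p) S ω ∧ ∀ b ∈ ω, ∀ x ∈ b.1, ∀ y ∈ b.2, ‖x - y‖ ≤ ρ by
    obtain ⟨ω, hω, hω'⟩ := H _ h n rfl
    refine (dfd_le_walkCost hω).trans (Real.sSup_le ?_ hρ)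
    rintro r ⟨b, hb, x, hx, y, hy, rfl⟩
    exact hω' b hb x hx y hy
  intro b hb
  clear h n
  induction hb with
  | nil a =>
    intro n hn
    obtain rfl : n = 0 := by omega
    exact ⟨[], by constructor <;> simp, by simp⟩
  | @cons a e b c S hae hc hS ih =>
    intro n hn
    have heb := hS.le
    obtain ⟨ω, hω, hω'⟩ := ih (b - e) (by omega)
    refine ⟨((List.range' a (e - a)).map p, [c]) :: ω, ⟨?_, ?_, ?_, ?_, ?_⟩, ?_⟩
    · have h1 : n = (e - a) + (b - e) := by omega
      have h2 : a + (e - a) = e := by omega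
      rw [List.map_cons, List.flatten_cons, hω.left, h1, range'_add, h2, List.map_append]
    · rw [List.map_cons, List.flatten_cons, hω.right]
      rfl
    · rintro b (_ | ⟨_, hb⟩)
      · simp
        omega
      · exact hω.left_ne_nil b hb
    · rintro b (_ | ⟨_, hb⟩)
      · simp
      · exact hω.right_ne_nil b hb
    · rintro b (_ | ⟨_, hb⟩)
      · simp
      · exact hω.single b hb
    · rintro b (_ | ⟨_, hb⟩)
      · intro x hx y hy
        simp only [List.mem_map, List.mem_range'_1, List.mem_singleton] at hx hy
        obtain ⟨z, hz, rfl⟩ := hx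
        subst hy
        exact hc z hz.1 (by omega)
      · exact hω' b hb

/-- The blocks of a paired walk are runs around the first points of their right halves. -/
lemma cov_of_isPairedWalk {n : ℕ} {S : List (Point d)} {ω : List (List (Point d) × List (Point d))}
    (h : IsPairedWalk ((List.range' a n).map p) S ω) (hk : S.length ≤ k) :
    Cov p (walkCost ω) k a (a + n) := by
  -- The induction runs over final parts `ω'` of the walk, while the radius stays the cost of the
  -- whole walk `ω`.
  suffices H : ∀ (ω' : List (List (Point d) × List (Point d))) a n k, (∀ b ∈ ω', b ∈ ω) →
      (ω'.map Prod.fst).flatten = (List.range' a n).map p →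
      (ω'.map Prod.snd).flatten.length ≤ k → Cov p (walkCost ω) k a (a + n) from
    H ω a n k (fun _ hb => hb) h.left (by rwa [h.right])
  intro ω'
  induction ω' with
  | nil =>
    intro a n k _ h1 _
    have : n = 0 := by simpa using congrArg List.length h1.symm
    subst this
    have h0 : Cov p (walkCost ω) 0 a (a + 0) := le_refl a
    exact h0.mono (Nat.zero_le _)
  | cons B ω' ih =>
    intro a n k hsub h1 h2
    rw [List.map_cons, List.flatten_cons] at h1 h2
    rw [List.length_append] at h2
    have hB := hsub B (by simp)
    -- Every block uses up at least one point of `S`, so there are at most `k` blocks.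
    have hB2 : 0 < B.2.length := List.length_pos_iff.mpr (h.right_ne_nil B hB)
    obtain ⟨k, rfl⟩ : ∃ k', k = k' + 1 := ⟨k - 1, by omega⟩
    have hlen := congrArg List.length h1
    rw [List.length_append, List.length_map, List.length_range'] at hlen
    have hsplit : List.range' a n =
        List.range' a B.1.length ++ List.range' (a + B.1.length) (n - B.1.length) := by
      rw [← range'_add]
      congr 1
      omega
    rw [hsplit, List.map_append] at h1
    obtain ⟨h3, h4⟩ := List.append_inj h1 (by simp)
    refine ⟨a + B.1.length, B.2.head (h.right_ne_nil B hB), fun y hy hy' => ?_, ?_⟩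
    · refine le_walkCost hB ?_ (List.head_mem _)
      rw [h3]
      exact List.mem_map_of_mem (List.mem_range'_1.mpr ⟨hy, hy'⟩)
    · have := ih _ _ k (fun b hb => hsub b (by simp [hb])) h4 (by omega)
      convert this using 1
      omega

/-- An approximately optimal cover is a simplification. -/
lemma isSimplification_of_ballCover {n : ℕ} {S : List (Point d)} {γ α : ℝ} (hn : 0 < n) (hγ : 0 < γ)
    (hρ : 0 ≤ ρ) (hS : (S.length : ℝ) ≤ α * k) (h : BallCover p ρ a (a + n) S)
    (hopt : ∀ r, Cov p r k a (a + n) → ρ ≤ γ * r) :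
    IsSimplification α k γ ((List.range' a n).map p) S := by
  refine ⟨h.ne_nil (by omega), hS, fun S' hS' hk => (dfd_le_of_ballCover hρ h).trans ?_⟩
  rw [← div_le_iff₀' hγ]
  refine le_dfd (by simp; omega) hS' fun ω hω => ?_
  rw [div_le_iff₀' hγ]
  exact hopt _ (cov_of_isPairedWalk hω hk)

lemma subcurve_eq_map {P : List (Point d)} {i j : ℕ} (hi : 1 ≤ i) (hj : j ≤ P.length)
    (hp : ∀ x (h : x < P.length), p x = P[x]) :
    subcurve P i j = (List.range' (i - 1) (j + 1 - i)).map p := by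
  refine List.ext_getElem ?_ ?_
  · simp [subcurve]
    omega
  · intro x h1 h2
    simp [subcurve] at h1 ⊢
    rw [hp]

end walk

/-! ## Moving a centre -/

section centre
variable {d : ℕ}

/-- Stewart's identity for the point dividing the segment from `c` to `p` in the ratio `e : 1 - e`.
The negative last term is the gain from moving towards a distant `p`. -/
lemma sq_norm_move (e : ℝ) (c p q : Point d) : ‖c + e • (p - c) - q‖ ^ 2 =
    (1 - e) * ‖c - q‖ ^ 2 + e * ‖p - q‖ ^ 2 - e * (1 - e) * ‖p - c‖ ^ 2 := by
  have h1 : c + e • (p - c) - q = (c - q) + e • ((p - q) - (c - q)) := by abel_nf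
  have h2 : p - c = (p - q) - (c - q) := by abel
  rw [h1, h2]
  generalize c - q = u
  generalize p - q = v
  simp only [← real_inner_self_eq_norm_sq, inner_add_left, inner_add_right, inner_sub_left,
    inner_sub_right, real_inner_smul_left, real_inner_smul_right, real_inner_comm u v]
  ring

/-- Moving the centre towards a point that is too far away brings it closer to the optimum. -/
lemma move_potential {e r : ℝ} {c p q : Point d} (he : 0 < e) (he' : e ≤ 1 / 2)
    (hq : ‖p - q‖ ≤ r) (hp : ((1 + e) * r) ^ 2 ≤ ‖p - c‖ ^ 2) :
    ‖c + e • (p - c) - q‖ ^ 2 + e / 4 * r ^ 2 ≤ (1 - e) * (‖c - q‖ ^ 2 + e / 4 * r ^ 2) := by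
  have h1 : ‖p - q‖ ^ 2 ≤ r ^ 2 := by gcongr
  have h2 : e * (1 - e) * ((1 + e) * r) ^ 2 ≤ e * (1 - e) * ‖p - c‖ ^ 2 := by
    have : 0 ≤ e * (1 - e) := mul_nonneg he.le (by linarith)
    gcongr
  rw [sq_norm_move]
  have h3 : e * ‖p - q‖ ^ 2 ≤ e * r ^ 2 := by gcongr
  -- This is the excess of the gain `e * (1 - e) * (1 + e) ^ 2` over `e + e ^ 2 / 4`, the
  -- coefficients of `r ^ 2` that it has to pay for. The factor `3 / 4 - e - e ^ 2` vanishes at `e =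
  -- 1 / 2`.
  have h4 : 0 ≤ e * (e - e ^ 2 - e ^ 3 - e / 4) * r ^ 2 := by
    have h5 : 0 ≤ 3 / 4 - e - e ^ 2 := by nlinarith
    have : 0 ≤ e * (e * (3 / 4 - e - e ^ 2)) * r ^ 2 := by positivity
    nlinarith
  nlinarith

/-- When the potential is used up, no ball of radius `r` contains the points seen. -/
lemma false_of_potential {e r β : ℝ} {c p q : Point d} (hr : 0 ≤ r)
    (hq : ‖p - q‖ ≤ r) (hp : ((1 + e) * r) ^ 2 < ‖p - c‖ ^ 2)
    (hβ : β * (4 + e) < e) (h : ‖c - q‖ ^ 2 + e / 4 * r ^ 2 ≤ β * ((1 + e / 4) * r ^ 2)) :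
    False := by
  -- For `r = 0` the potential has no positive floor, but then `c = q = p`, although `p` is away
  -- from `c`. For `r > 0` the floor `e / 4 * r ^ 2` already exceeds the right-hand side.
  rcases hr.eq_or_lt with rfl | hr
  · have h1 : ‖c - q‖ ^ 2 ≤ 0 := by simpa using h
    have h2 : c - q = 0 := by
      rw [← norm_eq_zero]
      exact pow_eq_zero_iff (two_ne_zero) |>.mp (le_antisymm h1 (by positivity))
    have h3 : p - q = 0 := by
      rw [← norm_eq_zero]
      exact le_antisymm hq (norm_nonneg _)
    have h4 : p - c = 0 := by
      rw [sub_eq_zero] at *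
      rw [h3, h2]
    rw [h4] at hp
    simp at hp
  · have h1 : 0 ≤ ‖c - q‖ ^ 2 := by positivity
    have h2 : 0 < r ^ 2 := by positivity
    nlinarith

end centre

/-! ## Growing a run

Integer registers: `0` the number of points, `1` the bound on the number of runs, `2` the dimension,
`7` the end of the current interval, `8` the address where its centres are stored, `9` the number of
runs found, `10` the beginning of the current run, `11` its end, `12` the point looked at, `13`
whether the run can grow, `14` a loop counter. Real registers: `1` the precision, `2` the radius, `3`
the remaining potential, `4` a squared distance. Real arrays: `0` the points, `1` the output, `3` the
current centre. -/

/-- The squared distance from a point to the current centre. -/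
def sqDist : Prog :=
  .rset 4 0 ;;
  forLoop 14 (.reg 2) (.rset 4 (.reg 4 +
    (.get 0 (.reg 12 * .reg 2 + .reg 14) - .get 3 (.reg 14)) *
      (.get 0 (.reg 12 * .reg 2 + .reg 14) - .get 3 (.reg 14))))

/-- Move the current centre towards a point. -/
def moveCentre : Prog :=
  forLoop 14 (.reg 2) (.rput 3 (.reg 14) (.get 3 (.reg 14) +
    .reg 1 * (.get 0 (.reg 12 * .reg 2 + .reg 14) - .get 3 (.reg 14))))

/-- Store the current centre as the centre of the current run. -/
def saveCentre : Prog := copyReals 14 1 (.reg 8 + .reg 9 * .reg 2) 3 0 (.reg 2)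

/-- Begin with the first point of the run as the centre. -/
def loadCentre : Prog := copyReals 14 3 0 0 (.reg 10 * .reg 2) (.reg 2)

/-- Look at the next point. -/
def scanStep : Prog :=
  sqDist ;;
  .ite (.rle (.reg 4) (((1 + .reg 1) * .reg 2) * ((1 + .reg 1) * .reg 2)))
    (.iset 12 (.reg 12 + 1) ;;
      .ite (.ilt (.reg 11) (.reg 12)) (.iset 11 (.reg 12) ;; saveCentre) .skip)
    (.ite (.rle (.reg 1) (.reg 3 * (4 + .reg 1)))
      (moveCentre ;; .rset 3 (.reg 3 * (1 - .reg 1)) ;; .iset 12 (.reg 10))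
      (.iset 13 0))

/-- Find a run that begins at a given point and a ball that contains it. -/
def grow : Prog :=
  loadCentre ;; saveCentre ;; .iset 11 (.reg 10 + 1) ;; .iset 12 (.reg 10 + 1) ;; .rset 3 1 ;;
  .iset 13 1 ;; .loop (.and (.ilt (.reg 12) (.reg 7)) (.ile 1 (.reg 13))) scanStep

/-- The memory cells that a run is grown from. -/
structure GrowEnv (d : ℕ) (A : ℕ → ℝ) (e r : ℝ) (q b o n : ℕ) (t : Memory) : Prop where
  dim : t.ireg 2 = d
  last : t.ireg 7 = b
  addr : t.ireg 8 = o
  count : t.ireg 9 = n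
  start : t.ireg 10 = q
  prec : t.rreg 1 = e
  rad : t.rreg 2 = r
  pts : t.rarr 0 = A

section grow
variable {w d : ℕ} {A : ℕ → ℝ} {e r : ℝ} {q b o n : ℕ} {s : Memory}

/-- All hypotheses on `c` are Boolean and hold by `rfl` for the programs used. -/
lemma GrowEnv.of_frame {c : Prog} {t : Memory} (h : GrowEnv d A e r q b o n s) (hf : Frame c s t)
    (h2 : c.setsI 2 = false) (h7 : c.setsI 7 = false) (h8 : c.setsI 8 = false)
    (h9 : c.setsI 9 = false) (h10 : c.setsI 10 = false) (h1 : c.setsR 1 = false)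
    (h2' : c.setsR 2 = false) (h0 : c.putsR 0 = false) : GrowEnv d A e r q b o n t :=
  ⟨(hf.ireg 2 h2).trans h.dim, (hf.ireg 7 h7).trans h.last, (hf.ireg 8 h8).trans h.addr,
    (hf.ireg 9 h9).trans h.count, (hf.ireg 10 h10).trans h.start, (hf.rreg 1 h1).trans h.prec,
    (hf.rreg 2 h2').trans h.rad, (hf.rarr 0 h0).trans h.pts⟩

lemma norm_sq_pt_sub (d : ℕ) (A B : ℕ → ℝ) (x y : ℕ) : ‖pt d A x - pt d B y‖ ^ 2 =
    ∑ i ∈ Finset.range d, (A (x + i) - B (y + i)) * (A (x + i) - B (y + i)) := by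
  rw [EuclideanSpace.real_norm_sq_eq, ← Fin.sum_univ_eq_sum_range
    (fun i => (A (x + i) - B (y + i)) * (A (x + i) - B (y + i)))]
  exact Finset.sum_congr rfl fun i _ => sq _

lemma halts_sqDist {x : ℕ} (hd : s.ireg 2 = d) (hA : s.rarr 0 = A) (hx : s.ireg 12 = x)
    (hw : d < 2 ^ w) : Halts w sqDist s fun t n =>
      t.rreg 4 = ‖pt d A (x * d) - pt d (s.rarr 3) 0‖ ^ 2 ∧ n ≤ 32 * d + 11 := by
  refine halts_rset_seq ?_
  refine halts_for d 22 (fun n t => t.rreg 4 = ∑ i ∈ Finset.range n,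
    (A (x * d + i) - s.rarr 3 (0 + i)) * (A (x * d + i) - s.rarr 3 (0 + i))) rfl hw ?_ ?_ ?_ ?_
  · intro n t _ hf _
    simpa [hd] using hf.ireg 2 rfl
  · simp
  · intro n t _ hf hi hJ
    have h2 : t.ireg 2 = d := by simpa [hd] using hf.ireg 2 rfl
    have h12 : t.ireg 12 = x := by simpa [hx] using hf.ireg 12 rfl
    have h0 : t.rarr 0 = A := by simpa [hA] using hf.rarr 0 rfl
    have h3 : t.rarr 3 = s.rarr 3 := by simpa using hf.rarr 3 rfl
    refine halts_rset ⟨by simp, ?_⟩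
    simp [Finset.sum_range_succ, h2, h12, h0, h3, hi, hJ]
  · intro t n _ hJ hn
    refine ⟨hJ.trans (norm_sq_pt_sub d A (s.rarr 3) (x * d) 0).symm, ?_⟩
    simp at hn ⊢
    omega

lemma halts_moveCentre {x : ℕ} (hd : s.ireg 2 = d) (hA : s.rarr 0 = A) (hx : s.ireg 12 = x)
    (he : s.rreg 1 = e) (hw : d < 2 ^ w) : Halts w moveCentre s fun t n =>
      pt d (t.rarr 3) 0 = pt d (s.rarr 3) 0 + e • (pt d A (x * d) - pt d (s.rarr 3) 0) ∧
      n ≤ 26 * d + 8 := by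
  refine halts_for d 16 (fun n t => ∀ y, t.rarr 3 y = if y < n then
    s.rarr 3 y + e * (A (x * d + y) - s.rarr 3 y) else s.rarr 3 y) rfl hw ?_ ?_ ?_ ?_
  · intro n t _ hf _
    exact (hf.ireg 2 rfl).trans hd
  · simp
  · intro n t hn hf hi hJ
    have h2 : t.ireg 2 = d := (hf.ireg 2 rfl).trans hd
    have h12 : t.ireg 12 = x := (hf.ireg 12 rfl).trans hx
    have h0 : t.rarr 0 = A := (hf.rarr 0 rfl).trans hA
    have h1 : t.rreg 1 = e := (hf.rreg 1 rfl).trans he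
    refine halts_rput (by simp [hi]; omega) ⟨by simp, ?_⟩
    intro y
    simp only [IExp.eval_reg, iset_rarr, rput_rarr_same, Function.update_apply, hi, RExp.eval_add,
      RExp.eval_get, RExp.eval_mul, RExp.eval_sub, RExp.eval_reg, IExp.eval_add, IExp.eval_mul, h2,
      h12, h0, h1, hJ]
    rcases lt_trichotomy y n with h | rfl | h
    · simp [h.ne, h, Nat.lt_succ_of_lt h]
    · simp
    · simp [h.ne', not_lt.mpr h.le, not_lt.mpr (Nat.succ_le_of_lt h)]
  · intro t n _ hJ hn
    refine ⟨?_, ?_⟩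
    · ext i
      simp [pt, hJ]
    · simp at hn ⊢
      omega

lemma halts_saveCentre (hs : GrowEnv d A e r q b o n s) (hw : o + n * d + d < 2 ^ w) :
    Halts w saveCentre s fun t N => t.rarr 3 = s.rarr 3 ∧
      pt d (t.rarr 1) (o + n * d) = pt d (s.rarr 3) 0 ∧
      (∀ y, ¬ (o + n * d ≤ y ∧ y < o + n * d + d) → t.rarr 1 y = s.rarr 1 y) ∧
      N ≤ 22 * d + 8 := by
  refine (halts_copyReals (o + n * d) 0 d (by decide) hw ?_ ?_ ?_).imp ?_
  · intro t hf
    have h := hs.of_frame hf rfl rfl rfl rfl rfl rfl rfl rfl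
    simp [h.addr, h.count, h.dim]
  · intro t _
    rfl
  · intro t hf
    exact (hf.ireg 2 rfl).trans hs.dim
  · rintro t N hf ⟨h1, h2⟩
    refine ⟨hf.rarr 3 rfl, ?_, ?_, by simp at h2; omega⟩
    · ext i
      simp [pt, h1]
    · intro y hy
      rw [h1, if_neg hy]

lemma halts_loadCentre (hs : GrowEnv d A e r q b o n s) (hw : d < 2 ^ w) :
    Halts w loadCentre s fun t N => pt d (t.rarr 3) 0 = pt d A (q * d) ∧ N ≤ 20 * d + 8 := by
  refine (halts_copyReals 0 (q * d) d (by decide) (by simpa using hw) ?_ ?_ ?_).imp ?_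
  · intro t _
    rfl
  · intro t hf
    have h := hs.of_frame hf rfl rfl rfl rfl rfl rfl rfl rfl
    simp [h.start, h.dim]
  · intro t hf
    exact (hf.ireg 2 rfl).trans hs.dim
  · rintro t N hf ⟨h1, h2⟩
    refine ⟨?_, by simp at h2; omega⟩
    ext i
    simp [pt, h1, hs.pts]

/-- The state of growing a run: `τ` moves of the centre have been made, the centre contains the points
up to `x`, the stored centre those up to `X`, and the run can grow if `g = 1`. -/
structure Growing (d : ℕ) (A : ℕ → ℝ) (e r : ℝ) (q b z : ℕ) (B : ℕ → ℝ) (T τ x X g : ℕ) (t : Memory) :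
    Prop where
  look : t.ireg 12 = x
  last : t.ireg 11 = X
  flag : t.ireg 13 = g
  pot : t.rreg 3 = (1 - e) ^ τ
  moves : τ ≤ T
  start_le : q ≤ x
  look_le : x ≤ X
  last_le : X ≤ b
  start_lt : q < X
  done : X = b → x = b
  flag_le : g ≤ 1
  cur : ∀ y, q ≤ y → y < x → ‖pt d A (y * d) - pt d (t.rarr 3) 0‖ ≤ (1 + e) * r
  saved : ∀ y, q ≤ y → y < X → ‖pt d A (y * d) - pt d (t.rarr 1) z‖ ≤ (1 + e) * r
  potential : ∀ c, X < b → (∀ y, q ≤ y → y ≤ X → ‖pt d A (y * d) - c‖ ≤ r) →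
    ‖pt d (t.rarr 3) 0 - c‖ ^ 2 + e / 4 * r ^ 2 ≤ (1 - e) ^ τ * ((1 + e / 4) * r ^ 2)
  stuck : g = 0 → X < b ∧ ¬ ∃ c, ∀ y, q ≤ y → y ≤ X → ‖pt d A (y * d) - c‖ ≤ r
  rest : ∀ y, ¬ (z ≤ y ∧ y < z + d) → t.rarr 1 y = B y

/-- The three outcomes are: the point is near, and the scan advances, storing the centre if it sets
a record; the point is far and potential is left, so the centre moves and the scan restarts at `q`;
the point is far and the potential is used up, so no ball of radius `r` contains the points up to
`X`. Storing the record centre separately matters because a later centre may cover fewer points. -/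
lemma halts_scanStep {B : ℕ → ℝ} {T τ x X : ℕ} (hd : 1 ≤ d) (he : 0 < e) (he' : e ≤ 1 / 2)
    (hr : 0 ≤ r) (hT : (1 - e) ^ T * (4 + e) < e) (hs : GrowEnv d A e r q b o n s)
    (hw : o + n * d + d < 2 ^ w) (hwb : b < 2 ^ w) (hxb : x < b)
    (h : Growing d A e r q b (o + n * d) B T τ x X 1 s) :
    Halts w scanStep s fun t N => N ≤ 135 * d ∧
      ∃ τ' x' X' g', Growing d A e r q b (o + n * d) B T τ' x' X' g' t ∧ X ≤ X' ∧
        (τ' = τ ∧ x' = x + 1 ∧ g' = 1 ∨ τ' = τ + 1 ∧ x' = q ∧ g' = 1 ∨ τ' = τ ∧ x' = x ∧ g' = 0) := by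
  have hR : 0 ≤ (1 + e) * r := by positivity
  have hXb : X < b := by
    refine lt_of_le_of_ne h.last_le fun hX => ?_
    have := h.done hX
    omega
  refine halts_seq ((halts_sqDist hs.dim hs.pts h.look (by omega)).imp ?_)
  rintro t N₁ hf ⟨hD, hN₁⟩
  have ht := hs.of_frame hf rfl rfl rfl rfl rfl rfl rfl rfl
  have t12 : t.ireg 12 = x := (hf.ireg 12 rfl).trans h.look
  have t11 : t.ireg 11 = X := (hf.ireg 11 rfl).trans h.last
  have t13 : t.ireg 13 = 1 := (hf.ireg 13 rfl).trans h.flag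
  have t3 : t.rreg 3 = (1 - e) ^ τ := (hf.rreg 3 rfl).trans h.pot
  have c3 : t.rarr 3 = s.rarr 3 := hf.rarr 3 rfl
  have c1 : t.rarr 1 = s.rarr 1 := hf.rarr 1 rfl
  have hxX := h.look_le
  have hqx := h.start_le
  refine halts_ite (fun hb => ?_) (fun hb => ?_)
  · have hnear : ‖pt d A (x * d) - pt d (s.rarr 3) 0‖ ≤ (1 + e) * r := by
      have : ‖pt d A (x * d) - pt d (s.rarr 3) 0‖ ^ 2 ≤ ((1 + e) * r) ^ 2 := by
        simpa [hD, ht.prec, ht.rad, sq] using hb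
      exact (sq_le_sq₀ (norm_nonneg _) hR).mp this
    have hcur : ∀ y, q ≤ y → y < x + 1 → ‖pt d A (y * d) - pt d (s.rarr 3) 0‖ ≤ (1 + e) * r := by
      intro y hy hy'
      rcases Nat.lt_succ_iff_lt_or_eq.mp hy' with hy' | rfl
      · exact h.cur y hy hy'
      · exact hnear
    refine halts_iset_seq (by simp [t12]; omega) (halts_ite (fun hb' => ?_) (fun hb' => ?_))
    · have hX : X = x := by
        simp [t12, t11] at hb'
        omega
      subst hX
      set t' := (t.iset 12 _).iset 11 _ with ht'
      have e' : GrowEnv d A e r q b o n t' := by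
        constructor <;> simp [ht', ht.dim, ht.last, ht.addr, ht.count, ht.start, ht.prec, ht.rad, ht.pts]
      refine halts_iset_seq (by simp [t12]; omega) ((halts_saveCentre e' hw).imp ?_)
      rintro u N₂ hf' ⟨u3, uc, ur, hN₂⟩
      have c3' : u.rarr 3 = s.rarr 3 := by rw [u3]; simpa [ht'] using c3
      have uc' : pt d (u.rarr 1) (o + n * d) = pt d (s.rarr 3) 0 := by rw [uc]; simp [ht', c3]
      refine ⟨by simp at hN₁ hN₂ ⊢; omega, τ, X + 1, X + 1, 1, ⟨?_, ?_, ?_, ?_, h.moves, by omega, le_rfl,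
        by omega, by omega, id, le_rfl, ?_, ?_, ?_, by simp, ?_⟩, by omega, Or.inl ⟨rfl, rfl, rfl⟩⟩
      · exact (hf'.ireg 12 rfl).trans (by simp [ht', t12])
      · exact (hf'.ireg 11 rfl).trans (by simp [ht', t12])
      · exact (hf'.ireg 13 rfl).trans (by simp [ht', t13])
      · exact (hf'.rreg 3 rfl).trans (by simp [ht', t3])
      · rwa [c3']
      · rwa [uc']
      · intro c _ hc
        rw [c3']
        -- Raising `X` only shrinks the set of admissible centres `c`, so the old inequality
        -- persists.
        exact h.potential c hXb fun y hy hy' => hc y hy (by omega)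
      · intro y hy
        rw [ur y hy]
        simpa [ht', c1] using h.rest y hy
    · simp [t12, t11] at hb'
      refine halts_skip ⟨by simp; omega, τ, x + 1, X, 1, ⟨?_, ?_, ?_, ?_, h.moves, by omega, hb',
        by omega, h.start_lt, by omega, le_rfl, ?_, ?_, ?_, by simp, ?_⟩, le_rfl,
          Or.inl ⟨rfl, rfl, rfl⟩⟩
      · simp [t12]
      · simp [t11]
      · simp [t13]
      · simp [t3]
      · simpa [c3] using hcur
      · simpa [c1] using h.saved
      · simpa [c3] using h.potential
      · simpa [c1] using h.rest
  · have hfar : ((1 + e) * r) ^ 2 < ‖pt d A (x * d) - pt d (s.rarr 3) 0‖ ^ 2 := by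
      simpa [hD, ht.prec, ht.rad, sq] using hb
    refine halts_ite (fun hb' => ?_) (fun hb' => ?_)
    · have hb'' : e ≤ (1 - e) ^ τ * (4 + e) := by simpa [t3, ht.prec] using hb'
      -- After `T` moves the test for remaining potential must fail, by the choice of `T`.
      have hτ : τ < T := by
        by_contra hc
        have : (1 - e) ^ τ ≤ (1 - e) ^ T :=
          pow_le_pow_of_le_one (by linarith) (by linarith) (by omega)
        nlinarith
      refine halts_seq ((halts_moveCentre ht.dim ht.pts t12 ht.prec (by omega)).imp ?_)
      rintro u N₂ hf' ⟨hc, hN₂⟩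
      have hu := ht.of_frame hf' rfl rfl rfl rfl rfl rfl rfl rfl
      have c1' : u.rarr 1 = s.rarr 1 := (hf'.rarr 1 rfl).trans c1
      refine halts_rset_seq (halts_iset (by simp [hu.start]; omega) ⟨by simp; omega, τ + 1, q, X, 1,
        ⟨?_, ?_, ?_, ?_, hτ, le_rfl, by omega, by omega, h.start_lt, by omega, le_rfl, ?_, ?_, ?_,
          by simp, ?_⟩, le_rfl, Or.inr (Or.inl ⟨rfl, rfl, rfl⟩)⟩)
      · simp [hu.start]
      · simpa using (hf'.ireg 11 rfl).trans t11
      · simpa using (hf'.ireg 13 rfl).trans t13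
      · simp [(hf'.rreg 3 rfl).trans t3, hu.prec, pow_succ]
      -- The moved centre may lose points that it contained before, even the first one; hence the
      -- scan restarts at `q` and nothing is claimed here.
      · intro y hy hy'
        omega
      · simpa [c1'] using h.saved
      · intro c hX hc'
        simp only [iset_rarr, rset_rarr]
        rw [hc, c3]
        refine (move_potential he he' (hc' x hqx hxX) hfar.le).trans ?_
        rw [pow_succ' (1 - e)]
        have := h.potential c hX hc'
        have h1 : 0 ≤ 1 - e := by linarith
        rw [mul_assoc]
        exact mul_le_mul_of_nonneg_left this h1
      · simpa [c1'] using h.rest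
    · have hb'' : (1 - e) ^ τ * (4 + e) < e := by simpa [t3, ht.prec] using hb'
      refine halts_iset (by simp) ⟨by simp; omega, τ, x, X, 0, ⟨?_, ?_, ?_, ?_, h.moves, hqx, hxX,
        by omega, h.start_lt, h.done, by omega, ?_, ?_, ?_, ?_, ?_⟩, le_rfl,
          Or.inr (Or.inr ⟨rfl, rfl, rfl⟩)⟩
      · simp [t12]
      · simp [t11]
      · simp
      · simp [t3]
      · simpa [c3] using h.cur
      · simpa [c1] using h.saved
      · simpa [c3] using h.potential
      · intro _
        refine ⟨hXb, fun ⟨c, hc⟩ => ?_⟩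
        exact false_of_potential hr (hc x hqx hxX) hfar hb'' (h.potential c hXb hc)
      · simpa [c1] using h.rest

/-- Between two moves the scan passes only points up to the record `X`. The cost is therefore
charged to the length `X - q` of the run rather than to `b - q`, and adds up over consecutive runs
to the length of the interval. -/
lemma halts_grow {T : ℕ} (hd : 1 ≤ d) (he : 0 < e) (he' : e ≤ 1 / 2)
    (hr : 0 ≤ r) (hT : (1 - e) ^ T * (4 + e) < e) (hs : GrowEnv d A e r q b o n s)
    (hw : o + n * d + d < 2 ^ w) (hwb : b < 2 ^ w) (hqb : q < b) :
    Halts w grow s fun t N => ∃ X, t.ireg 11 = X ∧ q < X ∧ X ≤ b ∧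
      (∀ y, q ≤ y → y < X → ‖pt d A (y * d) - pt d (t.rarr 1) (o + n * d)‖ ≤ (1 + e) * r) ∧
      (X < b → ¬ ∃ c, ∀ y, q ≤ y → y ≤ X → ‖pt d A (y * d) - c‖ ≤ r) ∧
      (∀ y, ¬ (o + n * d ≤ y ∧ y < o + n * d + d) → t.rarr 1 y = s.rarr 1 y) ∧
      N ≤ 150 * d * ((2 * T + 3) * (X - q)) := by
  refine halts_seq ((halts_loadCentre hs (by omega)).imp ?_)
  rintro s₁ N₁ hf₁ ⟨hc₁, hN₁⟩
  have h₁ := hs.of_frame hf₁ rfl rfl rfl rfl rfl rfl rfl rfl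
  refine halts_seq ((halts_saveCentre h₁ hw).imp ?_)
  rintro s₂ N₂ hf₂ ⟨e₂, hc₂, hr₂, hN₂⟩
  have h₂ := h₁.of_frame hf₂ rfl rfl rfl rfl rfl rfl rfl rfl
  have hc₃ : pt d (s₂.rarr 3) 0 = pt d A (q * d) := by rw [e₂, hc₁]
  rw [hc₁] at hc₂
  refine halts_iset_seq (by simp [h₂.start]; omega) (halts_iset_seq (by simp [h₂.start]; omega)
    (halts_rset_seq (halts_iset_seq (by simpa using (by omega : 1 < 2 ^ w)) ?_)))
  set t := (Memory.rset _ 3 _).iset 13 _ with ht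
  have h₃ : GrowEnv d A e r q b o n t := by
    constructor <;> simp [ht, h₂.dim, h₂.last, h₂.addr, h₂.count, h₂.start, h₂.prec, h₂.rad, h₂.pts]
  have hR : 0 ≤ (1 + e) * r := by positivity
  -- In the variant a remaining move weighs `b + 1`, more than the progress of `x` that a restart
  -- can destroy; `g` accounts for the round in which the run gets stuck. The step bound uses the
  -- record `X`, which never decreases.
  refine halts_loop (fun v N u => ∃ τ x X g, Growing d A e r q b (o + n * d) (s.rarr 1) T τ x X g u ∧
    v = (T - τ) * (b + 1) + (b - x) + g ∧ N ≤ 150 * d * (τ * (X - q + 1) + (x - q) + (1 - g)))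
    (v₀ := T * (b + 1) + (b - (q + 1)) + 1) ?_ ?_ ?_
  · refine ⟨0, q + 1, q + 1, 1, ⟨?_, ?_, ?_, ?_, by omega, by omega, le_rfl, by omega, by omega, id, le_rfl,
      ?_, ?_, ?_, by simp, ?_⟩, by simp, by simp⟩
    · simp [ht, h₂.start]
    · simp [ht, h₂.start]
    · simp [ht]
    · simp [ht]
    · intro y hy hy'
      obtain rfl : y = q := by omega
      simpa [ht, hc₃] using hR
    · intro y hy hy'
      obtain rfl : y = q := by omega
      simpa [ht, hc₂] using hR
    · intro c _ hc
      have h1 : ‖pt d A (q * d) - c‖ ^ 2 ≤ r ^ 2 := by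
        have := hc q le_rfl (by omega)
        gcongr
      simp [ht, hc₃]
      linarith
    · intro y hy
      simp only [ht, iset_rarr, rset_rarr]
      rw [hr₂ y hy]
      exact congrFun (hf₁.rarr 1 rfl) y
  · rintro v N u hf ⟨τ, x, X, g, hG, rfl, hN⟩ hb
    have hu : GrowEnv d A e r q b o n u := h₃.of_frame hf rfl rfl rfl rfl rfl rfl rfl rfl
    simp only [BExp.holds_and, BExp.holds_ilt, BExp.holds_ile, IExp.eval_reg, IExp.eval_one, hG.look,
      hu.last, hG.flag] at hb
    obtain rfl : g = 1 := le_antisymm hG.flag_le hb.2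
    refine (halts_scanStep hd he he' hr hT hu hw hwb hb.1 hG).imp ?_
    rintro u' N' _ ⟨hN', τ', x', X', g', hG', hX, hcase⟩
    have hτ := hG'.moves
    have hqX := hG.start_lt
    have hxX := hG.look_le
    have hqx := hG.start_le
    refine ⟨_, ?_, τ', x', X', g', hG', rfl, ?_⟩
    · rcases hcase with ⟨rfl, rfl, rfl⟩ | ⟨h1, h2, rfl⟩ | ⟨rfl, rfl, rfl⟩
      · omega
      · have : T - τ = (T - τ') + 1 := by omega
        rw [this, Nat.add_mul, h2]
        omega
      · omega
    · have hstep : τ * (X - q + 1) + (x - q) + 1 ≤ τ' * (X' - q + 1) + (x' - q) + (1 - g') := by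
        rcases hcase with ⟨rfl, rfl, rfl⟩ | ⟨h1, h2, rfl⟩ | ⟨rfl, rfl, rfl⟩
        · have : τ' * (X - q + 1) ≤ τ' * (X' - q + 1) := by gcongr
          omega
        · have : (τ + 1) * (X - q + 1) ≤ (τ + 1) * (X' - q + 1) := by gcongr
          rw [Nat.add_mul τ 1 (X - q + 1)] at this
          rw [h1]
          omega
        · have : τ' * (X - q + 1) ≤ τ' * (X' - q + 1) := by gcongr
          omega
      refine le_trans ?_ (Nat.mul_le_mul_left (150 * d) hstep)
      rw [Nat.mul_add (150 * d) _ 1]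
      rw [Nat.sub_self, Nat.add_zero] at hN
      simp only [BExp.cost_and, BExp.cost_ilt, BExp.cost_ile, IExp.cost_reg, IExp.cost_one]
      omega
  · rintro v N u hf ⟨τ, x, X, g, hG, rfl, hN⟩ hb
    have hu : GrowEnv d A e r q b o n u := h₃.of_frame hf rfl rfl rfl rfl rfl rfl rfl rfl
    simp only [BExp.holds_and, BExp.holds_ilt, BExp.holds_ile, IExp.eval_reg, IExp.eval_one, hG.look,
      hu.last, hG.flag] at hb
    have hτ := hG.moves
    have hqX := hG.start_lt
    have hxX := hG.look_le
    have hXb := hG.last_le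
    refine ⟨X, hG.last, hqX, hXb, hG.saved, fun hX => (hG.stuck ?_).2, hG.rest, ?_⟩
    · have := hG.flag_le
      omega
    · have h1 : τ * (X - q + 1) + (x - q) + (1 - g) + 1 ≤ (2 * T + 3) * (X - q) := by
        -- Since `X - q ≥ 1`, a scan of `X - q + 1` points is at most twice the run; this explains
        -- the `2 * T`.
        obtain ⟨δ, hδ⟩ : ∃ δ, X - q = δ + 1 := ⟨X - q - 1, by omega⟩
        rw [hδ]
        have h2 : τ * (δ + 1 + 1) ≤ T * (2 * δ + 2) := Nat.mul_le_mul hτ (by omega)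
        have h3 : (2 * T + 3) * (δ + 1) = T * (2 * δ + 2) + 3 * (δ + 1) := by ring
        omega
      refine le_trans ?_ (Nat.mul_le_mul_left (150 * d) h1)
      rw [Nat.mul_add (150 * d) _ 1]
      simp at hN₁ hN₂ ⊢
      omega

end grow

/-! ## Covering an interval by few balls of a given radius

Further integer registers: `6` the beginning of the interval. -/

/-- Cover an interval greedily. -/
def cover : Prog :=
  .iset 9 0 ;; .iset 10 (.reg 6) ;;
  .loop (.and (.ilt (.reg 10) (.reg 7)) (.ilt (.reg 9) (.reg 1)))
    (grow ;; .iset 9 (.reg 9 + 1) ;; .iset 10 (.reg 11))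

/-- The memory cells that an interval is covered from. -/
structure CoverEnv (d : ℕ) (A : ℕ → ℝ) (e : ℝ) (k a b o : ℕ) (t : Memory) : Prop where
  runs : t.ireg 1 = k
  dim : t.ireg 2 = d
  first : t.ireg 6 = a
  last : t.ireg 7 = b
  addr : t.ireg 8 = o
  prec : t.rreg 1 = e
  pts : t.rarr 0 = A

section cover
variable {w d : ℕ} {A : ℕ → ℝ} {e r : ℝ} {k a b o : ℕ} {s : Memory}

lemma CoverEnv.of_frame {c : Prog} {t : Memory} (h : CoverEnv d A e k a b o s) (hf : Frame c s t)
    (h1 : c.setsI 1 = false) (h2 : c.setsI 2 = false) (h6 : c.setsI 6 = false)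
    (h7 : c.setsI 7 = false) (h8 : c.setsI 8 = false) (h1' : c.setsR 1 = false)
    (h0 : c.putsR 0 = false) : CoverEnv d A e k a b o t :=
  ⟨(hf.ireg 1 h1).trans h.runs, (hf.ireg 2 h2).trans h.dim, (hf.ireg 6 h6).trans h.first,
    (hf.ireg 7 h7).trans h.last, (hf.ireg 8 h8).trans h.addr, (hf.rreg 1 h1').trans h.prec,
    (hf.rarr 0 h0).trans h.pts⟩

/-- The curve with `n` points whose coordinates are stored from the address `o` on. -/
def curveAt (d : ℕ) (B : ℕ → ℝ) (o n : ℕ) : List (Point d) :=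
  (List.range n).map fun j => pt d B (o + j * d)

lemma curveAt_congr {B B' : ℕ → ℝ} {n : ℕ} (h : ∀ y, o ≤ y → y < o + n * d → B' y = B y) :
    curveAt d B' o n = curveAt d B o n := by
  refine List.map_congr_left fun j hj => ?_
  ext i
  have h1 : (j + 1) * d ≤ n * d := Nat.mul_le_mul_right d (List.mem_range.mp hj)
  rw [Nat.add_mul] at h1
  have := i.2
  exact h _ (by omega) (by omega)

lemma curveAt_succ (B : ℕ → ℝ) (n : ℕ) :
    curveAt d B o (n + 1) = curveAt d B o n ++ [pt d B (o + n * d)] := by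
  simp [curveAt, List.range_succ]

@[simp] lemma length_curveAt (B : ℕ → ℝ) (n : ℕ) : (curveAt d B o n).length = n := by
  simp [curveAt]

lemma Cov.mono_radius {p : ℕ → Point d} {r' : ℝ} (h : Cov p r k a b) (hr : r ≤ r') :
    Cov p r' k a b := by
  induction k generalizing a with
  | zero => exact h
  | succ k ih =>
    obtain ⟨e, c, h1, h2⟩ := h
    exact ⟨e, c, fun y hy hy' => (h1 y hy hy').trans hr, ih h2⟩

lemma BallCover.cov {p : ℕ → Point d} {S : List (Point d)} (h : BallCover p r a b S) :
    Cov p r S.length a b := by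
  induction h with
  | nil a => exact le_refl a
  | cons _ h1 _ ih => exact ⟨_, _, h1, ih⟩

/-- Greedy exchange: each grown run either reaches `b` or cannot be extended even by a ball of the
exact radius `r`. By `Cov.greedy` it reaches at least as far as the first run of any cover of radius
`r`, so `n` greedy runs leave a rest that `k - n` exact runs cover. Only the balls themselves are
larger, by the factor `1 + e`. -/
lemma halts_cover {T : ℕ} (hd : 1 ≤ d) (he : 0 < e) (he' : e ≤ 1 / 2)
    (hr : 0 ≤ r) (hT : (1 - e) ^ T * (4 + e) < e) (hs : CoverEnv d A e k a b o s)
    (hsr : s.rreg 2 = r) (hw : o + k * d < 2 ^ w) (hwb : b < 2 ^ w) (hwk : k < 2 ^ w)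
    (hab : a < b) :
    Halts w cover s fun t N => ∃ n q, t.ireg 9 = n ∧ t.ireg 10 = q ∧ n ≤ k ∧ q ≤ b ∧
      BallCover (fun x => pt d A (x * d)) ((1 + e) * r) a q (curveAt d (t.rarr 1) o n) ∧
      (Cov (fun x => pt d A (x * d)) r k a b → q = b) ∧
      (∀ y, ¬ (o ≤ y ∧ y < o + k * d) → t.rarr 1 y = s.rarr 1 y) ∧
      N ≤ 200 * d * ((2 * T + 3) * (b - a)) := by
  refine halts_iset_seq (by simp) (halts_iset_seq (by simp [hs.first]; omega) ?_)
  set t := (Memory.iset _ 9 _).iset 10 _ with ht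
  have h₃ : CoverEnv d A e k a b o t := by
    constructor <;> simp [ht, hs.dim, hs.last, hs.addr, hs.runs, hs.first, hs.prec, hs.pts]
  refine halts_loop (fun v N u => ∃ n q, u.ireg 9 = n ∧ u.ireg 10 = q ∧ n ≤ k ∧ a ≤ q ∧ q ≤ b ∧
    BallCover (fun x => pt d A (x * d)) ((1 + e) * r) a q (curveAt d (u.rarr 1) o n) ∧
    (Cov (fun x => pt d A (x * d)) r k a b →
      ∃ k', k = n + k' ∧ Cov (fun x => pt d A (x * d)) r k' q b) ∧
    (∀ y, ¬ (o ≤ y ∧ y < o + k * d) → u.rarr 1 y = s.rarr 1 y) ∧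
    v = b - q ∧ N ≤ 180 * d * ((2 * T + 3) * (q - a))) (v₀ := b - a) ?_ ?_ ?_
  · refine ⟨0, a, by simp [ht], by simp [ht, hs.first], by omega, le_rfl, hab.le, ?_, ?_, ?_, rfl,
      by simp⟩
    · exact .nil a
    · exact fun h => ⟨k, by omega, h⟩
    · intro y _
      rfl
  · rintro v N u hf ⟨n, q, hn, hq, hnk, haq, hqb, hB, hC, hrest, rfl, hN⟩ hb
    have hu := h₃.of_frame hf rfl rfl rfl rfl rfl rfl rfl
    have hur : u.rreg 2 = r := (hf.rreg 2 rfl).trans (by simpa [ht] using hsr)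
    have henv : GrowEnv d A e r q b o n u :=
      ⟨hu.dim, hu.last, hu.addr, hn, hq, hu.prec, hur, hu.pts⟩
    simp only [BExp.holds_and, BExp.holds_ilt, IExp.eval_reg, hn, hq, hu.last, hu.runs] at hb
    have hnd : n * d + d ≤ k * d := by
      have := Nat.mul_le_mul_right d (Nat.succ_le_of_lt hb.2)
      rwa [Nat.succ_mul] at this
    refine halts_seq ((halts_grow hd he he' hr hT henv (by omega) hwb hb.1).imp ?_)
    rintro u' N' hf' ⟨X, hX, hqX, hXb, hball, hstuck, hrest', hN'⟩
    have hn' : u'.ireg 9 = n := (hf'.ireg 9 rfl).trans hn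
    refine halts_iset_seq (by simp [hn']; omega) (halts_iset (by simp [hX]; omega) ⟨b - X, by omega,
      n + 1, X, by simp [hn'], by simp [hX], by omega, by omega, hXb, ?_, ?_, ?_, rfl, ?_⟩)
    · simp only [iset_rarr]
      rw [curveAt_succ]
      refine BallCover.append (e := q) ?_ (.cons hqX hball (.nil X))
      rw [curveAt_congr fun y hy hy' => hrest' y (by omega)]
      exact hB
    · intro hcov
      obtain ⟨k', hk, hc⟩ := hC hcov
      obtain ⟨k'', rfl, hc'⟩ := hc.greedy hb.1 hstuck
      exact ⟨k'', by omega, by rwa [min_eq_left hXb] at hc'⟩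
    · intro y hy
      simp only [iset_rarr]
      rw [hrest' y (by omega), hrest y hy]
    · have h1 : (2 * T + 3) * (X - a) = (2 * T + 3) * (q - a) + (2 * T + 3) * (X - q) := by
        rw [← Nat.mul_add]
        congr 1
        omega
      have h2 : 1 ≤ (2 * T + 3) * (X - q) := Nat.mul_pos (by omega) (by omega)
      have h3 : d ≤ d * ((2 * T + 3) * (X - q)) := Nat.le_mul_of_pos_right d h2
      rw [h1]
      simp only [Nat.mul_assoc, Nat.mul_add d] at *
      simp only [BExp.cost_and, BExp.cost_ilt, IExp.cost_reg, IExp.cost_one, IExp.cost_add]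
      omega
  · rintro v N u hf ⟨n, q, hn, hq, hnk, haq, hqb, hB, hC, hrest, rfl, hN⟩ hb
    have hu := h₃.of_frame hf rfl rfl rfl rfl rfl rfl rfl
    simp only [BExp.holds_and, BExp.holds_ilt, IExp.eval_reg, hn, hq, hu.last, hu.runs] at hb
    refine ⟨n, q, hn, hq, hnk, hqb, hB, ?_, hrest, ?_⟩
    · intro hcov
      obtain ⟨k', hk, hc⟩ := hC hcov
      by_contra hne
      -- Having stopped before `b`, the loop has used all `k` runs, and `Cov` with no run left
      -- forces `b ≤ q`.
      obtain rfl : k' = 0 := by omega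
      have : b ≤ q := hc
      omega
    · have h1 : (2 * T + 3) * (q - a) ≤ (2 * T + 3) * (b - a) := Nat.mul_le_mul_left _ (by omega)
      have h2 : 1 ≤ (2 * T + 3) * (b - a) := Nat.mul_pos (by omega) (by omega)
      have h3 := Nat.mul_le_mul_left d h1
      have h4 : d ≤ d * ((2 * T + 3) * (b - a)) := Nat.le_mul_of_pos_right d h2
      simp only [Nat.mul_assoc] at *
      simp only [BExp.cost_and, BExp.cost_ilt, IExp.cost_reg, IExp.cost_zero]
      omega

end cover

/-! ## The scale of the optimal radius

Further integer registers: `15` a position in the sorted sequence of gaps, `16` the number of gaps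
found, `17` the current gap. Real register `5`: the length of a gap. Integer array `2`: the gaps in
decreasing order. Real array `2`: their lengths. -/

/-- Find the gap of rank `k` in the interval; its length is `0` if there are fewer gaps. -/
def pickGap : Prog :=
  .iset 16 0 ;; .iset 15 0 ;;
  .loop (.and (.ilt (.reg 15 + 1) (.reg 0)) (.ilt (.reg 16) (.reg 1)))
    (.iset 17 (.get 2 (.reg 15)) ;;
      .ite (.and (.ile (.reg 6) (.reg 17)) (.ilt (.reg 17 + 1) (.reg 7)))
        (.iset 16 (.reg 16 + 1) ;; .rset 5 (.get 2 (.reg 17))) .skip ;;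
      .iset 15 (.reg 15 + 1)) ;;
  .ite (.ilt (.reg 16) (.reg 1)) (.rset 5 0) .skip

/-- `ord 0, …, ord (M - 1)` is the sequence `0, …, M - 1` by decreasing `G`. -/
structure SortsDown (G : ℕ → ℝ) (M : ℕ) (ord : ℕ → ℕ) : Prop where
  lt : ∀ z < M, ord z < M
  inj : ∀ z < M, ∀ z' < M, ord z = ord z' → z = z'
  surj : ∀ f < M, ∃ z < M, ord z = f
  anti : ∀ z z', z ≤ z' → z' < M → G (ord z') ≤ G (ord z)

section pickGap
variable {w d : ℕ} {A : ℕ → ℝ} {e : ℝ} {m k a b o : ℕ} {s : Memory}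

/-- The number of gaps in the interval among the first `y` gaps. -/
def gapCount (ord : ℕ → ℕ) (a b y : ℕ) : ℕ :=
  ((Finset.range y).filter fun z => a ≤ ord z ∧ ord z + 1 < b).card

lemma gapCount_succ (ord : ℕ → ℕ) (a b y : ℕ) : gapCount ord a b (y + 1) =
    gapCount ord a b y + if a ≤ ord y ∧ ord y + 1 < b then 1 else 0 := by
  rw [gapCount, Finset.range_add_one, Finset.filter_insert]
  split_ifs with h
  · rw [Finset.card_insert_of_notMem (by simp)]
    rfl
  · rfl

/-- Gaps longer than `g` can only stand before position `y`. This count is for strict and the next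
one for weak inequality, so ties in length are harmless. -/
lemma SortsDown.card_gt_le {G : ℕ → ℝ} {ord : ℕ → ℕ} {y : ℕ} {g : ℝ} (h : SortsDown G (m - 1) ord)
    (hb : b ≤ m) (hy : ∀ z, y ≤ z → z < m - 1 → G (ord z) ≤ g) :
    ((Finset.Ico a (b - 1)).filter fun f => g < G f).card ≤ gapCount ord a b y := by
  refine (Finset.card_le_card (t := ((Finset.range y).filter fun z => a ≤ ord z ∧ ord z + 1 < b).image
    ord) ?_).trans Finset.card_image_le
  intro f
  simp only [Finset.mem_filter, Finset.mem_Ico, Finset.mem_image, Finset.mem_range]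
  rintro ⟨⟨h1, h2⟩, h3⟩
  obtain ⟨z, hz, rfl⟩ := h.surj f (by omega)
  refine ⟨z, ⟨?_, h1, by omega⟩, rfl⟩
  by_contra hc
  exact absurd (hy z (not_lt.mp hc) hz) (not_le.mpr h3)

lemma SortsDown.le_card_ge {G : ℕ → ℝ} {ord : ℕ → ℕ} {y : ℕ} {g : ℝ} (h : SortsDown G (m - 1) ord)
    (hym : y ≤ m - 1) (hy : ∀ z < y, g ≤ G (ord z)) :
    gapCount ord a b y ≤ ((Finset.Ico a (b - 1)).filter fun f => g ≤ G f).card := by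
  rw [gapCount, ← Finset.card_image_of_injOn (f := ord)]
  · refine Finset.card_le_card ?_
    intro f
    simp only [Finset.mem_filter, Finset.mem_Ico, Finset.mem_image, Finset.mem_range]
    rintro ⟨z, ⟨hz, h1, h2⟩, rfl⟩
    exact ⟨⟨h1, by omega⟩, hy z hz⟩
  · intro z hz z' hz' heq
    simp only [Finset.coe_filter, Finset.mem_range, Set.mem_ofPred_eq] at hz hz'
    exact h.inj z (by omega) z' (by omega) heq

/-- The gap of rank `k` in the interval serves twice. Fewer than `k` gaps are longer, so cutting
there gives `k` runs of radius `m * g`; at least `k` gaps are as long, so a cover with `k` runs has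
one of them inside a run. With fewer than `k` gaps in all, every point can be its own run and `g =
0` is right. -/
lemma halts_pickGap (hs : CoverEnv d A e k a b o s) (hm : s.ireg 0 = m) (hk : 1 ≤ k)
    (hord : SortsDown (s.rarr 2) (m - 1) (s.iarr 2))
    (hG : ∀ x, x + 1 < m → s.rarr 2 x = ‖pt d A (x * d) - pt d A ((x + 1) * d)‖)
    (hab : a < b) (hb : b ≤ m) (hwk : k < 2 ^ w) (hwm : m < 2 ^ w) :
    Halts w pickGap s fun t N => ∃ g, t.rreg 5 = g ∧ 0 ≤ g ∧
      Cov (fun x => pt d A (x * d)) (m * g) k a b ∧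
      (∀ r, Cov (fun x => pt d A (x * d)) r k a b → g ≤ 2 * r) ∧ N ≤ 80 * m := by
  have hGf : ∀ f ∈ Finset.Ico a (b - 1),
      s.rarr 2 f = ‖pt d A (f * d) - pt d A ((f + 1) * d)‖ := by
    intro f hf
    rw [Finset.mem_Ico] at hf
    exact hG f (by omega)
  have hcov : ∀ g, 0 ≤ g → ((Finset.Ico a (b - 1)).filter fun f => g < s.rarr 2 f).card < k →
      Cov (fun x => pt d A (x * d)) (m * g) k a b := by
    intro g hg hcard
    refine cov_of_card_gaps_lt hg hab ?_ ?_
    · have h1 : (b : ℝ) ≤ m := by exact_mod_cast hb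
      have h2 : (0 : ℝ) ≤ a := by positivity
      gcongr
      linarith
    · rwa [Finset.filter_congr fun f hf => by rw [hGf f hf]] at hcard
  refine halts_iset_seq (by simp) (halts_iset_seq (by simp) (halts_seq ?_))
  set t := (Memory.iset _ 16 _).iset 15 _ with ht
  refine halts_loop (fun v N u => ∃ y n, u.ireg 15 = y ∧ u.ireg 16 = n ∧ y ≤ m - 1 ∧ n ≤ k ∧
    n = gapCount (s.iarr 2) a b y ∧
    (1 ≤ n → ∃ z < y, n = gapCount (s.iarr 2) a b z + 1 ∧ n = gapCount (s.iarr 2) a b (z + 1) ∧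
      u.rreg 5 = s.rarr 2 (s.iarr 2 z)) ∧
    v = m - 1 - y ∧ N ≤ 45 * y) (v₀ := m - 1) ?_ ?_ ?_
  · refine ⟨0, 0, by simp [ht], by simp [ht], by omega, by omega, ?_, by omega, rfl, by omega⟩
    simp [gapCount]
  · rintro v N u hf ⟨y, n, hy, hn, hym, hnk, hcnt, hlast, rfl, hN⟩ hc
    have e2 : u.iarr 2 = s.iarr 2 := hf.iarr 2 rfl
    have r2 : u.rarr 2 = s.rarr 2 := hf.rarr 2 rfl
    have e0 : u.ireg 0 = m := (hf.ireg 0 rfl).trans hm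
    have e1 : u.ireg 1 = k := (hf.ireg 1 rfl).trans hs.runs
    have e6 : u.ireg 6 = a := (hf.ireg 6 rfl).trans hs.first
    have e7 : u.ireg 7 = b := (hf.ireg 7 rfl).trans hs.last
    simp only [BExp.holds_and, BExp.holds_ilt, IExp.eval_reg, IExp.eval_add, IExp.eval_one, hy, hn,
      e0, e1] at hc
    have hlt := hord.lt y (by omega)
    refine halts_iset_seq (by simp [e2, hy]; omega) (halts_seq (halts_ite (fun hin => ?_)
      (fun hin => ?_)))
    · have hin' : a ≤ s.iarr 2 y ∧ s.iarr 2 y + 1 < b := by simpa [e2, hy, e6, e7] using hin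
      have hsucc := gapCount_succ (s.iarr 2) a b y
      rw [if_pos hin'] at hsucc
      clear hlast
      refine halts_iset_seq (by simp [hn]; omega) (halts_rset (halts_iset (by simp [hy]; omega)
        ⟨m - 1 - (y + 1), by omega, y + 1, n + 1, by simp [hy], by simp [hn], by omega, by omega,
          by omega, fun _ => ⟨y, by omega, by omega, by omega, ?_⟩, rfl, ?_⟩))
      · simp [e2, r2, hy]
      · simp
        omega
    · have hin' : ¬ (a ≤ s.iarr 2 y ∧ s.iarr 2 y + 1 < b) := by
        simpa [e2, hy, e6, e7] using hin
      have hsucc := gapCount_succ (s.iarr 2) a b y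
      rw [if_neg hin'] at hsucc
      refine halts_skip (halts_iset (by simp [hy]; clear hlast; omega)
        ⟨m - 1 - (y + 1), by clear hlast; omega, y + 1, n, by simp [hy], by simp [hn], by clear hlast; omega, by clear hlast; omega,
          by clear hlast; omega, fun h1 => ?_, rfl, ?_⟩)
      · obtain ⟨z, hz, h2, h3, h4⟩ := hlast h1
        exact ⟨z, by omega, h2, h3, by simpa using h4⟩
      · simp
        omega
  · rintro v N u hf ⟨y, n, hy, hn, hym, hnk, hcnt, hlast, rfl, hN⟩ hc
    have e0 : u.ireg 0 = m := (hf.ireg 0 rfl).trans hm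
    have e1 : u.ireg 1 = k := (hf.ireg 1 rfl).trans hs.runs
    simp only [BExp.holds_and, BExp.holds_ilt, IExp.eval_reg, IExp.eval_add, IExp.eval_one, hy, hn,
      e0, e1] at hc
    refine halts_ite (fun hlt => ?_) (fun hlt => ?_)
    · simp only [BExp.holds_ilt, IExp.eval_reg, hn, e1] at hlt
      refine halts_rset ⟨0, by simp, le_rfl, hcov 0 le_rfl ?_, fun r hr => ?_, ?_⟩
      · refine lt_of_le_of_lt (hord.card_gt_le hb (y := y) ?_) (by clear hlast; omega)
        intro z hz hz'
        omega
      · have := hr.nonneg hab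
        linarith
      · simp
        omega
    · simp only [BExp.holds_ilt, IExp.eval_reg, hn, e1] at hlt
      obtain ⟨z, hz, h2, h3, h4⟩ := hlast (by omega)
      clear hlast
      have hg : 0 ≤ s.rarr 2 (s.iarr 2 z) := by
        have := hord.lt z (by omega)
        rw [hG _ (by omega)]
        exact norm_nonneg _
      refine halts_skip ⟨_, h4, hg, hcov _ hg ?_, fun r hr => hr.gap_le hab ?_, ?_⟩
      · refine lt_of_le_of_lt (hord.card_gt_le hb (y := z) ?_) (by omega)
        intro z' hz' hz''
        exact hord.anti z z' hz' hz''
      · have := hord.le_card_ge (a := a) (b := b) (y := z + 1) (by omega) fun z' hz' =>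
          hord.anti z' z (by omega) (by omega)
        rw [Finset.filter_congr fun f hf => by rw [hGf f hf]] at this
        omega
      · simp
        omega

end pickGap

/-! ## The search for the radius

Further real registers: `6` and `7`, the bounds between which the radius is searched. -/

/-- Find the optimal radius up to a factor, and an optimal cover up to that factor. -/
def search : Prog :=
  pickGap ;; .rset 6 (.reg 5 / 2) ;; .rset 7 (.cast (.reg 0) * .reg 5) ;;
  .loop (.not (.rle (.reg 7 - .reg 6) (.reg 1 * .reg 5)))
    (.rset 2 ((.reg 6 + .reg 7) / 2) ;; cover ;;
      .ite (.ile (.reg 7) (.reg 10)) (.rset 7 (.reg 2)) (.rset 6 (.reg 2))) ;;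
  .rset 2 ((1 + .reg 1) * .reg 7) ;; cover

section search
variable {w d : ℕ} {A : ℕ → ℝ} {e : ℝ} {m k a b o : ℕ} {s : Memory}

/-- Bisection with an approximate decision procedure: failure at the midpoint proves an exact lower
bound, whereas success gives a cover only for `1 + e` times the midpoint. Measuring the width
relative to `g`, which is at most twice any feasible radius, turns the additive error into a
relative one. For `g = 0` the loop is never entered. -/
lemma halts_search {T R : ℕ} (hd : 1 ≤ d) (he : 0 < e) (he' : e ≤ 1 / 16)
    (hT : (1 - e) ^ T * (4 + e) < e) (hR : (m : ℝ) ≤ e * 2 ^ R) (hs : CoverEnv d A e k a b o s)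
    (hm : s.ireg 0 = m) (hk : 1 ≤ k)
    (hord : SortsDown (s.rarr 2) (m - 1) (s.iarr 2))
    (hG : ∀ x, x + 1 < m → s.rarr 2 x = ‖pt d A (x * d) - pt d A ((x + 1) * d)‖)
    (hab : a < b) (hb : b ≤ m) (hw : o + k * d < 2 ^ w) (hwk : k < 2 ^ w) (hwm : m < 2 ^ w) :
    Halts w search s fun t N => ∃ n ρ, t.ireg 9 = n ∧ n ≤ k ∧ 0 ≤ ρ ∧
      BallCover (fun x => pt d A (x * d)) ρ a b (curveAt d (t.rarr 1) o n) ∧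
      (∀ r, Cov (fun x => pt d A (x * d)) r k a b → ρ ≤ (1 + 8 * e) * r) ∧
      (∀ y, ¬ (o ≤ y ∧ y < o + k * d) → t.rarr 1 y = s.rarr 1 y) ∧
      N ≤ 400 * (d * ((2 * T + 3) * m)) * (R + 2) := by
  have hm1 : 1 ≤ m := by omega
  have hM : (2 * T + 3) * (b - a) ≤ (2 * T + 3) * m := Nat.mul_le_mul_left _ (by omega)
  have hM1 := Nat.mul_le_mul_left d hM
  have hM2 : m ≤ d * ((2 * T + 3) * m) :=
    (Nat.le_mul_of_pos_left m (by omega : 0 < 2 * T + 3)).trans (Nat.le_mul_of_pos_left _ hd)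
  refine halts_seq ((halts_pickGap hs hm hk hord hG hab hb hwk hwm).imp ?_)
  rintro s₁ N₁ hf₁ ⟨g, hg, hg0, hcov, hlow, hN₁⟩
  have h₁ := hs.of_frame hf₁ rfl rfl rfl rfl rfl rfl rfl
  have m₁ : s₁.ireg 0 = m := (hf₁.ireg 0 rfl).trans hm
  have o₁ : s₁.rarr 1 = s.rarr 1 := hf₁.rarr 1 rfl
  refine halts_rset_seq (halts_rset_seq (halts_seq ?_))
  set t := (Memory.rset _ 6 _).rset 7 _ with ht
  have h₂ : CoverEnv d A e k a b o t := by
    constructor <;> simp [ht, h₁.dim, h₁.last, h₁.addr, h₁.runs, h₁.first, h₁.prec, h₁.pts]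
  have hm' : (1 : ℝ) ≤ m := by exact_mod_cast hm1
  refine halts_loop (fun v N u => ∃ lo hi τ, u.rreg 6 = lo ∧ u.rreg 7 = hi ∧ τ ≤ R ∧ v = R - τ ∧
    0 ≤ lo ∧ lo ≤ hi ∧ hi - lo ≤ m * g / 2 ^ τ ∧
    (∀ r, Cov (fun x => pt d A (x * d)) r k a b → lo ≤ r) ∧
    Cov (fun x => pt d A (x * d)) ((1 + e) * hi) k a b ∧
    (∀ y, ¬ (o ≤ y ∧ y < o + k * d) → u.rarr 1 y = s.rarr 1 y) ∧
    N ≤ 240 * (d * ((2 * T + 3) * m)) * τ) (v₀ := R) ?_ ?_ ?_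
  · refine ⟨g / 2, m * g, 0, by simp [ht, hg], by simp [ht, hg, m₁], by omega, rfl, by linarith,
      by nlinarith, by simp; linarith, fun r hr => ?_, hcov.mono_radius ?_, fun y _ => ?_, by simp⟩
    · have := hlow r hr
      linarith
    · have : 0 ≤ m * g := by positivity
      nlinarith
    · exact congrFun o₁ y
  · rintro v N u hf ⟨lo, hi, τ, hlo, hhi, hτ, rfl, hlo0, hlohi, hgap, hlow', hcov', hrest, hN⟩ hc
    have hu := h₂.of_frame hf rfl rfl rfl rfl rfl rfl rfl
    have u5 : u.rreg 5 = g := (hf.rreg 5 rfl).trans (by simpa [ht] using hg)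
    simp only [BExp.holds_not, BExp.holds_rle, RExp.eval_sub, RExp.eval_reg, RExp.eval_mul, hlo, hhi,
      hu.prec, u5, not_le] at hc
    -- After `R` halvings the width is at most `m * g / 2 ^ R ≤ e * g`, and the guard would be
    -- false.
    have hτR : τ < R := by
      by_contra hcon
      obtain rfl : τ = R := by omega
      have h1 : m * g / 2 ^ τ ≤ e * g := by
        rw [div_le_iff₀ (by positivity)]
        nlinarith
      linarith
    refine halts_rset_seq ?_
    set u' := Memory.rset _ 2 _ with hu'
    have h₃ : CoverEnv d A e k a b o u' := by
      constructor <;> simp [hu', hu.dim, hu.last, hu.addr, hu.runs, hu.first, hu.prec, hu.pts]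
    have r₃ : u'.rreg 2 = (lo + hi) / 2 := by simp [hu', hlo, hhi]
    refine halts_seq ((halts_cover hd he (by linarith) (by linarith) hT h₃ r₃ hw (by omega) hwk
      hab).imp ?_)
    rintro u'' N' hf' ⟨n, q, hn, hq, hnk, hqb, hB, hC, hrest', hN'⟩
    have e7 : u''.ireg 7 = b := (hf'.ireg 7 rfl).trans h₃.last
    have r2 : u''.rreg 2 = (lo + hi) / 2 := (hf'.rreg 2 rfl).trans r₃
    have r6 : u''.rreg 6 = lo := (hf'.rreg 6 rfl).trans (by simp [hu', hlo])
    have r7 : u''.rreg 7 = hi := (hf'.rreg 7 rfl).trans (by simp [hu', hhi])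
    have hhalf : (hi - lo) / 2 ≤ m * g / 2 ^ (τ + 1) := by
      rw [pow_succ, ← div_div]
      linarith
    have hrest'' : ∀ y, ¬ (o ≤ y ∧ y < o + k * d) → u''.rarr 1 y = s.rarr 1 y := by
      intro y hy
      rw [hrest' y hy]
      exact hrest y hy
    have hcost : N + ((BExp.not (.rle (.reg 7 - .reg 6) (.reg 1 * .reg 5))).cost +
        (((.reg 6 + .reg 7) / 2 : RExp).cost + 1 + (N' + ((BExp.ile (.reg 7) (.reg 10)).cost + 2 + 1)))
        + 1) ≤ 240 * (d * ((2 * T + 3) * m)) * (τ + 1) := by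
      simp only [BExp.cost_not, BExp.cost_rle, RExp.cost_sub, RExp.cost_reg, RExp.cost_mul,
        RExp.cost_div, RExp.cost_add, RExp.cost_ofNat, BExp.cost_ile, IExp.cost_reg]
      rw [Nat.mul_assoc] at hN'
      rw [Nat.mul_add]
      omega
    refine halts_ite (fun hc' => ?_) (fun hc' => ?_)
    · have hqb' : q = b := by
        simp [e7, hq] at hc'
        omega
      subst hqb'
      refine halts_rset ⟨R - (τ + 1), by omega, lo, (lo + hi) / 2, τ + 1, by simp [r6], by simp [r2],
        by omega, rfl, hlo0, by linarith, by linarith, hlow', ?_, by simpa using hrest'', hcost⟩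
      -- The cover found certifies the radius `(1 + e) * hi` for the new `hi`, which is all that the
      -- invariant asks.
      exact hB.cov.mono (by simpa using hnk)
    · have hqb' : q ≠ b := by
        simp [e7, hq] at hc'
        omega
      refine halts_rset ⟨R - (τ + 1), by omega, (lo + hi) / 2, hi, τ + 1, by simp [r2], by simp [r7],
        by omega, rfl, by linarith, by linarith, by linarith, fun r hr => ?_, hcov',
        by simpa using hrest'', hcost⟩
      by_contra hcon
      exact hqb' (hC (hr.mono_radius (not_le.mp hcon).le))
  · rintro v N u hf ⟨lo, hi, τ, hlo, hhi, hτ, rfl, hlo0, hlohi, hgap, hlow', hcov', hrest, hN⟩ hc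
    have hu := h₂.of_frame hf rfl rfl rfl rfl rfl rfl rfl
    have u5 : u.rreg 5 = g := (hf.rreg 5 rfl).trans (by simpa [ht] using hg)
    simp only [BExp.holds_not, BExp.holds_rle, RExp.eval_sub, RExp.eval_reg, RExp.eval_mul, hlo, hhi,
      hu.prec, u5, not_not] at hc
    refine halts_rset_seq ?_
    set u' := Memory.rset _ 2 _ with hu'
    have h₃ : CoverEnv d A e k a b o u' := by
      constructor <;> simp [hu', hu.dim, hu.last, hu.addr, hu.runs, hu.first, hu.prec, hu.pts]
    have r₃ : u'.rreg 2 = (1 + e) * hi := by simp [hu', hu.prec, hhi]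
    have hhi0 : 0 ≤ hi := by linarith
    have hr0 : 0 ≤ (1 + e) * hi := by positivity
    refine (halts_cover hd he (by linarith) hr0 hT h₃ r₃ hw (by omega) hwk hab).imp ?_
    rintro u'' N' hf' ⟨n, q, hn, hq, hnk, hqb, hB, hC, hrest', hN'⟩
    -- The cover is computed afresh because a failed round may have overwritten the last successful
    -- one. It succeeds at radius `(1 + e) * hi` by the invariant, at the price of a second factor
    -- `1 + e`.
    obtain rfl := hC hcov'
    refine ⟨n, _, hn, hnk, by positivity, hB, fun r hr => ?_, fun y hy => ?_, ?_⟩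
    · have h1 := hlow r hr
      have h2 := hlow' r hr
      have hr0 : 0 ≤ r := hr.nonneg hab
      -- `hi ≤ lo + e * g`, where `lo ≤ r` and `g ≤ 2 * r`.
      have h3 : hi ≤ (1 + 2 * e) * r := by nlinarith
      calc (1 + e) * ((1 + e) * hi) ≤ (1 + e) * ((1 + e) * ((1 + 2 * e) * r)) := by gcongr
        _ = ((1 + e) * (1 + e) * (1 + 2 * e)) * r := by ring
        _ ≤ (1 + 8 * e) * r := by
          refine mul_le_mul_of_nonneg_right ?_ hr0
          nlinarith [mul_pos he he]
    · rw [hrest' y hy]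
      exact hrest y hy
    · have h1 : 240 * (d * ((2 * T + 3) * m)) * τ ≤ 240 * (d * ((2 * T + 3) * m)) * R :=
        Nat.mul_le_mul_left _ hτ
      have h2 : 400 * (d * ((2 * T + 3) * m)) * (R + 2) = 240 * (d * ((2 * T + 3) * m)) * R +
        160 * (d * ((2 * T + 3) * m)) * R + 800 * (d * ((2 * T + 3) * m)) := by ring
      rw [h2]
      rw [Nat.mul_assoc] at hN'
      simp only [BExp.cost_not, BExp.cost_rle, RExp.cost_sub, RExp.cost_reg, RExp.cost_mul,
        RExp.cost_div, RExp.cost_add, RExp.cost_ofNat, RExp.cost_cast, IExp.cost_reg]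
      omega

end search

/-! ## Sorting the gaps

Further integer registers: `19` a rank, `20` and `21` loop counters. -/

/-- Compute the lengths of the gaps. -/
def gaps : Prog :=
  forLoop 20 (.reg 0 - 1) (.iset 10 (.reg 20) ;; loadCentre ;; .iset 12 (.reg 20 + 1) ;; sqDist ;;
    .rput 2 (.reg 20) (.sqrt (.reg 4)))

/-- Count the gaps that precede a given one in the decreasing order. -/
def rankGap : Prog :=
  .iset 19 0 ;;
  forLoop 21 (.reg 0 - 1)
    (.ite (.and (.rle (.get 2 (.reg 20)) (.get 2 (.reg 21)))
        (.not (.and (.rle (.get 2 (.reg 21)) (.get 2 (.reg 20))) (.ile (.reg 20) (.reg 21)))))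
      (.iset 19 (.reg 19 + 1)) .skip)

/-- Sort the gaps. -/
def sortGaps : Prog :=
  forLoop 20 (.reg 0 - 1) (rankGap ;; .iput 2 (.reg 19) (.reg 20))

section sort
variable {w d : ℕ} {A : ℕ → ℝ} {m : ℕ} {s : Memory}

lemma halts_gaps (hd : 1 ≤ d) (hm : s.ireg 0 = m) (h2 : s.ireg 2 = d) (hA : s.rarr 0 = A)
    (hwm : m < 2 ^ w) (hwd : d < 2 ^ w) : Halts w gaps s fun t N =>
      (∀ x, x + 1 < m → t.rarr 2 x = ‖pt d A (x * d) - pt d A ((x + 1) * d)‖) ∧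
      N ≤ 120 * (m * d) + 10 := by
  refine halts_for (m - 1) (85 * d) (fun n t => ∀ x < n,
    t.rarr 2 x = ‖pt d A (x * d) - pt d A ((x + 1) * d)‖) rfl (by omega) ?_ ?_ ?_ ?_
  · intro n t _ hf _
    simp [(hf.ireg 0 rfl).trans hm]
  · intro x hx
    omega
  · intro n t hn hf hi hJ
    have e2 : t.ireg 2 = d := (hf.ireg 2 rfl).trans h2
    have e0 : t.rarr 0 = A := (hf.rarr 0 rfl).trans hA
    refine halts_iset_seq (by simp [hi]; omega) ?_
    set t₁ := Memory.iset _ 10 _ with ht₁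
    have henv : GrowEnv d A (t₁.rreg 1) (t₁.rreg 2) n (t₁.ireg 7) (t₁.ireg 8) (t₁.ireg 9) t₁ := by
      constructor <;> simp [ht₁, e2, e0, hi]
    refine halts_seq ((halts_loadCentre henv hwd).imp ?_)
    rintro t₂ N₂ hf₂ ⟨hc, hN₂⟩
    have i₂ : t₂.ireg 20 = n := (hf₂.ireg 20 rfl).trans (by simp [ht₁, hi])
    have d₂ : t₂.ireg 2 = d := (hf₂.ireg 2 rfl).trans (by simp [ht₁, e2])
    have a₂ : t₂.rarr 0 = A := (hf₂.rarr 0 rfl).trans (by simp [ht₁, e0])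
    have g₂ : t₂.rarr 2 = t.rarr 2 := (hf₂.rarr 2 rfl).trans (by simp [ht₁])
    refine halts_iset_seq (by simp [i₂]; omega) ?_
    set t₃ := Memory.iset _ 12 _ with ht₃
    refine halts_seq ((halts_sqDist (s := t₃) (A := A) (x := n + 1) (by simp [ht₃, d₂]) (by simp [ht₃, a₂])
      (by simp [ht₃, i₂]) hwd).imp ?_)
    rintro t₄ N₄ hf₄ ⟨hD, hN₄⟩
    have i₄ : t₄.ireg 20 = n := (hf₄.ireg 20 rfl).trans (by simp [ht₃, i₂])
    have g₄ : t₄.rarr 2 = t.rarr 2 := (hf₄.rarr 2 rfl).trans (by simp [ht₃, g₂])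
    have hD' : t₄.rreg 4 = ‖pt d A (n * d) - pt d A ((n + 1) * d)‖ ^ 2 := by
      rw [hD, norm_sub_rev]
      simp [ht₃, hc]
    refine halts_rput (by simp [i₄]; omega) ⟨?_, fun x hx => ?_⟩
    · simp
      omega
    · simp only [RExp.eval_sqrt, RExp.eval_reg, iset_rarr, rput_rarr_same, IExp.eval_reg, i₄, g₄, hD']
      rw [Real.sqrt_sq (norm_nonneg _)]
      rcases Nat.lt_succ_iff_lt_or_eq.mp hx with hx | rfl
      · rw [Function.update_of_ne hx.ne, hJ x hx]
      · simp
  · intro t n _ hJ hn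
    refine ⟨fun x hx => hJ x (by omega), hn.trans ?_⟩
    have h1 : (m - 1) * (85 * d + (IExp.reg 0 - 1 : IExp).cost + 9) ≤ m * (97 * d) :=
      Nat.mul_le_mul (by omega) (by simp; omega)
    have h2 : m * (97 * d) = 97 * (m * d) := by ring
    simp at h1 ⊢
    omega

/-- The strict order of the gaps by decreasing length. -/
def Precedes (G : ℕ → ℝ) (f e : ℕ) : Prop := G e ≤ G f ∧ ¬ (G f ≤ G e ∧ e ≤ f)

open Classical in
/-- The number of gaps among the first `n` that precede the gap `e`. -/
noncomputable def rankOf (G : ℕ → ℝ) (n e : ℕ) : ℕ :=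
  ((Finset.range n).filter fun f => Precedes G f e).card

/-- `Precedes` is transitive and irreflexive, ties being broken by the index. So the predecessors of
`f` are predecessors of `e`, and `f` itself is a further one. -/
lemma rankOf_lt_rankOf {G : ℕ → ℝ} {M f e : ℕ} (hf : f < M) (h : Precedes G f e) :
    rankOf G M f < rankOf G M e := by
  classical
  refine Finset.card_lt_card (Finset.ssubset_iff_subset_ne.mpr ⟨fun g => ?_, fun heq => ?_⟩)
  · simp only [Finset.mem_filter]
    rintro ⟨hg, h1, h2⟩
    refine ⟨hg, h.1.trans h1, fun ⟨h3, h4⟩ => ?_⟩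
    have h5 : G f ≤ G e := h1.trans h3
    have h6 : f < e := by
      by_contra hc
      exact h.2 ⟨h5, not_lt.mp hc⟩
    exact h2 ⟨h3.trans h.1, by omega⟩
  · have : f ∈ (Finset.range M).filter fun g => Precedes G g e := by simp [hf, h]
    rw [← heq] at this
    exact (Finset.mem_filter.mp this).2.2 ⟨le_rfl, le_rfl⟩

lemma rankOf_lt {G : ℕ → ℝ} {M e : ℕ} (he : e < M) : rankOf G M e < M := by
  classical
  conv_rhs => rw [← Finset.card_range M]
  refine Finset.card_lt_card (Finset.filter_ssubset.mpr ⟨e, by simpa using he, ?_⟩)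
  exact fun h => h.2 ⟨le_rfl, le_rfl⟩

/-- `ord` inverts the rank, so the rank is an injective map of a finite set into itself and hence a
bijection. -/
lemma sortsDown_of_rankOf {G : ℕ → ℝ} {M : ℕ} {ord : ℕ → ℕ}
    (h : ∀ e < M, ord (rankOf G M e) = e) : SortsDown G M ord := by
  have hinj : ∀ e < M, ∀ e' < M, rankOf G M e = rankOf G M e' → e = e' := by
    intro e he e' he' heq
    rw [← h e he, heq, h e' he']
  have hsurj : ∀ z < M, ∃ e < M, rankOf G M e = z := by
    intro z hz
    have := Finset.surj_on_of_inj_on_of_card_le (s := Finset.range M) (t := Finset.range M)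
      (fun e _ => rankOf G M e) (fun e he => by simpa using rankOf_lt (by simpa using he))
      (fun e e' he he' heq => hinj e (by simpa using he) e' (by simpa using he') heq) le_rfl z
      (by simpa using hz)
    obtain ⟨e, he, heq⟩ := this
    exact ⟨e, by simpa using he, heq.symm⟩
  refine ⟨fun z hz => ?_, fun z hz z' hz' heq => ?_, fun f hf => ⟨_, rankOf_lt hf, h f hf⟩,
    fun z z' hzz hz' => ?_⟩
  · obtain ⟨e, he, rfl⟩ := hsurj z hz
    rwa [h e he]
  · obtain ⟨e, he, rfl⟩ := hsurj z hz
    obtain ⟨e', he', rfl⟩ := hsurj z' hz'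
    rw [h e he, h e' he'] at heq
    rw [heq]
  · obtain ⟨e, he, rfl⟩ := hsurj z (by omega)
    obtain ⟨e', he', rfl⟩ := hsurj z' hz'
    rw [h e he, h e' he']
    by_contra hc
    rw [not_le] at hc
    have := rankOf_lt_rankOf he' (e := e) ⟨hc.le, fun h3 => absurd h3.1 (not_le.mpr hc)⟩
    omega

lemma rankOf_succ_of {G : ℕ → ℝ} {n e : ℕ} (h : Precedes G n e) :
    rankOf G (n + 1) e = rankOf G n e + 1 := by
  rw [rankOf, Finset.range_add_one, Finset.filter_insert, if_pos h,
    Finset.card_insert_of_notMem (by simp)]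
  rfl

lemma rankOf_succ_of_not {G : ℕ → ℝ} {n e : ℕ} (h : ¬ Precedes G n e) :
    rankOf G (n + 1) e = rankOf G n e := by
  rw [rankOf, Finset.range_add_one, Finset.filter_insert, if_neg h]
  rfl

lemma rankOf_le (G : ℕ → ℝ) (n e : ℕ) : rankOf G n e ≤ n := by
  classical
  exact (Finset.card_filter_le _ _).trans (by simp)

lemma halts_rankGap {e : ℕ} (hm : s.ireg 0 = m) (he : s.ireg 20 = e) (hwm : m < 2 ^ w) :
    Halts w rankGap s fun t N => t.ireg 19 = rankOf (s.rarr 2) (m - 1) e ∧ N ≤ 40 * m + 12 := by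
  refine halts_iset_seq (by simp) ?_
  refine halts_for (m - 1) 22 (fun n t => t.ireg 19 = rankOf (s.rarr 2) n e) rfl (by omega) ?_ ?_ ?_ ?_
  · intro n t _ hf _
    have : t.ireg 0 = m := (hf.ireg 0 rfl).trans (by simpa using hm)
    simp [this]
  · simp [rankOf]
  · intro n t hn hf hi hJ
    have e20 : t.ireg 20 = e := (hf.ireg 20 rfl).trans (by simpa using he)
    have g : t.rarr 2 = s.rarr 2 := (hf.rarr 2 rfl).trans (by simp)
    have hle := rankOf_le (s.rarr 2) n e
    refine halts_ite (fun hb => ?_) (fun hb => ?_)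
    · have hb' : Precedes (s.rarr 2) n e := by simpa [g, e20, hi, Precedes] using hb
      refine halts_iset (by simp [hJ]; omega) ⟨by simp, ?_⟩
      simp [hJ, rankOf_succ_of hb']
    · have hb' : ¬ Precedes (s.rarr 2) n e := by simpa [g, e20, hi, Precedes] using hb
      refine halts_skip ⟨by simp, ?_⟩
      simp [hJ, rankOf_succ_of_not hb']
  · intro t n _ hJ hn
    refine ⟨hJ, ?_⟩
    simp at hn ⊢
    omega

/-- Counting predecessors is quadratic, which the time bound allows. Any two gaps are comparable
under `Precedes`, so their ranks differ and no entry is overwritten. -/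
lemma halts_sortGaps (hm : s.ireg 0 = m) (hwm : m < 2 ^ w) : Halts w sortGaps s fun t N =>
    SortsDown (t.rarr 2) (m - 1) (t.iarr 2) ∧ N ≤ 75 * (m * m) + 10 := by
  refine halts_for (m - 1) (40 * m + 15) (fun n t => ∀ e < n,
    t.iarr 2 (rankOf (s.rarr 2) (m - 1) e) = e) rfl (by omega) ?_ ?_ ?_ ?_
  · intro n t _ hf _
    simp [(hf.ireg 0 rfl).trans hm]
  · intro e he
    omega
  · intro n t hn hf hi hJ
    have e0 : t.ireg 0 = m := (hf.ireg 0 rfl).trans hm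
    have g : t.rarr 2 = s.rarr 2 := hf.rarr 2 rfl
    refine halts_seq ((halts_rankGap e0 hi hwm).imp ?_)
    rintro t' N' hf' ⟨hr, hN'⟩
    have i' : t'.ireg 20 = n := (hf'.ireg 20 rfl).trans hi
    have a' : t'.iarr 2 = t.iarr 2 := hf'.iarr 2 rfl
    rw [g] at hr
    have hlt : rankOf (s.rarr 2) (m - 1) n < m - 1 := rankOf_lt hn
    refine halts_iput (by simp [hr]; omega) (by simp [i']; omega) ⟨by simp; omega, fun e he => ?_⟩
    simp only [iset_iarr, iput_iarr_same, IExp.eval_reg, hr, i', a']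
    rcases Nat.lt_succ_iff_lt_or_eq.mp he with he | rfl
    · rw [Function.update_of_ne, hJ e he]
      intro heq
      rcases lt_or_ge (s.rarr 2 e) (s.rarr 2 n) with h | h
      · have := rankOf_lt_rankOf (M := m - 1) hn (e := e) ⟨h.le, fun h3 => absurd h3.1 (not_le.mpr h)⟩
        omega
      · have := rankOf_lt_rankOf (M := m - 1) (by omega : e < m - 1) (e := n)
          ⟨h, fun h3 => by omega⟩
        omega
    · simp
  · intro t n hf hJ hn
    have g : t.rarr 2 = s.rarr 2 := hf.rarr 2 rfl
    refine ⟨by rw [g]; exact sortsDown_of_rankOf hJ, hn.trans ?_⟩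
    rcases Nat.eq_zero_or_pos m with rfl | hpos
    · simp
    · have h2 : (m - 1) * (40 * m + 15 + (IExp.reg 0 - 1 : IExp).cost + 9) ≤ m * (75 * m) := by
        obtain ⟨M, rfl⟩ : ∃ M, m = M + 1 := ⟨m - 1, by omega⟩
        simp
        nlinarith
      have h3 : m * (75 * m) = 75 * (m * m) := by ring
      simp at h2 ⊢
      omega

end sort

/-! ## A table of logarithms -/

/-- Store the logarithms to base `2` of all numbers less than `2 * (m / k)`. -/
def logTable : Prog :=
  forLoop 20 (2 * (.reg 0 / .reg 1))
    (.ite (.ilt 1 (.reg 20)) (.iput 1 (3 + .reg 20) (.get 1 (3 + .reg 20 / 2) + 1))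
      (.iput 1 (3 + .reg 20) 0))

/-- The machine has no operation for the highest bit, hence a table. Entry `y > 1` is one more than
the earlier entry `y / 2`. Queries look up the exclusive or of two block numbers at most `m / k`,
which is less than `2 * (m / k)`. -/
lemma halts_logTable {w m k : ℕ} {s : Memory} (hm : s.ireg 0 = m) (hk : s.ireg 1 = k)
    (hw : 3 + 2 * m < 2 ^ w) : Halts w logTable s fun t N =>
      (∀ y < 2 * (m / k), t.iarr 1 (3 + y) = Nat.log 2 y) ∧
      (∀ y < 3, t.iarr 1 y = s.iarr 1 y) ∧ N ≤ 80 * m + 12 := by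
  have hmk : m / k ≤ m := Nat.div_le_self _ _
  refine halts_for (2 * (m / k)) 22 (fun n t => (∀ y < n, t.iarr 1 (3 + y) = Nat.log 2 y) ∧
    ∀ y < 3, t.iarr 1 y = s.iarr 1 y) rfl (by omega) ?_ ?_ ?_ ?_
  · intro n t _ hf _
    simp [(hf.ireg 0 rfl).trans hm, (hf.ireg 1 rfl).trans hk]
  · exact ⟨fun y hy => by omega, fun y _ => rfl⟩
  · rintro n t hn hf hi ⟨hJ, hJ'⟩
    refine halts_ite (fun hb => ?_) (fun hb => ?_)
    · have hb' : 1 < n := by simpa [hi] using hb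
      have hlog : Nat.log 2 n = Nat.log 2 (n / 2) + 1 := Nat.log_of_one_lt_of_le (by omega) (by omega)
      have hle : Nat.log 2 n ≤ n := Nat.log_le_self _ _
      have hval : t.iarr 1 (3 + n / 2) + 1 = Nat.log 2 n := by rw [hJ _ (by omega), hlog]
      refine halts_iput (by simp [hi]; omega) (by simp [hi, hval]; omega) ⟨by simp, ?_, ?_⟩
      · intro y hy
        simp only [iset_iarr, iput_iarr_same, IExp.eval_add, IExp.eval_reg, IExp.eval_get,
          IExp.eval_div, IExp.eval_ofNat, hi, hval]
        rcases Nat.lt_succ_iff_lt_or_eq.mp hy with hy | rfl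
        · rw [Function.update_of_ne (by omega), hJ y hy]
        · simp
      · intro y hy
        simp only [iset_iarr, iput_iarr_same, IExp.eval_add, IExp.eval_reg, IExp.eval_ofNat, hi]
        rw [Function.update_of_ne (by omega), hJ' y hy]
    · have hb' : n ≤ 1 := by simpa [hi] using hb
      refine halts_iput (by simp [hi]; omega) (by simp) ⟨by simp, ?_, ?_⟩
      · intro y hy
        simp only [iset_iarr, iput_iarr_same, IExp.eval_add, IExp.eval_reg, IExp.eval_ofNat,
          hi]
        rcases Nat.lt_succ_iff_lt_or_eq.mp hy with hy | rfl
        · rw [Function.update_of_ne (by omega), hJ y hy]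
        · rw [Nat.log_of_lt (by omega)]
          simp
      · intro y hy
        simp only [iset_iarr, iput_iarr_same, IExp.eval_add, IExp.eval_reg, IExp.eval_ofNat, hi]
        rw [Function.update_of_ne (by omega), hJ' y hy]
  · rintro t n _ ⟨hJ, hJ'⟩ hn
    refine ⟨hJ, hJ', ?_⟩
    simp at hn ⊢
    omega

/-! ## The data structure

For every level `l` with `k * 2 ^ l < m`, the points are divided into blocks of `k * 2 ^ l` points. For
every point, the data structure holds an approximately optimal cover of the interval from the point to
the end of its block if the block has an even number, and from the beginning of its block to the point
if the block has an odd number. -/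

/-- The beginning of the interval of `x` at a level with blocks of size `h`. -/
def intervalStart (h x : ℕ) : ℕ := if x / h % 2 = 0 then x else x / h * h

/-- The end of the interval of `x` at a level with blocks of size `h`. -/
def intervalStop (m h x : ℕ) : ℕ := if x / h % 2 = 0 then min ((x / h + 1) * h) m else x + 1

/-- The address of the number of runs in cell number `c`. -/
def lengthAddr (m k c : ℕ) : ℕ := 3 + 2 * (m / k) + c

/-- The address of the centres in cell number `c`. -/
def centreAddr (d m k c : ℕ) : ℕ := m * d + c * (k * d)

/-- The cell of level `l` and point `x`, which has number `l * m + x`, holds a cover that is optimal up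
to the factor `γ`. -/
def GoodCell (d : ℕ) (A : ℕ → ℝ) (m k : ℕ) (γ : ℝ) (I : ℕ → ℕ) (B : ℕ → ℝ) (l x : ℕ) : Prop :=
  ∃ n ρ, I (lengthAddr m k (l * m + x)) = n ∧ n ≤ k ∧ 0 ≤ ρ ∧
    BallCover (fun x => pt d A (x * d)) ρ (intervalStart (k * 2 ^ l) x)
      (intervalStop m (k * 2 ^ l) x) (curveAt d B (centreAddr d m k (l * m + x)) n) ∧
    ∀ r, Cov (fun x => pt d A (x * d)) r k (intervalStart (k * 2 ^ l) x)
      (intervalStop m (k * 2 ^ l) x) → ρ ≤ γ * r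

/-- The contents of the data structure with `L` levels. -/
structure Stores (d : ℕ) (A : ℕ → ℝ) (m k : ℕ) (γ : ℝ) (L : ℕ) (I : ℕ → ℕ) (B : ℕ → ℝ) : Prop where
  runs : I 0 = k
  dim : I 1 = d
  size : I 2 = m
  pts : ∀ y < m * d, B y = A y
  level_lt : ∀ l < L, k * 2 ^ l < m
  lt_level : 2 * k < m → ∀ l, k * 2 ^ l < m → l < L
  log : 2 * k < m → ∀ y < 2 * (m / k), I (3 + y) = Nat.log 2 y
  cell : ∀ l < L, ∀ x < m, GoodCell d A m k γ I B l x

/-- Find the interval of a point. Further integer registers: `3` the level, `4` the size of its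
blocks, `5` the point, `18` the number of its block. -/
def findInterval : Prog :=
  .iset 18 (.reg 5 / .reg 4) ;;
  .ite (.ile (.reg 18 % 2) 0)
    (.iset 6 (.reg 5) ;; .iset 7 ((.reg 18 + 1) * .reg 4) ;;
      .ite (.ile (.reg 0) (.reg 7)) (.iset 7 (.reg 0)) .skip)
    (.iset 6 (.reg 18 * .reg 4) ;; .iset 7 (.reg 5 + 1))

/-- Compute a cell. -/
def fillCell : Prog :=
  findInterval ;;
  .iset 8 (.reg 0 * .reg 2 + (.reg 3 * .reg 0 + .reg 5) * (.reg 1 * .reg 2)) ;;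
  search ;;
  .iput 1 (3 + 2 * (.reg 0 / .reg 1) + (.reg 3 * .reg 0 + .reg 5)) (.reg 9)

/-- Compute the cells of all levels. -/
def fillLevels : Prog :=
  .iset 3 0 ;; .iset 4 (.reg 1) ;;
  .loop (.ilt (.reg 4) (.reg 0))
    (forLoop 5 (.reg 0) fillCell ;; .iset 3 (.reg 3 + 1) ;; .iset 4 (.reg 4 * 2))

/-- The preprocessing. -/
def preprocess : Prog :=
  .rset 1 (.reg 0 / 8) ;;
  .iput 1 0 (.reg 1) ;; .iput 1 1 (.reg 2) ;; .iput 1 2 (.reg 0) ;;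
  copyReals 14 1 0 0 0 (.reg 0 * .reg 2) ;;
  .ite (.ilt (2 * .reg 1) (.reg 0))
    (gaps ;; sortGaps ;; logTable ;; fillLevels ;;
      .iset 17 (3 + 2 * (.reg 0 / .reg 1) + .reg 3 * .reg 0) ;;
      .iset 1 (.reg 0 * .reg 2 + .reg 3 * .reg 0 * (.reg 1 * .reg 2)) ;;
      .iset 0 (.reg 17))
    (.iset 1 (.reg 0 * .reg 2) ;; .iset 0 3)

/-- The memory cells that the levels are computed from. -/
structure LevelEnv (d : ℕ) (A : ℕ → ℝ) (e : ℝ) (m k : ℕ) (t : Memory) : Prop where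
  size : t.ireg 0 = m
  runs : t.ireg 1 = k
  dim : t.ireg 2 = d
  prec : t.rreg 1 = e
  pts : t.rarr 0 = A
  sorts : SortsDown (t.rarr 2) (m - 1) (t.iarr 2)
  gap : ∀ x, x + 1 < m → t.rarr 2 x = ‖pt d A (x * d) - pt d A ((x + 1) * d)‖

/-! ### Correctness and cost of filling the cells. -/

section levels
variable {w d : ℕ} {A : ℕ → ℝ} {e γ : ℝ} {m k : ℕ} {s : Memory}

lemma LevelEnv.of_frame {c : Prog} {t : Memory} (h : LevelEnv d A e m k s) (hf : Frame c s t)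
    (h0 : c.setsI 0 = false) (h1 : c.setsI 1 = false) (h2 : c.setsI 2 = false)
    (h1' : c.setsR 1 = false) (h0' : c.putsR 0 = false) (h2' : c.putsR 2 = false)
    (h2'' : c.putsI 2 = false) : LevelEnv d A e m k t := by
  refine ⟨(hf.ireg 0 h0).trans h.size, (hf.ireg 1 h1).trans h.runs, (hf.ireg 2 h2).trans h.dim,
    (hf.rreg 1 h1').trans h.prec, (hf.rarr 0 h0').trans h.pts, ?_, ?_⟩
  · rw [hf.rarr 2 h2', hf.iarr 2 h2'']
    exact h.sorts
  · rw [hf.rarr 2 h2']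
    exact h.gap

lemma interval_bounds {h x : ℕ} (hh : 0 < h) (hx : x < m) :
    intervalStart h x < intervalStop m h x ∧ intervalStop m h x ≤ m := by
  have h1 := Nat.div_mul_le_self x h
  have h2 := Nat.lt_div_mul_add (a := x) hh
  rw [intervalStart, intervalStop]
  split_ifs
  · rw [Nat.add_mul]
    omega
  · omega

lemma halts_findInterval {h x : ℕ} (hm : s.ireg 0 = m) (h4 : s.ireg 4 = h) (h5 : s.ireg 5 = x)
    (hx : x < m) (hhm : h < m) (hw : 2 * m < 2 ^ w) : Halts w findInterval s fun t N =>
      t.ireg 6 = intervalStart h x ∧ t.ireg 7 = intervalStop m h x ∧ N ≤ 40 := by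
  have hdiv := Nat.div_mul_le_self x h
  have hdiv' := Nat.div_le_self x h
  refine halts_iset_seq (by simp [h4, h5]; omega) (halts_ite (fun hb => ?_) (fun hb => ?_))
  · have hb' : x / h % 2 = 0 := by simpa [h4, h5] using hb
    have h1 : (x / h + 1) * h < 2 ^ w := by
      rw [Nat.add_mul]
      omega
    refine halts_iset_seq (by simp [h5]; omega) (halts_iset_seq (by simpa [h4, h5] using h1)
      (halts_ite (fun hc => ?_) (fun hc => ?_)))
    · have hc' : m ≤ (x / h + 1) * h := by simpa [h4, h5, hm] using hc
      refine halts_iset (by simp [hm]; omega) ⟨?_, ?_, by simp⟩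
      · simp [intervalStart, hb', h5]
      · simp [intervalStop, hb', hm, min_eq_right hc']
    · have hc' : (x / h + 1) * h < m := by simpa [h4, h5, hm] using hc
      refine halts_skip ⟨?_, ?_, by simp⟩
      · simp [intervalStart, hb', h5]
      · simp [intervalStop, hb', h4, h5, min_eq_left hc'.le]
  · have hb' : ¬ x / h % 2 = 0 := by simpa [h4, h5] using hb
    refine halts_iset_seq (by simp [h4, h5]; omega) (halts_iset (by simp [h5]; omega) ⟨?_, ?_, by simp⟩)
    · simp [intervalStart, hb', h4, h5]
    · simp [intervalStop, hb', h5]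

lemma GoodCell.congr {I I' : ℕ → ℕ} {B B' : ℕ → ℝ} {l x : ℕ} (h : GoodCell d A m k γ I B l x)
    (hI : I' (lengthAddr m k (l * m + x)) = I (lengthAddr m k (l * m + x)))
    (hB : ∀ y, centreAddr d m k (l * m + x) ≤ y → y < centreAddr d m k (l * m + x) + k * d →
      B' y = B y) : GoodCell d A m k γ I' B' l x := by
  obtain ⟨n, ρ, hn, hnk, hρ, hcov, hopt⟩ := h
  refine ⟨n, ρ, hI.trans hn, hnk, hρ, ?_, hopt⟩
  rwa [curveAt_congr fun y hy hy' => hB y hy ?_]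
  have := Nat.mul_le_mul_right d hnk
  omega

/-- The state in which the cells with numbers less than `c` have been computed. -/
structure Filled (d : ℕ) (A : ℕ → ℝ) (m k : ℕ) (γ : ℝ) (s : Memory) (c : ℕ) (t : Memory) : Prop where
  words : ∀ y < 3 + 2 * (m / k), t.iarr 1 y = s.iarr 1 y
  reals : ∀ y < m * d, t.rarr 1 y = s.rarr 1 y
  cell : ∀ l x, x < m → l * m + x < c → GoodCell d A m k γ (t.iarr 1) (t.rarr 1) l x

/-- The search writes centres only into the slot of the current cell, so the cells with smaller
numbers stay good. -/
lemma halts_fillCell {T R l x : ℕ} {s₀ : Memory} (hd : 1 ≤ d) (he : 0 < e) (he' : e ≤ 1 / 16)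
    (hT : (1 - e) ^ T * (4 + e) < e) (hR : (m : ℝ) ≤ e * 2 ^ R) (hs : LevelEnv d A e m k s)
    (hk : 1 ≤ k) (hkm : k * 2 ^ l < m) (hx : x < m) (h3 : s.ireg 3 = l) (h4 : s.ireg 4 = k * 2 ^ l)
    (h5 : s.ireg 5 = x) (hγ : γ = 1 + 8 * e) (hw : 8 * (m * m * m * d) < 2 ^ w)
    (hfill : Filled d A m k γ s₀ (l * m + x) s) :
    Halts w fillCell s fun t N => Filled d A m k γ s₀ (l * m + x + 1) t ∧
      N ≤ 450 * (d * ((2 * T + 3) * m)) * (R + 2) := by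
  -- From `l < 2 ^ l ≤ k * 2 ^ l < m`, cell numbers stay below `m * m`, and addresses of centres are
  -- at most `2 * (m * m * m * d)`, which fits into a word.
  have hl2 : l < 2 ^ l := Nat.lt_two_pow_self
  have hpow : 2 ^ l ≤ k * 2 ^ l := Nat.le_mul_of_pos_left _ hk
  have hlm : l < m := by omega
  have hkm' : k < m := lt_of_le_of_lt (Nat.le_mul_of_pos_right k (by positivity)) hkm
  have hq : l * m + x + 1 ≤ m * m := by
    have := Nat.mul_le_mul_right m (Nat.succ_le_of_lt hlm)
    rw [Nat.succ_mul] at this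
    omega
  have hmm : m ≤ m * m := Nat.le_mul_of_pos_left m (by omega)
  have hmmm : m * m ≤ m * m * m := Nat.le_mul_of_pos_right _ (by omega)
  have hmmmd : m * m * m ≤ m * m * m * d := Nat.le_mul_of_pos_right _ hd
  have hmd : m * d ≤ m * m * m * d := Nat.mul_le_mul_right d (by omega)
  have hqk : (l * m + x + 1) * (k * d) ≤ m * m * m * d := by
    calc (l * m + x + 1) * (k * d) ≤ m * m * (m * d) :=
          Nat.mul_le_mul hq (Nat.mul_le_mul_right d hkm'.le)
      _ = m * m * m * d := by ring
  have hqk' : (l * m + x + 1) * (k * d) = (l * m + x) * (k * d) + k * d := by ring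
  refine halts_seq ((halts_findInterval hs.size h4 h5 hx hkm (by omega)).imp ?_)
  rintro t₁ N₁ hf₁ ⟨ha, hb, hN₁⟩
  have h₁ := hs.of_frame hf₁ rfl rfl rfl rfl rfl rfl rfl
  have l₁ : t₁.ireg 3 = l := (hf₁.ireg 3 rfl).trans h3
  have x₁ : t₁.ireg 5 = x := (hf₁.ireg 5 rfl).trans h5
  obtain ⟨hab, hbm⟩ := interval_bounds (h := k * 2 ^ l) (by positivity) hx
  have hval : IExp.eval t₁ (.reg 0 * .reg 2 + (.reg 3 * .reg 0 + .reg 5) * (.reg 1 * .reg 2)) =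
      centreAddr d m k (l * m + x) := by
    simp [h₁.size, h₁.dim, h₁.runs, l₁, x₁, centreAddr]
  have hca : centreAddr d m k (l * m + x) + k * d ≤ 2 * (m * m * m * d) := by
    rw [centreAddr]
    omega
  refine halts_iset_seq (by rw [hval]; omega) ?_
  rw [hval]
  set t₂ := Memory.iset _ 8 _ with ht₂
  have h₂ : CoverEnv d A e k (intervalStart (k * 2 ^ l) x) (intervalStop m (k * 2 ^ l) x)
      (centreAddr d m k (l * m + x)) t₂ := by
    constructor <;> simp [ht₂, h₁.runs, h₁.dim, h₁.prec, h₁.pts, ha, hb]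
  refine halts_seq ((halts_search (m := m) hd he he' hT hR h₂ (by simp [ht₂, h₁.size]) hk
    (by simpa [ht₂] using h₁.sorts) (by simpa [ht₂] using h₁.gap) hab hbm (by omega) (by omega)
    (by omega)).imp ?_)
  rintro t₃ N₃ hf₃ ⟨n, ρ, hn, hnk, hρ, hcov, hopt, hrest, hN₃⟩
  have e0 : t₃.ireg 0 = m := (hf₃.ireg 0 rfl).trans (by simp [ht₂, h₁.size])
  have e1 : t₃.ireg 1 = k := (hf₃.ireg 1 rfl).trans (by simp [ht₂, h₁.runs])
  have e3 : t₃.ireg 3 = l := (hf₃.ireg 3 rfl).trans (by simp [ht₂, l₁])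
  have e5 : t₃.ireg 5 = x := (hf₃.ireg 5 rfl).trans (by simp [ht₂, x₁])
  have w₃ : t₃.iarr 1 = s.iarr 1 :=
    (hf₃.iarr 1 rfl).trans (by simpa [ht₂] using hf₁.iarr 1 rfl)
  have r₂ : t₂.rarr 1 = s.rarr 1 := by simpa [ht₂] using hf₁.rarr 1 rfl
  have haddr : IExp.eval t₃ (3 + 2 * (.reg 0 / .reg 1) + (.reg 3 * .reg 0 + .reg 5)) =
      lengthAddr m k (l * m + x) := by
    simp [e0, e1, e3, e5, lengthAddr]
  have hdiv : m / k ≤ m := Nat.div_le_self _ _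
  have hm1 : 2 ≤ m := by omega
  have hbig : 2 * m ≤ m * m := Nat.mul_le_mul_right m hm1
  refine halts_iput (by rw [haddr, lengthAddr]; omega) (by simp [hn]; omega) ⟨⟨?_, ?_, ?_⟩, ?_⟩
  · intro y hy
    rw [haddr]
    simp only [iput_iarr_same]
    rw [Function.update_of_ne (by rw [lengthAddr]; omega), w₃]
    exact hfill.words y hy
  · intro y hy
    simp only [iput_rarr]
    rw [hrest y (by rw [centreAddr]; omega), r₂]
    exact hfill.reals y hy
  · intro l' x' hx' hlt
    rw [haddr]
    simp only [iput_rarr, iput_iarr_same, IExp.eval_reg, hn]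
    rcases Nat.lt_succ_iff_lt_or_eq.mp hlt with hlt | heq
    · refine (hfill.cell l' x' hx' hlt).congr ?_ fun y hy hy' => ?_
      · rw [Function.update_of_ne (by simp only [lengthAddr]; omega), w₃]
      · have h6 := Nat.mul_le_mul_right (k * d) (Nat.succ_le_of_lt hlt)
        rw [Nat.succ_mul] at h6
        rw [hrest y ?_, r₂]
        simp only [centreAddr] at hy hy' ⊢
        omega
    -- Division by `m` recovers the level from the cell number.
    · have hl' : l' = l := by
        have h6 : (l' * m + x') / m = l' := by
          rw [Nat.mul_comm, Nat.mul_add_div (by omega), Nat.div_eq_of_lt hx', Nat.add_zero]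
        have h7 : (l * m + x) / m = l := by
          rw [Nat.mul_comm, Nat.mul_add_div (by omega), Nat.div_eq_of_lt hx, Nat.add_zero]
        rw [← h6, heq, h7]
      subst hl'
      obtain rfl : x' = x := by omega
      exact ⟨n, ρ, by simp, hnk, hρ, hcov, by rwa [hγ]⟩
  · have h6 : m ≤ d * ((2 * T + 3) * m) :=
      (Nat.le_mul_of_pos_left m (by omega : 0 < 2 * T + 3)).trans (Nat.le_mul_of_pos_left _ hd)
    have h7 : 1 * 2 ≤ d * ((2 * T + 3) * m) * (R + 2) := Nat.mul_le_mul (by omega) (by omega)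
    rw [Nat.mul_assoc 400] at hN₃
    rw [Nat.mul_assoc 450]
    simp
    omega

/-- The block size doubles from `k` until it reaches `m`, so exactly the levels with `k * 2 ^ l < m`
are filled, each with `m` cells. -/
lemma halts_fillLevels {T R : ℕ} (hd : 1 ≤ d) (he : 0 < e) (he' : e ≤ 1 / 16)
    (hT : (1 - e) ^ T * (4 + e) < e) (hR : (m : ℝ) ≤ e * 2 ^ R) (hs : LevelEnv d A e m k s)
    (hk : 1 ≤ k) (hkm : k < m) (hγ : γ = 1 + 8 * e) (hw : 8 * (m * m * m * d) < 2 ^ w) :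
    Halts w fillLevels s fun t N => ∃ L, t.ireg 3 = L ∧ (∀ l < L, k * 2 ^ l < m) ∧ m ≤ k * 2 ^ L ∧
      Filled d A m k γ s (L * m) t ∧
      N ≤ 600 * (d * ((2 * T + 3) * m)) * (R + 2) * m * (L + 1) := by
  have hmm : m ≤ m * m := Nat.le_mul_of_pos_left m (by omega)
  have hmmm : m * m ≤ m * m * m := Nat.le_mul_of_pos_right _ (by omega)
  have hmmmd : m * m * m ≤ m * m * m * d := Nat.le_mul_of_pos_right _ hd
  have hX : 1 * 2 ≤ d * ((2 * T + 3) * m) * (R + 2) := Nat.mul_le_mul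
    (Nat.mul_pos hd (Nat.mul_pos (by omega) (by omega))) (by omega)
  simp only [Nat.mul_assoc 600]
  -- Naming the cost of a cell makes the remaining step counts linear in a few products.
  generalize hXd : d * ((2 * T + 3) * m) * (R + 2) = X at hX
  have hXm : m * 2 ≤ X * m := by
    rw [Nat.mul_comm]
    exact Nat.mul_le_mul_right m (by omega)
  refine halts_iset_seq (by simp) (halts_iset_seq (by simp [hs.runs]; omega) ?_)
  set t := (Memory.iset _ 3 _).iset 4 _ with ht
  refine halts_loop (fun v N u => ∃ l, u.ireg 3 = l ∧ u.ireg 4 = k * 2 ^ l ∧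
    (∀ l' < l, k * 2 ^ l' < m) ∧ v = m - k * 2 ^ l ∧ Filled d A m k γ s (l * m) u ∧
    N ≤ 600 * (X * m) * l) (v₀ := m - k) ?_ ?_ ?_
  · refine ⟨0, by simp [ht], by simp [ht, hs.runs], by simp, by simp, ⟨?_, ?_, ?_⟩, by simp⟩
    · intro y _
      rfl
    · intro y _
      rfl
    · intro l x _ hlt
      omega
  · rintro v N u hf ⟨l, hl, hh, hlev, rfl, hfill, hN⟩ hb
    have hu : LevelEnv d A e m k u := by
      refine LevelEnv.of_frame (s := t) ?_ hf rfl rfl rfl rfl rfl rfl rfl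
      constructor <;> simp [ht, hs.size, hs.runs, hs.dim, hs.prec, hs.pts]
      · exact hs.sorts
      · exact hs.gap
    have hkl : k * 2 ^ l < m := by simpa [hh, hu.size] using hb
    have hl2 : l < 2 ^ l := Nat.lt_two_pow_self
    have hpow : 2 ^ l ≤ k * 2 ^ l := Nat.le_mul_of_pos_left _ hk
    refine halts_seq ?_
    refine halts_for m (450 * X) (fun n t => Filled d A m k γ s (l * m + n) t) rfl (by omega)
      ?_ ?_ ?_ ?_
    · intro n t _ hf' _
      exact (hf'.ireg 0 rfl).trans hu.size
    · exact ⟨hfill.words, hfill.reals, hfill.cell⟩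
    · intro x t hx hf' hi hJ
      have h₁ := hu.of_frame hf' rfl rfl rfl rfl rfl rfl rfl
      refine (halts_fillCell hd he he' hT hR h₁ hk hkl hx ((hf'.ireg 3 rfl).trans hl)
        ((hf'.ireg 4 rfl).trans hh) hi hγ hw hJ).imp ?_
      rintro t' N' hf'' ⟨hF, hN'⟩
      refine ⟨by rwa [← hXd, ← Nat.mul_assoc], ⟨hF.words, hF.reals, hF.cell⟩⟩
    · intro u' N' hf' hJ hN'
      have e3 : u'.ireg 3 = l := (hf'.ireg 3 rfl).trans hl
      have e4 : u'.ireg 4 = k * 2 ^ l := (hf'.ireg 4 rfl).trans hh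
      have hpos : 0 < k * 2 ^ l := by positivity
      refine halts_iset_seq (by simp [e3]; omega) (halts_iset (by simp [e4]; omega)
        ⟨m - k * 2 ^ (l + 1), ?_, l + 1, by simp [e3], ?_, ?_, rfl, ?_, ?_⟩)
      · rw [pow_succ, ← Nat.mul_assoc]
        omega
      · simp [e4, pow_succ, Nat.mul_assoc]
      · intro l' hl'
        rcases Nat.lt_succ_iff_lt_or_eq.mp hl' with hl' | rfl
        · exact hlev l' hl'
        · exact hkl
      · rw [Nat.succ_mul]
        exact ⟨hJ.words, hJ.reals, hJ.cell⟩
      · have h6 : m * (450 * X + (IExp.reg 0).cost + 9) = 450 * (X * m) + 10 * m := by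
          simp
          ring
        rw [h6] at hN'
        simp at hN' ⊢
        rw [Nat.mul_add]
        omega
  · rintro v N u hf ⟨l, hl, hh, hlev, rfl, hfill, hN⟩ hb
    have h0 : u.ireg 0 = m := (hf.ireg 0 rfl).trans (by simp [ht, hs.size])
    have hkl : m ≤ k * 2 ^ l := by simpa [hh, h0] using hb
    refine ⟨l, hl, hlev, hkl, hfill, ?_⟩
    have h6 : 600 * (X * m * (l + 1)) = 600 * (X * m) * l + 600 * (X * m) := by ring
    rw [h6]
    simp
    omega

end levels

/-! ### Correctness and cost of the preprocessing. -/

section preprocess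
variable {w d : ℕ} {A : ℕ → ℝ} {m k : ℕ} {ε : ℝ} {s : Memory}

/-- If `m ≤ 2 * k`, no query has more than `2 * k` points and the points alone suffice. Otherwise
the levels dominate: copying, sorting and the table cost `O(m * d + m * m)`. -/
lemma halts_preprocess {T R : ℕ} (hd : 1 ≤ d) (hk : 1 ≤ k) (hkm : k ≤ m) (hε : 0 < ε)
    (hε' : ε < 1 / 2) (hT : (1 - ε / 8) ^ T * (4 + ε / 8) < ε / 8)
    (hR : (m : ℝ) ≤ ε / 8 * 2 ^ R) (hw : 8 * (m * m * m * d) < 2 ^ w) (hm : s.ireg 0 = m)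
    (hks : s.ireg 1 = k) (hds : s.ireg 2 = d) (hεs : s.rreg 0 = ε) (hA : s.rarr 0 = A) :
    Halts w preprocess s fun t N => ∃ L, Stores d A m k (1 + ε) L (t.iarr 1) (t.rarr 1) ∧
      (2 * k < m ∧ t.ireg 0 = lengthAddr m k (L * m) ∧ t.ireg 1 = centreAddr d m k (L * m) ∨
        m ≤ 2 * k ∧ L = 0 ∧ t.ireg 0 = 3 ∧ t.ireg 1 = m * d) ∧
      N ≤ 1000 * (d * ((2 * T + 3) * m)) * (R + 2) * m * (L + 1) := by
  have hm1 : 1 ≤ m := by omega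
  have hmm : m ≤ m * m := Nat.le_mul_of_pos_left m (by omega)
  have hmmm : m * m ≤ m * m * m := Nat.le_mul_of_pos_right _ (by omega)
  have hmmmd : m * m * m ≤ m * m * m * d := Nat.le_mul_of_pos_right _ hd
  have hmd : m * d ≤ m * m * m * d := Nat.mul_le_mul_right d (by omega)
  have hdm : d ≤ m * d := Nat.le_mul_of_pos_left d (by omega)
  have h1w : 1 < 2 ^ w := by omega
  refine halts_rset_seq (halts_seq (halts_iput (by simp) (by simp [hks]; omega) (halts_seq (halts_iput
    (by simpa using h1w) (by simp [hds]; omega) (halts_seq (halts_iput (by simp; omega)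
    (by simp [hm]; omega) (halts_seq ?_)))))))
  set t := Memory.iput _ 1 _ (IExp.eval _ (.reg 0)) with ht
  have t0 : t.ireg 0 = m := by simp [ht, hm]
  have t1 : t.ireg 1 = k := by simp [ht, hks]
  have t2 : t.ireg 2 = d := by simp [ht, hds]
  have tε : t.rreg 1 = ε / 8 := by simp [ht, hεs]
  have tA : t.rarr 0 = A := by simp [ht, hA]
  have i0 : t.iarr 1 0 = k := by simp [ht, hks]
  have i1 : t.iarr 1 1 = d := by simp [ht, hds]
  have i2 : t.iarr 1 2 = m := by simp [ht, hm]
  clear_value t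
  refine (halts_copyReals 0 0 (m * d) (by decide) (by omega) ?_ ?_ ?_).imp ?_
  · intro t' _
    rfl
  · intro t' _
    rfl
  · intro t' hf
    simp [(hf.ireg 0 rfl).trans t0, (hf.ireg 2 rfl).trans t2]
  rintro t₁ N₁ hf₁ ⟨hpts, hN₁⟩
  have t0 : t₁.ireg 0 = m := (hf₁.ireg 0 rfl).trans t0
  have t1 : t₁.ireg 1 = k := (hf₁.ireg 1 rfl).trans t1
  have t2 : t₁.ireg 2 = d := (hf₁.ireg 2 rfl).trans t2
  have tε : t₁.rreg 1 = ε / 8 := (hf₁.rreg 1 rfl).trans tε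
  have i0 : t₁.iarr 1 0 = k := by rw [hf₁.iarr 1 rfl, i0]
  have i1 : t₁.iarr 1 1 = d := by rw [hf₁.iarr 1 rfl, i1]
  have i2 : t₁.iarr 1 2 = m := by rw [hf₁.iarr 1 rfl, i2]
  have hpts : ∀ y < m * d, t₁.rarr 1 y = A y := by
    intro y hy
    rw [hpts, if_pos (by omega), tA]
    simp
  have tA : t₁.rarr 0 = A := (hf₁.rarr 0 rfl).trans tA
  have hX : 3 * m * d ≤ d * ((2 * T + 3) * m) := by
    rw [Nat.mul_comm (3 * m)]
    exact Nat.mul_le_mul_left d (Nat.mul_le_mul_right m (by omega))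
  simp only [Nat.mul_assoc 1000]
  have hXR : 6 * (m * d) ≤ d * ((2 * T + 3) * m) * (R + 2) := by
    calc 6 * (m * d) = 3 * m * d * 2 := by ring
      _ ≤ _ := Nat.mul_le_mul hX (by omega)
  generalize hXd : d * ((2 * T + 3) * m) * (R + 2) = X at hXR
  have hXm : 6 * (m * m) ≤ X * m := by
    calc 6 * (m * m) = 6 * m * m := by ring
      _ ≤ X * m := Nat.mul_le_mul_right m
        (le_trans (Nat.mul_le_mul_left 6 (Nat.le_mul_of_pos_right m hd)) hXR)
  have hXm' : X ≤ X * m := Nat.le_mul_of_pos_right X hm1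
  refine halts_ite (fun hb => ?_) (fun hb => ?_)
  · have hb' : 2 * k < m := by simpa [t0, t1] using hb
    have hm2 : 2 * m ≤ m * m := Nat.mul_le_mul_right m (by omega)
    refine halts_seq ((halts_gaps hd t0 t2 tA (by omega) (by omega)).imp ?_)
    rintro t₂ N₂ hf₂ ⟨hgap, hN₂⟩
    refine halts_seq ((halts_sortGaps ((hf₂.ireg 0 rfl).trans t0) (by omega)).imp ?_)
    rintro t₃ N₃ hf₃ ⟨hsort, hN₃⟩
    have u0 : t₃.ireg 0 = m := (hf₃.ireg 0 rfl).trans ((hf₂.ireg 0 rfl).trans t0)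
    have u1 : t₃.ireg 1 = k := (hf₃.ireg 1 rfl).trans ((hf₂.ireg 1 rfl).trans t1)
    refine halts_seq ((halts_logTable u0 u1 (by omega)).imp ?_)
    rintro t₄ N₄ hf₄ ⟨hlog, hfix, hN₄⟩
    have henv : LevelEnv d A (ε / 8) m k t₄ := by
      refine ⟨(hf₄.ireg 0 rfl).trans u0, (hf₄.ireg 1 rfl).trans u1, ?_, ?_, ?_, ?_, ?_⟩
      · exact (hf₄.ireg 2 rfl).trans ((hf₃.ireg 2 rfl).trans ((hf₂.ireg 2 rfl).trans t2))
      · exact (hf₄.rreg 1 rfl).trans ((hf₃.rreg 1 rfl).trans ((hf₂.rreg 1 rfl).trans tε))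
      · exact (hf₄.rarr 0 rfl).trans ((hf₃.rarr 0 rfl).trans ((hf₂.rarr 0 rfl).trans tA))
      · rw [hf₄.rarr 2 rfl, hf₄.iarr 2 rfl]
        exact hsort
      · rw [hf₄.rarr 2 rfl, hf₃.rarr 2 rfl]
        exact hgap
    have hw₄ : ∀ y < 3, t₄.iarr 1 y = t₁.iarr 1 y := by
      intro y hy
      rw [hfix y hy, hf₃.iarr 1 rfl, hf₂.iarr 1 rfl]
    have hr₄ : t₄.rarr 1 = t₁.rarr 1 := by
      rw [hf₄.rarr 1 rfl, hf₃.rarr 1 rfl, hf₂.rarr 1 rfl]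
    refine halts_seq ((halts_fillLevels (γ := 1 + ε) hd (by linarith) (by linarith) hT hR henv hk
      (by omega) (by ring) hw).imp ?_)
    rintro t₅ N₅ hf₅ ⟨L, hL, hlev, hlev', hfill, hN₅⟩
    simp only [Nat.mul_assoc 600, hXd] at hN₅
    have h₅ := henv.of_frame hf₅ rfl rfl rfl rfl rfl rfl rfl
    have hLm : L ≤ m := by
      rcases Nat.eq_zero_or_pos L with rfl | hpos
      · omega
      · have h1 := hlev (L - 1) (by omega)
        have h2 : L - 1 < 2 ^ (L - 1) := Nat.lt_two_pow_self
        have h3 : 2 ^ (L - 1) ≤ k * 2 ^ (L - 1) := Nat.le_mul_of_pos_left _ hk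
        omega
    have hLmm : L * m ≤ m * m := Nat.mul_le_mul_right m hLm
    have hLk : L * m * (k * d) ≤ m * m * m * d := by
      calc L * m * (k * d) ≤ m * m * (m * d) := Nat.mul_le_mul hLmm (Nat.mul_le_mul_right d hkm)
        _ = _ := by ring
    have hdiv : m / k ≤ m := Nat.div_le_self _ _
    -- Register `17` keeps the number of words while registers `0` and `1` are still read as `m` and
    -- `k`.
    refine halts_iset_seq (by simp [h₅.size, h₅.runs, hL]; omega) (halts_iset_seq
      (by simp [h₅.size, h₅.runs, h₅.dim, hL]; omega) (halts_iset
        (by simp [h₅.size, h₅.runs, hL]; omega) ⟨L, ⟨?_, ?_, ?_, ?_, hlev, ?_, ?_, ?_⟩,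
          Or.inl ⟨hb', ?_, ?_⟩, ?_⟩))
    · simp only [iset_iarr]
      rw [hfill.words 0 (by omega), hw₄ 0 (by omega), i0]
    · simp only [iset_iarr]
      rw [hfill.words 1 (by omega), hw₄ 1 (by omega), i1]
    · simp only [iset_iarr]
      rw [hfill.words 2 (by omega), hw₄ 2 (by omega), i2]
    · intro y hy
      simp only [iset_rarr]
      rw [hfill.reals y hy, hr₄, hpts y hy]
    · intro _ l hl
      by_contra hc
      have : k * 2 ^ L ≤ k * 2 ^ l :=
        Nat.mul_le_mul_left k (Nat.pow_le_pow_right (by omega) (not_lt.mp hc))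
      omega
    · intro _ y hy
      simp only [iset_iarr]
      rw [hfill.words _ (by omega), hlog y hy]
    · intro l hl x hx
      refine hfill.cell l x hx ?_
      have := Nat.mul_le_mul_right m (Nat.succ_le_of_lt hl)
      rw [Nat.succ_mul] at this
      omega
    · simp [h₅.size, h₅.runs, hL, lengthAddr]
    · simp [h₅.size, h₅.runs, h₅.dim, hL, centreAddr]
    · have h6 : 1000 * (X * m * (L + 1)) = 1000 * (X * m * L) + 1000 * (X * m) := by ring
      have h7 : 600 * (X * m * (L + 1)) = 600 * (X * m * L) + 600 * (X * m) := by ring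
      simp at hN₁ ⊢
      omega
  · have hb' : m ≤ 2 * k := by simpa [t0, t1] using hb
    refine halts_iset_seq (by simp [t0, t2]; omega) (halts_iset (by simp; omega) ⟨0, ⟨?_, ?_, ?_, ?_,
      by simp, by omega, by omega, by simp⟩, Or.inr ⟨hb', rfl, ?_, ?_⟩, ?_⟩)
    · simpa using i0
    · simpa using i1
    · simpa using i2
    · simpa using hpts
    · simp
    · simp [t0, t2]
    · simp at hN₁ ⊢
      omega

end preprocess

/-! ## Queries -/

/-- The query. Integer registers: `2`, `3`, `4` the numbers `k`, `d`, `m`; `5` and `6` the indices of the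
first and the last point, starting at `0`; `7` and `8` the lengths of the two halves of the output; `9`
and `10` the numbers of their cells; `11` the level; `14` a loop counter. -/
def answer : Prog :=
  .iset 2 (.get 0 0) ;; .iset 3 (.get 0 1) ;; .iset 4 (.get 0 2) ;;
  .iset 5 (.reg 0 - 1) ;; .iset 6 (.reg 1 - 1) ;;
  .ite (.ile (.reg 6 + 1 - .reg 5) (2 * .reg 2))
    (.iset 0 (.reg 6 + 1 - .reg 5) ;; copyReals 14 1 0 0 (.reg 5 * .reg 3) (.reg 0 * .reg 3))
    (.iset 11 (.get 0 (3 + .bin .xor (.reg 5 / .reg 2) (.reg 6 / .reg 2))) ;;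
      .iset 9 (.reg 11 * .reg 4 + .reg 5) ;; .iset 10 (.reg 11 * .reg 4 + .reg 6) ;;
      .iset 7 (.get 0 (3 + 2 * (.reg 4 / .reg 2) + .reg 9)) ;;
      .iset 8 (.get 0 (3 + 2 * (.reg 4 / .reg 2) + .reg 10)) ;;
      copyReals 14 1 0 0 (.reg 4 * .reg 3 + .reg 9 * (.reg 2 * .reg 3)) (.reg 7 * .reg 3) ;;
      copyReals 14 1 (.reg 7 * .reg 3) 0 (.reg 4 * .reg 3 + .reg 10 * (.reg 2 * .reg 3))
        (.reg 8 * .reg 3) ;;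
      .iset 0 (.reg 7 + .reg 8))

/-- At the level of the highest bit in which they differ, two numbers lie in neighbouring blocks. -/
lemma div_two_pow_log_xor {a b : ℕ} (hab : a < b) :
    a / 2 ^ Nat.log 2 (a ^^^ b) % 2 = 0 ∧
      b / 2 ^ Nat.log 2 (a ^^^ b) = a / 2 ^ Nat.log 2 (a ^^^ b) + 1 := by
  have hne : a ^^^ b ≠ 0 := by
    rw [Ne, Nat.xor_eq_zero_iff]
    omega
  set l := Nat.log 2 (a ^^^ b) with hl
  have h1 : 2 ^ l ≤ a ^^^ b := Nat.pow_log_le_self 2 hne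
  have h2 : a ^^^ b < 2 ^ (l + 1) := Nat.lt_pow_succ_log_self (by omega) _
  have h3 : (a ^^^ b) / 2 ^ l = 1 := by
    rw [Nat.div_eq_iff (by positivity)]
    rw [pow_succ] at h2
    omega
  rw [Nat.xor_div_two_pow] at h3
  have hle : a / 2 ^ l ≤ b / 2 ^ l := Nat.div_le_div_right hab.le
  generalize a / 2 ^ l = a' at *
  generalize b / 2 ^ l = b' at *
  -- After the shift by `l` the exclusive or is `1`: the parities differ and the halves agree. With
  -- `a' ≤ b'` this leaves only `a'` even and `b' = a' + 1`.
  have h4 : (a' ^^^ b') % 2 = (a' + b') % 2 := Nat.xor_mod_two_eq ..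
  have h5 : (a' ^^^ b') / 2 ^ 1 = a' / 2 ^ 1 ^^^ b' / 2 ^ 1 := Nat.xor_div_two_pow
  rw [h3] at h4 h5
  have h6 : a' / 2 ^ 1 = b' / 2 ^ 1 := by
    rw [← Nat.xor_eq_zero_iff, ← h5]
    rfl
  omega

/-- Both numbers have at most as many bits as `q`, and so has their exclusive or. -/
lemma xor_lt_two_mul {a b q : ℕ} (hq : 1 ≤ q) (ha : a ≤ q) (hb : b ≤ q) : a ^^^ b < 2 * q := by
  have h1 : q < 2 ^ (Nat.log 2 q + 1) := Nat.lt_pow_succ_log_self (by omega) _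
  have h2 : 2 ^ Nat.log 2 q ≤ q := Nat.pow_log_le_self 2 (by omega)
  have h3 : a ^^^ b < 2 ^ (Nat.log 2 q + 1) := Nat.xor_lt_two_pow (by omega) (by omega)
  rw [pow_succ] at h3
  omega

section curveAt
variable {d : ℕ}

lemma curveAt_shift {B B' : ℕ → ℝ} {o o' n : ℕ} (h : ∀ y < n * d, B' (o' + y) = B (o + y)) :
    curveAt d B' o' n = curveAt d B o n := by
  refine List.map_congr_left fun j hj => ?_
  ext i
  have h1 : (j + 1) * d ≤ n * d := Nat.mul_le_mul_right d (List.mem_range.mp hj)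
  rw [Nat.add_mul] at h1
  have := i.2
  simpa [pt, Nat.add_assoc] using h (j * d + i) (by omega)

lemma curveAt_add (B : ℕ → ℝ) (o n n' : ℕ) :
    curveAt d B o (n + n') = curveAt d B o n ++ curveAt d B (o + n * d) n' := by
  simp [curveAt, List.range_add, Nat.add_mul, Nat.add_assoc, Function.comp_def]

lemma curveAt_eq_map_range' (A : ℕ → ℝ) (a n : ℕ) :
    curveAt d A (a * d) n = (List.range' a n).map fun x => pt d A (x * d) := by
  rw [List.range'_eq_map_range, List.map_map]
  simp [curveAt, Function.comp_def, Nat.add_mul]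

lemma queryOutput_eq_curveAt (t : Memory) :
    queryOutput d t = curveAt d (t.rarr 1) 0 (t.ireg 0) := by
  simp [queryOutput, curveAt, pt]

end curveAt

/-! ### Correctness and cost of the query. -/

section answer
variable {w d : ℕ} {A : ℕ → ℝ} {m k L : ℕ} {γ : ℝ} {s : Memory}

/-- The query sees only the initial parts of the arrays that are output; everything that `Stores`
speaks of lies within them. -/
lemma Stores.congr {I I' : ℕ → ℕ} {B B' : ℕ → ℝ} (h : Stores d A m k γ L I B) {W X : ℕ}
    (hI : ∀ y < W, I' y = I y) (hB : ∀ y < X, B' y = B y)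
    (hWX : 2 * k < m ∧ W = lengthAddr m k (L * m) ∧ X = centreAddr d m k (L * m) ∨
      m ≤ 2 * k ∧ L = 0 ∧ W = 3 ∧ X = m * d) : Stores d A m k γ L I' B' := by
  have hW : 3 ≤ W := by
    rcases hWX with ⟨_, h1, -⟩ | ⟨_, _, h1, -⟩
    · rw [h1, lengthAddr]
      omega
    · omega
  have hX : m * d ≤ X := by
    rcases hWX with ⟨_, -, h1⟩ | ⟨_, _, -, h1⟩
    · rw [h1, centreAddr]
      omega
    · omega
  refine ⟨(hI 0 (by omega)).trans h.runs, (hI 1 (by omega)).trans h.dim,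
    (hI 2 (by omega)).trans h.size, fun y hy => (hB y (by omega)).trans (h.pts y hy), h.level_lt,
    h.lt_level, fun hkm y hy => ?_, fun l hl x hx => ?_⟩
  · refine (hI _ ?_).trans (h.log hkm y hy)
    rcases hWX with ⟨_, h1, -⟩ | ⟨_, _, h1, -⟩
    · rw [h1, lengthAddr]
      omega
    · omega
  · rcases hWX with ⟨_, h1, h2⟩ | ⟨_, h1, -⟩
    · have h3 : l * m + x + 1 ≤ L * m := by
        have := Nat.mul_le_mul_right m (Nat.succ_le_of_lt hl)
        rw [Nat.succ_mul] at this
        omega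
      refine (h.cell l hl x hx).congr (hI _ ?_) fun y _ hy => hB y ?_
      · rw [h1, lengthAddr, lengthAddr]
        omega
      · have h4 := Nat.mul_le_mul_right (k * d) h3
        rw [Nat.add_mul] at h4
        rw [h2]
        rw [centreAddr] at hy ⊢
        omega
    · omega

lemma halts_answer {i j : ℕ} (hd : 1 ≤ d) (hk : 1 ≤ k) (hkm : k ≤ m) (hγ : 0 ≤ γ)
    (hs : Stores d A m k γ L (s.iarr 0) (s.rarr 0)) (hi : s.ireg 0 = i) (hj : s.ireg 1 = j)
    (hi1 : 1 ≤ i) (hij : i < j) (hjm : j ≤ m) (hw : 8 * (m * m * m * d) < 2 ^ w) :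
    Halts w answer s fun t N => (queryOutput d t).length ≤ 2 * k ∧
      (∃ ρ, 0 ≤ ρ ∧ BallCover (fun x => pt d A (x * d)) ρ (i - 1) j (queryOutput d t) ∧
        ∀ r, Cov (fun x => pt d A (x * d)) r k (i - 1) j → ρ ≤ γ * r) ∧
      N ≤ 200 * (k * d) := by
  have hmm : m ≤ m * m := Nat.le_mul_of_pos_left m (by omega)
  have hmmm : m * m ≤ m * m * m := Nat.le_mul_of_pos_right _ (by omega)
  have hmmmd : m * m * m ≤ m * m * m * d := Nat.le_mul_of_pos_right _ hd
  have hmd : m * d ≤ m * m * m * d := Nat.mul_le_mul_right d (by omega)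
  have hdm : d ≤ m * d := Nat.le_mul_of_pos_left d (by omega)
  have hkd : k * d ≤ m * d := Nat.mul_le_mul_right d hkm
  have hkd1 : 1 ≤ k * d := Nat.mul_pos hk hd
  refine halts_iset_seq (by simp [hs.runs]; omega) (halts_iset_seq (by simp [hs.dim]; omega)
    (halts_iset_seq (by simp [hs.size]; omega) (halts_iset_seq (by simp [hi]; omega)
      (halts_iset_seq (by simp [hj]; omega) ?_))))
  set t := Memory.iset _ 6 _ with ht
  have t2 : t.ireg 2 = k := by simp [ht, hs.runs]
  have t3 : t.ireg 3 = d := by simp [ht, hs.dim]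
  have t4 : t.ireg 4 = m := by simp [ht, hs.size]
  have t5 : t.ireg 5 = i - 1 := by simp [ht, hi]
  have t6 : t.ireg 6 = j - 1 := by simp [ht, hj]
  have tI : t.iarr 0 = s.iarr 0 := by simp [ht]
  have tB : t.rarr 0 = s.rarr 0 := by simp [ht]
  clear_value t
  obtain ⟨a, rfl⟩ : ∃ a, i = a + 1 := ⟨i - 1, by omega⟩
  obtain ⟨b, rfl⟩ : ∃ b, j = b + 1 := ⟨j - 1, by omega⟩
  simp only [Nat.add_sub_cancel] at t5 t6 ⊢
  refine halts_ite (fun hb => ?_) (fun hb => ?_)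
  · have hb' : b + 1 - a ≤ 2 * k := by simpa [t2, t5, t6] using hb
    have hlen := Nat.mul_le_mul_right d hb'
    rw [Nat.mul_assoc] at hlen
    refine halts_iset_seq (by simp [t5, t6]; omega) ?_
    set u := Memory.iset _ 0 _ with hu
    have u0 : u.ireg 0 = b + 1 - a := by simp [hu, t5, t6]
    have u3 : u.ireg 3 = d := by simp [hu, t3]
    have u5 : u.ireg 5 = a := by simp [hu, t5]
    have uB : u.rarr 0 = s.rarr 0 := by simp [hu, tB]
    refine (halts_copyReals 0 (a * d) ((b + 1 - a) * d) (by decide) (by omega) ?_ ?_ ?_).imp ?_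
    · intro t' _
      rfl
    · intro t' hf
      simp [(hf.ireg 3 rfl).trans u3, (hf.ireg 5 rfl).trans u5]
    · intro t' hf
      simp [(hf.ireg 3 rfl).trans u3, (hf.ireg 0 rfl).trans u0]
    rintro t' N hf ⟨hcopy, hN⟩
    have e0 : t'.ireg 0 = b + 1 - a := (hf.ireg 0 rfl).trans u0
    have hout : queryOutput d t' =
        (List.range' a (b + 1 - a)).map fun x => pt d A (x * d) := by
      rw [queryOutput_eq_curveAt, e0, ← curveAt_eq_map_range']
      refine curveAt_shift fun y hy => ?_
      have h1 : (b + 1 - a) * d + a * d ≤ m * d := by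
        rw [← Nat.add_mul]
        exact Nat.mul_le_mul_right d (by omega)
      rw [hcopy, if_pos (by omega), uB, hs.pts _ (by omega)]
      simp
    refine ⟨by rw [hout]; simpa using hb', ⟨0, le_rfl, ?_, fun r hr => ?_⟩, ?_⟩
    · rw [hout]
      have := ballCover_self (p := fun x => pt d A (x * d)) (a := a) (b + 1 - a)
      rwa [show a + (b + 1 - a) = b + 1 by omega] at this
    · exact mul_nonneg hγ (hr.nonneg (by omega))
    · simp at hN ⊢
      omega
  · have hb' : 2 * k < b + 1 - a := by
      simp [t2, t5, t6] at hb
      omega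
    have hak := Nat.div_mul_le_self a k
    have hbk := Nat.div_mul_le_self b k
    have hbk' := Nat.lt_div_mul_add (a := b) (by omega : 0 < k)
    -- More than `2 * k` points cannot lie in one block of `k`, so the exclusive or is nonzero.
    have hlt : a / k < b / k := by
      rw [Nat.div_lt_iff_lt_mul (by omega)]
      omega
    obtain ⟨heven, hsucc⟩ := div_two_pow_log_xor hlt
    have hxor : a / k ^^^ b / k < 2 * (m / k) := xor_lt_two_mul (Nat.div_pos hkm (by omega))
      (Nat.div_le_div_right (by omega)) (Nat.div_le_div_right (by omega))
    have hlog := hs.log (by omega) _ hxor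
    set l := Nat.log 2 (a / k ^^^ b / k)
    -- The block of `b` at level `l` has an odd number, so it is not the first one. Hence the block
    -- size is at most `b < m`, and the level is present.
    have hpow : k * 2 ^ l ≤ b := by
      have h1 : 2 ^ l ≤ b / k := by
        by_contra hc
        rw [Nat.div_eq_of_lt (not_le.mp hc)] at hsucc
        omega
      calc k * 2 ^ l ≤ k * (b / k) := Nat.mul_le_mul_left k h1
        _ ≤ b := Nat.mul_div_le b k
    have hl2 : l < 2 ^ l := Nat.lt_two_pow_self
    have hl3 : 2 ^ l ≤ k * 2 ^ l := Nat.le_mul_of_pos_left _ hk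
    have hlL : l < L := hs.lt_level (by omega) l (by omega)
    have hlm : l * m + m ≤ m * m := by
      rw [← Nat.succ_mul]
      exact Nat.mul_le_mul_right m (by omega)
    rw [Nat.div_div_eq_div_mul, Nat.div_div_eq_div_mul] at hsucc
    rw [Nat.div_div_eq_div_mul] at heven
    obtain ⟨n₁, ρ₁, hn₁, hnk₁, hρ₁, hcov₁, hopt₁⟩ := hs.cell l hlL a (by omega)
    obtain ⟨n₂, ρ₂, hn₂, hnk₂, hρ₂, hcov₂, hopt₂⟩ := hs.cell l hlL b (by omega)
    generalize hh : k * 2 ^ l = h at *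
    have hbh := Nat.div_mul_le_self b h
    have hstart₁ : intervalStart h a = a := by rw [intervalStart, if_pos heven]
    -- The two stored intervals meet at `b / h * h`, the beginning of the block of `b`; it is at
    -- most `b < m`, so the truncation at `m` has no effect.
    have hstop₁ : intervalStop m h a = b / h * h := by
      rw [intervalStop, if_pos heven, ← hsucc, min_eq_left (by omega)]
    have hstart₂ : intervalStart h b = b / h * h := by rw [intervalStart, if_neg (by omega)]
    have hstop₂ : intervalStop m h b = b + 1 := by rw [intervalStop, if_neg (by omega)]
    rw [hstart₁, hstop₁] at hcov₁ hopt₁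
    rw [hstart₂, hstop₂] at hcov₂ hopt₂
    have hnd₁ := Nat.mul_le_mul_right d hnk₁
    have hnd₂ := Nat.mul_le_mul_right d hnk₂
    have hval : IExp.eval t (.get 0 (3 + .bin .xor (.reg 5 / .reg 2) (.reg 6 / .reg 2))) = l := by
      simp [t2, t5, t6, tI, hlog]
    refine halts_iset_seq (by rw [hval]; omega) ?_
    rw [hval]
    refine halts_iset_seq (by simp [t4, t5]; omega) (halts_iset_seq (by simp [t4, t6]; omega) ?_)
    set t₁ := Memory.iset _ 10 _ with ht₁
    have v2 : t₁.ireg 2 = k := by simp [ht₁, t2]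
    have v3 : t₁.ireg 3 = d := by simp [ht₁, t3]
    have v4 : t₁.ireg 4 = m := by simp [ht₁, t4]
    have v9 : t₁.ireg 9 = l * m + a := by simp [ht₁, t4, t5]
    have v10 : t₁.ireg 10 = l * m + b := by simp [ht₁, t4, t6]
    have vI : t₁.iarr 0 = s.iarr 0 := by simp [ht₁, tI]
    have vB : t₁.rarr 0 = s.rarr 0 := by simp [ht₁, tB]
    clear_value t₁
    have hval₁ : IExp.eval t₁ (.get 0 (3 + 2 * (.reg 4 / .reg 2) + .reg 9)) = n₁ := by
      simpa [v2, v4, v9, vI, lengthAddr] using hn₁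
    refine halts_iset_seq (by rw [hval₁]; omega) ?_
    rw [hval₁]
    have hval₂ : IExp.eval (t₁.iset 7 n₁) (.get 0 (3 + 2 * (.reg 4 / .reg 2) + .reg 10)) = n₂ := by
      simpa [v2, v4, v10, vI, lengthAddr] using hn₂
    refine halts_iset_seq (by rw [hval₂]; omega) ?_
    rw [hval₂]
    set t₂ := Memory.iset _ 8 _ with ht₂
    have v2 : t₂.ireg 2 = k := by simp [ht₂, v2]
    have v3 : t₂.ireg 3 = d := by simp [ht₂, v3]
    have v4 : t₂.ireg 4 = m := by simp [ht₂, v4]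
    have v7 : t₂.ireg 7 = n₁ := by simp [ht₂]
    have v8 : t₂.ireg 8 = n₂ := by simp [ht₂]
    have v9 : t₂.ireg 9 = l * m + a := by simp [ht₂, v9]
    have v10 : t₂.ireg 10 = l * m + b := by simp [ht₂, v10]
    have vB : t₂.rarr 0 = s.rarr 0 := by simp [ht₂, vB]
    clear_value t₂
    refine halts_seq ((halts_copyReals 0 (centreAddr d m k (l * m + a)) (n₁ * d) (by decide)
      (by omega) ?_ ?_ ?_).imp ?_)
    · intro t' _
      rfl
    · intro t' hf
      simp [(hf.ireg 2 rfl).trans v2, (hf.ireg 3 rfl).trans v3, (hf.ireg 4 rfl).trans v4,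
        (hf.ireg 9 rfl).trans v9, centreAddr]
    · intro t' hf
      simp [(hf.ireg 3 rfl).trans v3, (hf.ireg 7 rfl).trans v7]
    rintro t₃ N₃ hf₃ ⟨hcopy₃, hN₃⟩
    have v2 : t₃.ireg 2 = k := (hf₃.ireg 2 rfl).trans v2
    have v3 : t₃.ireg 3 = d := (hf₃.ireg 3 rfl).trans v3
    have v4 : t₃.ireg 4 = m := (hf₃.ireg 4 rfl).trans v4
    have v7 : t₃.ireg 7 = n₁ := (hf₃.ireg 7 rfl).trans v7
    have v8 : t₃.ireg 8 = n₂ := (hf₃.ireg 8 rfl).trans v8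
    have v10 : t₃.ireg 10 = l * m + b := (hf₃.ireg 10 rfl).trans v10
    have vB₃ : t₃.rarr 0 = s.rarr 0 := (hf₃.rarr 0 rfl).trans vB
    refine halts_seq ((halts_copyReals (n₁ * d) (centreAddr d m k (l * m + b)) (n₂ * d) (by decide)
      (by omega) ?_ ?_ ?_).imp ?_)
    · intro t' hf
      simp [(hf.ireg 3 rfl).trans v3, (hf.ireg 7 rfl).trans v7]
    · intro t' hf
      simp [(hf.ireg 2 rfl).trans v2, (hf.ireg 3 rfl).trans v3, (hf.ireg 4 rfl).trans v4,
        (hf.ireg 10 rfl).trans v10, centreAddr]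
    · intro t' hf
      simp [(hf.ireg 3 rfl).trans v3, (hf.ireg 8 rfl).trans v8]
    rintro t₄ N₄ hf₄ ⟨hcopy₄, hN₄⟩
    have v7 : t₄.ireg 7 = n₁ := (hf₄.ireg 7 rfl).trans v7
    have v8 : t₄.ireg 8 = n₂ := (hf₄.ireg 8 rfl).trans v8
    refine halts_iset (by simp [v7, v8]; omega) ?_
    have hout : queryOutput d (t₄.iset 0 (IExp.eval t₄ (.reg 7 + .reg 8))) =
        curveAt d (s.rarr 0) (centreAddr d m k (l * m + a)) n₁ ++
          curveAt d (s.rarr 0) (centreAddr d m k (l * m + b)) n₂ := by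
      rw [queryOutput_eq_curveAt]
      simp only [iset_ireg, iset_rarr, IExp.eval_add, IExp.eval_reg, if_true, v7, v8]
      rw [curveAt_add]
      congr 1
      · refine curveAt_shift fun y hy => ?_
        rw [hcopy₄, if_neg (by omega), hcopy₃, if_pos (by omega), vB]
        simp
      · refine curveAt_shift fun y hy => ?_
        rw [hcopy₄, if_pos (by omega), vB₃]
        congr 2
        omega
    rw [hout]
    refine ⟨by simp; omega, ⟨max ρ₁ ρ₂, le_max_of_le_left hρ₁, ?_, fun r hr => ?_⟩, ?_⟩
    · exact (hcov₁.mono (le_max_left _ _)).append (hcov₂.mono (le_max_right _ _))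
    -- A cover of the whole interval by `k` runs also covers either part by `k` runs.
    · exact max_le (hopt₁ r (hr.mono_right (by omega)))
        (hopt₂ r (hr.mono_left hcov₁.le))
    · simp at hN₃ hN₄ ⊢
      omega

end answer

/-! ## Inputs and outputs -/

lemma getD_flatMap_ofFn {d : ℕ} (P : List (Point d)) (x : ℕ) (h : x < P.length) (b : Fin d) :
    (P.flatMap fun p => List.ofFn fun b : Fin d => p b).getD (x * d + b) 0 = P[x] b := by
  induction P generalizing x with
  | nil => simp at h
  | cons q P ih =>
    rw [List.flatMap_cons]
    cases x with
    | zero =>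
      rw [List.getD_append _ _ _ _ (by simp)]
      simp
    | succ x =>
      rw [List.getD_append_right _ _ _ _ (by simp [Nat.add_mul]; omega)]
      have h1 : (x + 1) * d + b - (List.ofFn fun b : Fin d => q b).length = x * d + b := by
        rw [List.length_ofFn, Nat.add_mul]
        omega
      rw [h1, ih x (by simpa using h)]
      simp

lemma getD_map_range {α : Type*} (f : ℕ → α) (z : α) {n y : ℕ} (hy : y < n) :
    ((List.range n).map f).getD y z = f y := by
  rw [List.getD_eq_getElem _ _ (by simpa using hy)]
  simp

/-- The number `L` of levels is known only from the run, so the space and time bounds are demanded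
for every `L` whose levels all satisfy `k * 2 ^ l < m`. -/
lemma zoomsIn {d m k T R w : ℕ} {ε space queryTime prepTime : ℝ} {P : List (Point d)} (hd : 1 ≤ d)
    (hP : P.length = m) (hk : 1 ≤ k) (hkm : k ≤ m) (hε : 0 < ε) (hε' : ε < 1 / 2)
    (hT : (1 - ε / 8) ^ T * (4 + ε / 8) < ε / 8) (hR : (m : ℝ) ≤ ε / 8 * 2 ^ R)
    (hw : 8 * (m * m * m * d) < 2 ^ w)
    (hspace : ∀ L, (∀ l < L, k * 2 ^ l < m) →
      2 * k < m → ((lengthAddr m k (L * m) + centreAddr d m k (L * m) : ℕ) : ℝ) ≤ space)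
    (hspace' : m ≤ 2 * k → ((3 + m * d : ℕ) : ℝ) ≤ space)
    (hquery : ((200 * (k * d) : ℕ) : ℝ) ≤ queryTime)
    (hprep : ∀ L, (∀ l < L, k * 2 ^ l < m) →
      ((1000 * (d * ((2 * T + 3) * m)) * (R + 2) * m * (L + 1) : ℕ) : ℝ) ≤ prepTime) :
    ZoomsIn preprocess answer w P k ε space queryTime prepTime := by
  set A := (prepInput P k ε).rarr 0 with hA
  obtain ⟨t, n, hrun, L, hst, hlen, hn⟩ := halts_preprocess (s := prepInput P k ε) (A := A) hd hk hkm
    hε hε' hT hR hw (by simpa [prepInput] using hP) (by simp [prepInput]) (by simp [prepInput])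
    (by simp [prepInput]) rfl
  refine ⟨t, n, hrun, le_trans (by exact_mod_cast hn) (hprep L hst.level_lt), ?_, ?_⟩
  · have : (prepOutput t).space = t.ireg 0 + t.ireg 1 := by
      simp [DataStructure.space, prepOutput]
    rw [this]
    rcases hlen with ⟨h1, h2, h3⟩ | ⟨h1, h2, h3, h4⟩
    · rw [h2, h3]
      exact hspace L hst.level_lt h1
    · rw [h3, h4]
      exact hspace' h1
  · intro i j hi hij hj
    rw [hP] at hj
    have hst' : Stores d A m k (1 + ε) L ((queryInput (prepOutput t) i j).iarr 0)
        ((queryInput (prepOutput t) i j).rarr 0) := by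
      refine hst.congr (W := t.ireg 0) (X := t.ireg 1) (fun y hy => ?_) (fun y hy => ?_) hlen
      · simpa [queryInput, prepOutput] using getD_map_range (t.iarr 1) 0 hy
      · simpa [queryInput, prepOutput] using getD_map_range (t.rarr 1) 0 hy
    obtain ⟨t', n', hrun', hlen', ⟨ρ, hρ, hcov, hopt⟩, hn'⟩ := halts_answer hd hk hkm
      (by linarith) hst' (by simp [queryInput]) (by simp [queryInput]) hi hij hj hw
    refine ⟨t', n', hrun', le_trans (by exact_mod_cast hn') hquery, ?_⟩
    rw [subcurve_eq_map (p := fun x => pt d A (x * d)) hi (by omega)]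
    · have hj' : i - 1 + (j + 1 - i) = j := by omega
      refine isSimplification_of_ballCover (by omega) (by linarith) hρ ?_ (by rwa [hj'])
        (by rwa [hj'])
      exact_mod_cast hlen'
    · intro x hx
      ext b
      simpa [pt, hA, prepInput] using getD_flatMap_ofFn P x hx b

/-! ## The bounds -/

section bounds
variable {d m k : ℕ} {ε : ℝ}

/-- `(1 - e) ^ T ≤ exp (-(e * T)) ≤ e / 5` as soon as `T ≥ log (5 / e) / e`, and `4 + e < 5`. -/
lemma exists_moves {e : ℝ} (he : 0 < e) (he' : e ≤ 1 / 16) : ∃ T : ℕ,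
    (1 - e) ^ T * (4 + e) < e ∧ (T : ℝ) ≤ 1 / e * Real.log (5 / e) + 2 := by
  have hlog : 0 ≤ Real.log (5 / e) := by
    refine Real.log_nonneg ?_
    rw [le_div_iff₀ he]
    linarith
  refine ⟨⌈1 / e * Real.log (5 / e)⌉₊ + 1, ?_, ?_⟩
  · set T := ⌈1 / e * Real.log (5 / e)⌉₊ + 1 with hT
    have h1 : 1 / e * Real.log (5 / e) ≤ T := by
      rw [hT]
      push_cast
      linarith [Nat.le_ceil (1 / e * Real.log (5 / e))]
    have h2 : (1 - e) ^ T ≤ Real.exp (-(e * T)) := by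
      rw [show -(e * T) = T * (-e) by ring, Real.exp_nat_mul]
      exact pow_le_pow_left₀ (by linarith) (Real.one_sub_le_exp_neg e) _
    have h3 : Real.exp (-(e * T)) ≤ e / 5 := by
      have h4 : Real.log (5 / e) ≤ e * T := by
        calc Real.log (5 / e) = e * (1 / e * Real.log (5 / e)) := by field_simp
          _ ≤ e * T := by gcongr
      calc Real.exp (-(e * T)) ≤ Real.exp (-Real.log (5 / e)) := Real.exp_le_exp.mpr (by linarith)
        _ = e / 5 := by rw [Real.exp_neg, Real.exp_log (by positivity), inv_div]
    nlinarith
  · push_cast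
    linarith [Nat.ceil_lt_add_one (show 0 ≤ 1 / e * Real.log (5 / e) by positivity)]

lemma log_le_logb_two {x : ℝ} (hx : 1 ≤ x) : Real.log x ≤ Real.logb 2 x := by
  rw [Real.logb, le_div_iff₀ (Real.log_pos (by norm_num))]
  have := Real.log_nonneg hx
  have := Real.log_two_lt_d9
  nlinarith

lemma logb_two_pow_mul {x : ℝ} (n : ℕ) (hx : 0 < x) :
    Real.logb 2 (2 ^ n * x) = n + Real.logb 2 x := by
  rw [Real.logb_mul (by positivity) hx.ne', Real.logb_pow, Real.logb_self_eq_one (by norm_num)]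
  ring

lemma logb_two_le_logb {x y : ℝ} (hx : 0 < x) (h : x ≤ y) : Real.logb 2 x ≤ Real.logb 2 y :=
  Real.logb_le_logb_of_le (by norm_num) hx h

/-- The size of the problem, whose logarithm occurs in the bounds. -/
lemma two_le_size (hd : 1 ≤ d) (hm : 1 ≤ m) (hε : 0 < ε) (hε' : ε < 1 / 2) :
    1 ≤ Real.logb 2 (m * d / ε) ∧ Real.logb 2 m ≤ Real.logb 2 (m * d / ε) ∧
      Real.logb 2 d ≤ Real.logb 2 (m * d / ε) ∧ Real.logb 2 (1 / ε) ≤ Real.logb 2 (m * d / ε) ∧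
      Real.logb 2 (m / ε) ≤ Real.logb 2 (m * d / ε) := by
  have hd' : (1 : ℝ) ≤ d := by exact_mod_cast hd
  have hm' : (1 : ℝ) ≤ m := by exact_mod_cast hm
  have hmd : (m : ℝ) ≤ m * d := le_mul_of_one_le_right (by linarith) hd'
  have hmd' : (d : ℝ) ≤ m * d := le_mul_of_one_le_left (by linarith) hm'
  have h0 : (m : ℝ) * d ≤ m * d / ε := le_div_self (by positivity) hε (by linarith)
  refine ⟨?_, ?_, ?_, ?_, ?_⟩
  -- `m * d / ε ≥ 2` because `ε < 1 / 2`; a logarithm of at least `1` later absorbs all additive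
  -- constants.
  · rw [← Real.logb_self_eq_one (b := 2) (by norm_num)]
    refine logb_two_le_logb (by norm_num) ?_
    rw [le_div_iff₀ hε]
    nlinarith
  · exact logb_two_le_logb (by linarith) (by linarith)
  · exact logb_two_le_logb (by linarith) (by linarith)
  · exact logb_two_le_logb (by positivity) (by gcongr; linarith)
  · exact logb_two_le_logb (by positivity) (by gcongr)

lemma exists_bisections (hm : 1 ≤ m) (hε : 0 < ε) (hε' : ε < 1 / 2) : ∃ R : ℕ,
    (m : ℝ) ≤ ε / 8 * 2 ^ R ∧ (R : ℝ) ≤ Real.logb 2 (m / ε) + 4 := by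
  have hm' : (1 : ℝ) ≤ m := by exact_mod_cast hm
  have hpos : 0 < (m : ℝ) / ε := by positivity
  have h1 : Real.logb 2 (2 ^ 3 * (m / ε)) = 3 + Real.logb 2 (m / ε) := by
    exact_mod_cast logb_two_pow_mul 3 hpos
  have h2 : 0 ≤ Real.logb 2 (m / ε) := by
    refine Real.logb_nonneg (by norm_num) ?_
    rw [le_div_iff₀ hε]
    linarith
  refine ⟨⌈Real.logb 2 (2 ^ 3 * (m / ε))⌉₊, ?_, ?_⟩
  · have h3 := Nat.le_ceil (Real.logb 2 (2 ^ 3 * (m / ε)))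
    rw [Real.logb_le_iff_le_rpow (by norm_num) (by positivity), Real.rpow_natCast] at h3
    calc (m : ℝ) = ε / 8 * (2 ^ 3 * (m / ε)) := by field_simp; norm_num
      _ ≤ _ := by gcongr
  · have h3 := Nat.ceil_lt_add_one (a := Real.logb 2 (2 ^ 3 * (m / ε))) (by linarith)
    linarith

lemma exists_wordSize (hd : 1 ≤ d) (hm : 1 ≤ m) (hε : 0 < ε) (hε' : ε < 1 / 2) : ∃ w : ℕ,
    8 * (m * m * m * d) < 2 ^ w ∧ (w : ℝ) ≤ 9 * Real.logb 2 (m * d / ε) := by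
  obtain ⟨h1, h2, h3, -, -⟩ := two_le_size hd hm hε hε'
  refine ⟨Nat.log 2 (8 * (m * m * m * d)) + 1, Nat.lt_pow_succ_log_self (by norm_num) _, ?_⟩
  have hpos : 0 < 8 * (m * m * m * d) :=
    Nat.mul_pos (by norm_num) (Nat.mul_pos (Nat.mul_pos (Nat.mul_pos hm hm) hm) hd)
  have hpow : 2 ^ Nat.log 2 (8 * (m * m * m * d)) ≤ 8 * (m * m * m * d) :=
    Nat.pow_log_le_self 2 hpos.ne'
  have hm0 : (m : ℝ) ≠ 0 := Nat.cast_ne_zero.mpr (by omega)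
  have hd0 : (d : ℝ) ≠ 0 := Nat.cast_ne_zero.mpr (by omega)
  have h4 : ((Nat.log 2 (8 * (m * m * m * d)) : ℕ) : ℝ) ≤ Real.logb 2 (2 ^ 3 * (m * m * m * d)) := by
    rw [Real.le_logb_iff_rpow_le (by norm_num) (by positivity), Real.rpow_natCast]
    norm_num
    exact_mod_cast hpow
  rw [logb_two_pow_mul 3 (by positivity), Real.logb_mul (by positivity) hd0,
    Real.logb_mul (by positivity) hm0, Real.logb_mul hm0 hm0] at h4
  push_cast at h4 ⊢
  linarith

/-- The number of levels. -/
lemma levels_le {L : ℕ} (hk : 1 ≤ k) (hkm : k ≤ m) (hL : ∀ l < L, k * 2 ^ l < m) :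
    (L : ℝ) ≤ Real.logb 2 (m / k) + 1 := by
  have hk' : (0 : ℝ) < k := by exact_mod_cast hk
  have hm' : (0 : ℝ) < m := by exact_mod_cast hk.trans hkm
  rcases Nat.eq_zero_or_pos L with rfl | hpos
  · have : 0 ≤ Real.logb 2 ((m : ℝ) / k) := by
      refine Real.logb_nonneg (by norm_num) ?_
      rw [le_div_iff₀ hk']
      simpa using hkm
    push_cast
    linarith
  · obtain ⟨l, rfl⟩ : ∃ l, L = l + 1 := ⟨L - 1, by omega⟩
    have h1 : (l : ℝ) ≤ Real.logb 2 (m / k) := by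
      rw [Real.le_logb_iff_rpow_le (by norm_num) (by positivity), Real.rpow_natCast,
        le_div_iff₀ hk', mul_comm]
      exact_mod_cast (hL l (by omega)).le
    push_cast
    linarith

lemma space_le_of_lt {L : ℕ} (hd : 1 ≤ d) (hk : 1 ≤ k) (hL : ∀ l < L, k * 2 ^ l < m)
    (hkm : 2 * k < m) : ((lengthAddr m k (L * m) + centreAddr d m k (L * m) : ℕ) : ℝ) ≤
      10 * spaceBound m k d := by
  have hlev := levels_le hk (by omega) hL
  have hk' : (0 : ℝ) < k := by exact_mod_cast hk
  have hm' : (0 : ℝ) < m := by exact_mod_cast (by omega : 0 < m)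
  have h1 : 1 ≤ Real.logb 2 ((m : ℝ) / k) := by
    rw [Real.le_logb_iff_rpow_le (by norm_num) (by positivity), Real.rpow_one, le_div_iff₀ hk']
    exact_mod_cast hkm.le
  have h2 : lengthAddr m k (L * m) + centreAddr d m k (L * m) ≤ (6 + 2 * L) * (m * (k * d)) := by
    have h3 : m / k ≤ m := Nat.div_le_self _ _
    have h4 : 1 ≤ k * d := Nat.mul_pos hk hd
    have h5 : m * d ≤ m * (k * d) := Nat.mul_le_mul_left m (Nat.le_mul_of_pos_left d hk)
    have h6 : m ≤ m * (k * d) := Nat.le_mul_of_pos_right m h4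
    have h7 : L * m ≤ L * (m * (k * d)) := Nat.mul_le_mul_left L h6
    have h8 : (6 + 2 * L) * (m * (k * d)) = 6 * (m * (k * d)) + L * (m * (k * d)) +
        L * m * (k * d) := by ring
    rw [lengthAddr, centreAddr, h8]
    omega
  rw [spaceBound, if_pos (by omega)]
  calc ((lengthAddr m k (L * m) + centreAddr d m k (L * m) : ℕ) : ℝ)
      ≤ (((6 + 2 * L) * (m * (k * d)) : ℕ) : ℝ) := by exact_mod_cast h2
    _ = (6 + 2 * L) * (m * k * d) := by push_cast; ring
    _ ≤ (10 * Real.logb 2 ((m : ℝ) / k)) * (m * k * d) := by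
      refine mul_le_mul_of_nonneg_right ?_ (by positivity)
      linarith
    _ = _ := by ring

/-- The delicate case is `k < m ≤ 2 * k`, where the logarithm may be tiny. Since `log (m / k) ≥ 1 -
k / m ≥ 1 / m`, the bound is still at least `k * d`, hence at least `m * d / 2`. -/
lemma space_le_of_le (hd : 1 ≤ d) (hk : 1 ≤ k) (hkm : k ≤ m) (hmk : m ≤ 2 * k) :
    ((3 + m * d : ℕ) : ℝ) ≤ 10 * spaceBound m k d := by
  have hk' : (0 : ℝ) < k := by exact_mod_cast hk
  have hd' : (1 : ℝ) ≤ d := by exact_mod_cast hd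
  have hm' : (1 : ℝ) ≤ m := by exact_mod_cast hk.trans hkm
  have h1 : (1 : ℝ) ≤ m * d := one_le_mul_of_one_le_of_one_le hm' hd'
  rw [spaceBound]
  push_cast
  split_ifs with h
  · have hkm' : (k : ℝ) + 1 ≤ m := by exact_mod_cast h
    have h2 : 1 / (m : ℝ) ≤ Real.logb 2 ((m : ℝ) / k) := by
      refine le_trans ?_ (log_le_logb_two ?_)
      · refine le_trans ?_ (Real.one_sub_inv_le_log_of_pos (by positivity))
        rw [inv_div, one_sub_div (by positivity)]
        gcongr
        linarith
      · rw [le_div_iff₀ hk']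
        linarith
    have h3 : (k : ℝ) * d ≤ m * k * d * Real.logb 2 ((m : ℝ) / k) := by
      calc (k : ℝ) * d = m * k * d * (1 / m) := by field_simp
        _ ≤ _ := by gcongr
    have h4 : (m : ℝ) * d ≤ 2 * (k * d) := by
      rw [← mul_assoc]
      gcongr
      exact_mod_cast hmk
    linarith
  · linarith

/-- The levels, the bisections and the moves contribute one logarithm each, and the moves also
contribute `1 / ε`. The constant is `1000 * 119 * 7 * 3 = 2499000`, rounded up. -/
lemma prep_le {T R L : ℕ} (hd : 1 ≤ d) (hk : 1 ≤ k) (hkm : k ≤ m) (hε : 0 < ε) (hε' : ε < 1 / 2)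
    (hT : (T : ℝ) ≤ 1 / (ε / 8) * Real.log (5 / (ε / 8)) + 2)
    (hR : (R : ℝ) ≤ Real.logb 2 (m / ε) + 4) (hL : ∀ l < L, k * 2 ^ l < m) :
    ((1000 * (d * ((2 * T + 3) * m)) * (R + 2) * m * (L + 1) : ℕ) : ℝ) ≤
      3000000 * ((m : ℝ) ^ 2 * d / ε) * Real.logb 2 (m * d / ε) ^ 3 := by
  obtain ⟨h1, h2, -, h4, h5⟩ := two_le_size hd (hk.trans hkm) hε hε'
  have hk' : (1 : ℝ) ≤ k := by exact_mod_cast hk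
  have hm' : (1 : ℝ) ≤ m := by exact_mod_cast hk.trans hkm
  set Λ := Real.logb 2 (m * d / ε) with hΛ
  have hL' : (L : ℝ) + 1 ≤ 3 * Λ := by
    have h6 : Real.logb 2 ((m : ℝ) / k) ≤ Real.logb 2 m :=
      logb_two_le_logb (by positivity) (div_le_self (by linarith) hk')
    have := levels_le hk hkm hL
    linarith
  have hR' : (R : ℝ) + 2 ≤ 7 * Λ := by linarith
  -- `5 / (ε / 8) = 40 / ε ≤ 2 ^ 6 / ε`, so its logarithm is at most `6 + Λ ≤ 7 * Λ`. Then `T ≤ 56 *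
  -- Λ / ε + 2`, and the leftover `7` is at most `7 * Λ / ε`.
  have hT' : 2 * (T : ℝ) + 3 ≤ 119 * Λ / ε := by
    have h6 : Real.log (5 / (ε / 8)) ≤ 7 * Λ := by
      have h7 : (1 : ℝ) ≤ 1 / ε := by
        rw [le_div_iff₀ hε]
        linarith
      calc Real.log (5 / (ε / 8)) ≤ Real.log (2 ^ 6 * (1 / ε)) := by
            refine Real.log_le_log (by positivity) ?_
            rw [show 5 / (ε / 8) = 40 * (1 / ε) by field_simp; norm_num]
            gcongr
            norm_num
        _ ≤ Real.logb 2 (2 ^ 6 * (1 / ε)) := log_le_logb_two (by linarith)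
        _ = 6 + Real.logb 2 (1 / ε) := by exact_mod_cast logb_two_pow_mul 6 (by positivity)
        _ ≤ 7 * Λ := by linarith
    have h7 : (T : ℝ) ≤ 56 * Λ / ε + 2 := by
      calc (T : ℝ) ≤ 1 / (ε / 8) * Real.log (5 / (ε / 8)) + 2 := hT
        _ ≤ 1 / (ε / 8) * (7 * Λ) + 2 := by gcongr
        _ = _ := by field_simp; ring
    have h8 : 7 ≤ 7 * Λ / ε := by
      rw [le_div_iff₀ hε]
      nlinarith
    calc 2 * (T : ℝ) + 3 ≤ 2 * (56 * Λ / ε + 2) + 7 * Λ / ε - 4 := by linarith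
      _ = _ := by ring
  push_cast
  calc 1000 * ((d : ℝ) * ((2 * T + 3) * m)) * (R + 2) * m * (L + 1)
      ≤ 1000 * ((d : ℝ) * ((119 * Λ / ε) * m)) * (7 * Λ) * m * (3 * Λ) := by gcongr
    _ = 2499000 * ((m : ℝ) ^ 2 * d / ε) * Λ ^ 3 := by ring
    _ ≤ _ := by gcongr; norm_num

end bounds

/-! ### Assembly of the theorem. -/

lemma zoomsIn_preprocess_answer {d m k : ℕ} {ε : ℝ} {P : List (Point d)} (hd : 1 ≤ d)
    (hP : P.length = m) (hk : 1 ≤ k) (hkm : k ≤ m) (hε : 0 < ε) (hε' : ε < 1 / 2) :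
    ∃ w : ℕ, (w : ℝ) ≤ 9 * Real.logb 2 (m * d / ε) ∧
      ∀ C ≥ (200 : ℝ), ∀ prepTime : ℝ,
        3000000 * ((m : ℝ) ^ 2 * d / ε) * Real.logb 2 (m * d / ε) ^ 3 ≤ prepTime →
        ZoomsIn preprocess answer w P k ε (C * spaceBound m k d) (C * (k * d)) prepTime := by
  obtain ⟨w, hw, hw'⟩ := exists_wordSize hd (hk.trans hkm) hε hε'
  obtain ⟨T, hT, hT'⟩ := exists_moves (e := ε / 8) (by linarith) (by linarith)
  obtain ⟨R, hR, hR'⟩ := exists_bisections (hk.trans hkm) hε hε'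
  have hspace : 0 ≤ spaceBound m k d := by
    have hk' : (0 : ℝ) < k := by exact_mod_cast hk
    rw [spaceBound]
    split_ifs
    · have : 0 ≤ Real.logb 2 ((m : ℝ) / k) := by
        refine Real.logb_nonneg (by norm_num) ?_
        rw [le_div_iff₀ hk']
        simpa using hkm
      positivity
    · positivity
  refine ⟨w, hw', fun C hC prepTime hprep => zoomsIn hd hP hk hkm hε hε' hT hR hw ?_ ?_ ?_ ?_⟩
  · intro L hL hkm'
    exact (space_le_of_lt hd hk hL hkm').trans (by gcongr; linarith)
  · intro hkm'
    exact (space_le_of_le hd hk hkm hkm').trans (by gcongr; linarith)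
  · push_cast
    gcongr
  · intro L hL
    exact (prep_le hd hk hkm hε hε' hT' hR' hL).trans hprep

theorem mainTheorem9 :
    ∃ (query : Prog) (C : ℝ),
      -- general dimension: the constants `C`, `c` are absolute
      (∃ (prep : Prog) (c : ℕ),
        ∀ (d m k : ℕ) (ε : ℝ) (P : List (Point d)),
          1 ≤ d → P.length = m → 1 ≤ k → k ≤ m → 0 < ε → ε < 1 / 2 →
          ∃ w : ℕ, (w : ℝ) ≤ C * Real.logb 2 (m * d / ε) ∧
            ZoomsIn prep query w P k ε (C * spaceBound m k d) (C * (k * d))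
              (C * ((m : ℝ) ^ 2 * d * ε ^ (-(9 / 2) : ℝ)) * Real.logb 2 (m * d / ε) ^ c)) ∧
      -- fixed dimension: only the preprocessing time and the word size have constants that depend on `d`
      (∃ prep : Prog, ∀ d : ℕ, 1 ≤ d → ∃ (C' : ℝ) (c' : ℕ),
        ∀ (m k : ℕ) (ε : ℝ) (P : List (Point d)),
          P.length = m → 1 ≤ k → k ≤ m → 0 < ε → ε < 1 / 2 →
          ∃ w : ℕ, (w : ℝ) ≤ C' * Real.logb 2 (m / ε) ∧
            ZoomsIn prep query w P k ε (C * spaceBound m k d) (C * (k * d))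
              (C' * ((m : ℝ) ^ 2 / ε) * Real.logb 2 (m / ε) ^ c')) := by
  refine ⟨answer, 3000000, ⟨preprocess, 3, fun d m k ε P hd hP hk hkm hε hε' => ?_⟩, preprocess,
    fun d hd => ⟨3000000 * d * (1 + Real.logb 2 d) ^ 3, 3, fun m k ε P hP hk hkm hε hε' => ?_⟩⟩
  · obtain ⟨w, hw, h⟩ := zoomsIn_preprocess_answer hd hP hk hkm hε hε'
    have h1 := (two_le_size hd (hk.trans hkm) hε hε').1
    refine ⟨w, hw.trans (by gcongr; norm_num), h _ (by norm_num) _ ?_⟩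
    -- The running time has only one factor `1 / ε`, far below the exponent allowed.
    have h2 : 1 / ε ≤ ε ^ (-(9 / 2) : ℝ) := by
      rw [one_div, ← Real.rpow_neg_one]
      exact Real.rpow_le_rpow_of_exponent_ge hε (by linarith) (by norm_num)
    rw [div_eq_mul_one_div]
    gcongr
  · obtain ⟨w, hw, h⟩ := zoomsIn_preprocess_answer hd hP hk hkm hε hε'
    have hd' : (1 : ℝ) ≤ d := by exact_mod_cast hd
    have hm' : (1 : ℝ) ≤ m := by exact_mod_cast hk.trans hkm
    have h1 : 1 ≤ Real.logb 2 ((m : ℝ) / ε) := by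
      have := (two_le_size (d := 1) le_rfl (hk.trans hkm) hε hε').1
      simpa using this
    have h2 : 0 ≤ Real.logb 2 (d : ℝ) := Real.logb_nonneg (by norm_num) hd'
    -- `log d + x ≤ (1 + log d) * x` for `x = log (m / ε) ≥ 1`; this moves the dependence on `d`
    -- into the constant.
    have h3 : Real.logb 2 (m * d / ε) ≤ (1 + Real.logb 2 d) * Real.logb 2 (m / ε) := by
      have h4 : Real.logb 2 (m * d / ε) = Real.logb 2 d + Real.logb 2 (m / ε) := by
        rw [← Real.logb_mul (by positivity) (by positivity)]
        congr 1
        ring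
      rw [h4]
      nlinarith
    have h4 : 0 ≤ Real.logb 2 ((m : ℝ) * d / ε) :=
      zero_le_one.trans (two_le_size hd (hk.trans hkm) hε hε').1
    refine ⟨w, ?_, h _ (by norm_num) _ ?_⟩
    · have h5 : 1 + Real.logb 2 (d : ℝ) ≤ d * (1 + Real.logb 2 d) ^ 3 := by
        have h6 : 1 + Real.logb 2 (d : ℝ) ≤ (1 + Real.logb 2 d) ^ 3 :=
          le_self_pow₀ (by linarith) (by norm_num)
        exact h6.trans (le_mul_of_one_le_left (by positivity) hd')
      calc (w : ℝ) ≤ 9 * Real.logb 2 (m * d / ε) := hw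
        _ ≤ 3000000 * ((1 + Real.logb 2 d) * Real.logb 2 (m / ε)) := by nlinarith
        _ ≤ 3000000 * (d * (1 + Real.logb 2 d) ^ 3 * Real.logb 2 (m / ε)) := by gcongr
        _ = _ := by ring
    · calc 3000000 * ((m : ℝ) ^ 2 * d / ε) * Real.logb 2 (m * d / ε) ^ 3
          ≤ 3000000 * ((m : ℝ) ^ 2 * d / ε) * ((1 + Real.logb 2 d) * Real.logb 2 (m / ε)) ^ 3 := by
            gcongr
        _ = _ := by ring
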